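/- Let $\gamma>\alpha>\beta\ge 1$ and $m>0$ be real numbers, and let $f(u)=e^{-1/u^m}$ for $u>0$, $f(0)=0$. For $r_0>0$ and $a\ge 0$ consider the problem $$ (P_a)\qquad r^{-(\gamma-1)}\bigl(r^{\alpha}|u'|^{\beta-1}u'\bigr)'=\frac{1}{f(u)}\ \text{ and }\ u(r)>0\quad\text{for } 0<r<r_0,\qquad u(0)=a, $$ where a solution is a function $u\in C^2(0,r_0)\cap C[0,r_0)$. Then there exists $r_0>0$ such that the singular problem $(P_0)$ has a unique solution $u^*$ and, for every $a>0$, the problem $(P_a)$ has a unique solution $u(\cdot,a)$ (the regular solution). Furthermore, $$ u^*(r)=\bigl|(\gamma-\alpha+\beta)\log r\bigr|^{-1/m}\,(1+o(1))\quad\text{as } r\to 0^+, $$ and the following hold. (i) $u(\cdot,a)\to u^*$ in $C^2_{\rm loc}(0,r_0)\cap C_{\rm loc}[0,r_0)$ as $a\to 0^+$; that is, $u(\cdot,a)\to u^*$ uniformly on compact subsets of $[0,r_0)$, and the first and second derivatives converge uniformly on compact subsets of $(0,r_0)$. (ii) If $4\gamma>(\alpha-\beta)(\beta+4)$, then for every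 $\rho\in(0,r_0)$ the number of points $r\in(0,\rho)$ with $u(r,a)=u^*(r)$ tends to $\infty$ as $a\to 0^+$. -/

import Mathlib

open Set Filter Topology

noncomputable section

/-- The nonlinearity `f(u) = exp(-1/u^m)` for `u > 0`, extended by `0` for `u ≤ 0`. -/
def expNonlin (m : ℝ) (u : ℝ) : ℝ :=
  if 0 < u then Real.exp (-(1 / u ^ m)) else 0

/-- `u ∈ C²(0,r₀) ∩ C[0,r₀)` is a solution of
`r^{-(γ-1)} (r^α |u'|^{β-1} u')' = 1 / f(u)` and `u > 0` on `(0,r₀)`, with `u(0) = a`.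
The singular problem is the case `a = 0`; for `a > 0` these are the regular solutions.
Only the values of `u` on `[0,r₀)` matter. -/
structure IsRadialSolution (α β γ : ℝ) (f : ℝ → ℝ) (r₀ a : ℝ) (u : ℝ → ℝ) : Prop where
  contDiffOn : ContDiffOn ℝ 2 u (Ioo 0 r₀)
  continuousOn : ContinuousOn u (Ico 0 r₀)
  equation : ∀ r ∈ Ioo 0 r₀,
    r ^ (-(γ - 1)) * deriv (fun s => s ^ α * (|deriv u s| ^ (β - 1) * deriv u s)) r
      = 1 / f (u r)
  pos : ∀ r ∈ Ioo 0 r₀, 0 < u r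
  initial : u 0 = a

/-- `u` is, up to its irrelevant values outside `[0,r₀)`, the only solution with `u(0) = a`. -/
def IsUniqueRadialSolution (α β γ : ℝ) (f : ℝ → ℝ) (r₀ a : ℝ) (u : ℝ → ℝ) : Prop :=
  IsRadialSolution α β γ f r₀ a u ∧
    ∀ v : ℝ → ℝ, IsRadialSolution α β γ f r₀ a v → EqOn v u (Ico 0 r₀)

/-- `U a → u` in `C²_loc(0,r₀)` as `a → 0⁺`: the functions and their first two derivatives
converge uniformly on every compact subset of `(0,r₀)`. -/
def TendstoC2Loc (r₀ : ℝ) (U : ℝ → ℝ → ℝ) (u : ℝ → ℝ) : Prop :=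
  ∀ K : Set ℝ, K ⊆ Ioo 0 r₀ → IsCompact K →
    TendstoUniformlyOn U u (𝓝[>] 0) K ∧
    TendstoUniformlyOn (fun a => deriv (U a)) (deriv u) (𝓝[>] 0) K ∧
    TendstoUniformlyOn (fun a => deriv (deriv (U a))) (deriv (deriv u)) (𝓝[>] 0) K

/-- `U a → u` in `C_loc[0,r₀)` as `a → 0⁺`: uniformly on every compact subset of `[0,r₀)`. -/
def TendstoCLoc (r₀ : ℝ) (U : ℝ → ℝ → ℝ) (u : ℝ → ℝ) : Prop :=
  ∀ K : Set ℝ, K ⊆ Ico 0 r₀ → IsCompact K → TendstoUniformlyOn U u (𝓝[>] 0) K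

/-- The zero number of `h` on `I`: the number of `r ∈ I` with `h r = 0`, possibly infinite. -/
def zeroNumber (I : Set ℝ) (h : ℝ → ℝ) : ℕ∞ :=
  {r ∈ I | h r = 0}.encard

end

/-!
The Emden–Fowler change of variables reduces the radial problem to a perturbed Lotka–Volterra
system. Let `F = r^α (u')^β` be the flux, which is positive along every solution
(`IsRadialSolution.exists_isFluxPair`). In the time `t = log r`, the quantities `v = u^{-m}`,
`P = exp p = r F' / F` and `y = exp q = m u^{-m-1} r u'` satisfy

`v' = -y`, `P' / P = -(P - δ) - (y - θ)`, `y' / y = (P - δ) / β - κ y / v`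

with `δ = α - β`, `θ = γ - α + β`, `κ = (m + 1) / m`, and they determine the time through
`p + β q = v + κ β log v + θ t + β log m`. The term `κ y / v` is small where `u` is small, and
without it the system is of damped Lotka–Volterra type with the globally attracting equilibrium
`P = δ`, `y = θ`.

Backward differential inequalities bound `p` and `q` uniformly along all orbits (`IsOrbit.exp_p_le`,
`IsOrbit.level_le`, `IsOrbit.exists_q_le`, `IsOrbit.exists_le_p`). A solution with a small initial
value has a large value of `v` near `t = -∞`; it leaves the region of small `y`
(`IsOrbit.exists_le_q`), and a strict Lyapunov function then carries it to the equilibrium within a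
time that does not depend on the solution, while `v` remains large (`IsOrbit.exists_capture`). For
this, `r₀` has to be small. Near the equilibrium, the difference of two orbits solves a small
perturbation of the linearized system. That system contracts exponentially (`exists_contraction`).
As the contraction may start at any early time, two singular solutions agree
(`IsOrbitComparison.eq_of_tendsto_atTop`), and the regular solutions are Cauchy as `a → 0`; their
limit is the singular solution (`IsOrbitComparison.exists_limit`). Its asymptotics follow from the
formula for the time and the bounds on `p + β q` (`IsOrbit.tendsto_v_div`). The eigenvalues of the
linearized system are not real exactly if `δ β < 4 θ`, that is, if `4 γ > (α - β) (β + 4)`. Then the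
difference of two orbits rotates, so that its `v`-component vanishes in every interval of a fixed
length (`exists_zero_of_rotation`), and the number of such intervals before `log ρ` tends to
infinity.

A regular solution exists by a Volterra contraction (`exists_regular`). It is unique because `y` is
integrable at `-∞` and `P → γ` there, so that Gronwall's inequality applies from `-∞` on
(`IsOrbit.eq_of_tendsto`).
-/

noncomputable section

/-! ### Differential inequalities -/

theorem le_of_hasDerivAt_nonneg {f f' : ℝ → ℝ} {a b : ℝ} (hab : a ≤ b)
    (hc : ContinuousOn f (Icc a b)) (hd : ∀ x ∈ Ioo a b, HasDerivAt f (f' x) x)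
    (h : ∀ x ∈ Ioo a b, 0 ≤ f' x) : f a ≤ f b := by
  have hm : MonotoneOn f (Icc a b) := by
    apply monotoneOn_of_deriv_nonneg (convex_Icc a b) hc
    · rw [interior_Icc]
      exact fun x hx => (hd x hx).differentiableAt.differentiableWithinAt
    · rw [interior_Icc]
      intro x hx
      rw [(hd x hx).deriv]
      exact h x hx
  exact hm (left_mem_Icc.2 hab) (right_mem_Icc.2 hab) hab

theorem mul_exp_le_mul_exp {f f' : ℝ → ℝ} {a b k : ℝ} (hab : a ≤ b)
    (hc : ContinuousOn f (Icc a b)) (hd : ∀ x ∈ Ioo a b, HasDerivAt f (f' x) x)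
    (h : ∀ x ∈ Ioo a b, 0 ≤ f' x + k * f x) :
    f a * Real.exp (k * a) ≤ f b * Real.exp (k * b) := by
  refine le_of_hasDerivAt_nonneg (f := fun x => f x * Real.exp (k * x))
    (f' := fun x => (f' x + k * f x) * Real.exp (k * x)) hab (hc.mul (by fun_prop)) ?_ ?_
  · intro x hx
    have h1 : HasDerivAt (fun x => Real.exp (k * x)) (Real.exp (k * x) * k) x := by
      simpa using ((hasDerivAt_id x).const_mul k).exp
    refine ((hd x hx).mul h1).congr_deriv ?_
    ring
  · intro x hx
    exact mul_nonneg (h x hx) (Real.exp_pos _).le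

/-- A function that stays positive all the way down to `-∞` and satisfies `s' ≥ b - k s` lies
above the equilibrium `b / k`: otherwise it would decrease exponentially backwards. -/
theorem div_le_of_backward {s s' : ℝ → ℝ} {T b k : ℝ} (hk : 0 < k) (hpos : ∀ t < T, 0 < s t)
    (hd : ∀ t < T, HasDerivAt s (s' t) t) (h : ∀ t < T, b - k * s t ≤ s' t) :
    ∀ t < T, b / k ≤ s t := by
  intro t ht
  by_contra hlt
  push Not at hlt
  have key : ∀ r ≤ t, (s r - b / k) * Real.exp (k * r) ≤ (s t - b / k) * Real.exp (k * t) := by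
    intro r hr
    refine mul_exp_le_mul_exp (f := fun r => s r - b / k) (f' := s') hr ?_ ?_ ?_
    · intro x hx
      exact ((hd x (hx.2.trans_lt ht)).continuousAt.sub continuousAt_const).continuousWithinAt
    · intro x hx
      exact (hd x (hx.2.trans ht)).sub_const _
    · intro x hx
      have := h x (hx.2.trans ht)
      have e : k * (s x - b / k) = k * s x - b := by field_simp
      rw [e]; linarith
  set C := (s t - b / k) * Real.exp (k * t) with hC
  have hCneg : C < 0 := mul_neg_of_neg_of_pos (by linarith) (Real.exp_pos _)
  have htend : Tendsto (fun r => b / k * Real.exp (k * r)) atBot (𝓝 (b / k * 0)) :=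
    (Real.tendsto_exp_atBot.comp (tendsto_id.const_mul_atBot hk)).const_mul _
  rw [mul_zero] at htend
  have hev := htend.eventually (Iio_mem_nhds (show (0 : ℝ) < -C by linarith))
  obtain ⟨r, hr1, hr2⟩ := (hev.and (eventually_le_atBot t)).exists
  have h1 := key r hr2
  have h2 := mul_pos (hpos r (hr2.trans_lt ht)) (Real.exp_pos (k * r))
  have hr3 : b / k * Real.exp (k * r) < -C := hr1
  nlinarith

/-- If `s' ≤ b - k s` and `s` exceeds the equilibrium `b / k` somewhere, then `s` tends to
infinity backwards. -/
theorem tendsto_atTop_of_backward {s s' : ℝ → ℝ} {T b k t : ℝ} (hk : 0 < k) (ht : t < T)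
    (hd : ∀ t < T, HasDerivAt s (s' t) t) (h : ∀ t < T, s' t ≤ b - k * s t)
    (hlt : b / k < s t) : Tendsto s atBot atTop := by
  have key : ∀ r ≤ t, (s t - b / k) * Real.exp (k * t) ≤ (s r - b / k) * Real.exp (k * r) := by
    intro r hr
    have := mul_exp_le_mul_exp (f := fun r => -(s r - b / k)) (f' := fun r => - s' r) (k := k) hr
      ?_ ?_ ?_
    · linarith
    · intro x hx
      exact ((hd x (hx.2.trans_lt ht)).continuousAt.sub continuousAt_const).neg.continuousWithinAt
    · intro x hx
      exact ((hd x (hx.2.trans ht)).sub_const _).neg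
    · intro x hx
      have := h x (hx.2.trans ht)
      have e : k * -(s x - b / k) = b - k * s x := by field_simp; ring
      rw [e]; linarith
  set C := (s t - b / k) * Real.exp (k * t) with hC
  have hCpos : 0 < C := mul_pos (by linarith) (Real.exp_pos _)
  have h1 : Tendsto (fun r => C * Real.exp (-(k * r)) + b / k) atBot atTop := by
    apply tendsto_atTop_add_const_right
    apply Tendsto.const_mul_atTop hCpos
    apply Real.tendsto_exp_atTop.comp
    exact tendsto_neg_atBot_atTop.comp (tendsto_id.const_mul_atBot hk)
  refine tendsto_atTop_mono' _ ?_ h1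
  filter_upwards [eventually_le_atBot t] with r hr
  have := key r hr
  have e : Real.exp (-(k * r)) * Real.exp (k * r) = 1 := by
    rw [← Real.exp_add]; simp
  have e2 : C * Real.exp (-(k * r)) ≤ s r - b / k := by
    calc C * Real.exp (-(k * r)) ≤ (s r - b / k) * Real.exp (k * r) * Real.exp (-(k * r)) :=
          mul_le_mul_of_nonneg_right this (Real.exp_pos _).le
      _ = s r - b / k := by rw [mul_assoc, mul_comm (Real.exp (k * r)), e, mul_one]
  linarith

/-- A function whose derivative is eventually at most `-k < 0` near `-∞` tends to `+∞` there. -/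
theorem tendsto_atTop_of_deriv_le {s s' : ℝ → ℝ} {T k : ℝ} (hk : 0 < k)
    (hd : ∀ t < T, HasDerivAt s (s' t) t) (h : ∀ᶠ t in atBot, s' t ≤ -k) :
    Tendsto s atBot atTop := by
  obtain ⟨t, ht⟩ := ((eventually_forall_le_atBot.2 h).and (eventually_lt_atBot T)).exists
  have h1 : Tendsto (fun r => s t + k * t + -(k * r)) atBot atTop := by
    apply tendsto_atTop_add_const_left
    exact tendsto_neg_atBot_atTop.comp (tendsto_id.const_mul_atBot hk)
  refine tendsto_atTop_mono' _ ?_ h1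
  filter_upwards [eventually_le_atBot t] with r hr
  have := le_of_hasDerivAt_nonneg (f := fun r => -(s r + k * r)) (f' := fun r => -(s' r + k)) hr
    ?_ ?_ ?_
  · linarith
  · intro x hx
    have := (hd x (hx.2.trans_lt ht.2)).continuousAt
    exact ContinuousAt.continuousWithinAt (by fun_prop)
  · intro x hx
    exact ((hd x (hx.2.trans ht.2)).add (by simpa using (hasDerivAt_id x).const_mul k)).neg
  · intro x hx
    have := ht.1 x hx.2.le
    linarith

/-! ### Orbits of the Emden–Fowler system and their a priori bounds -/

/-- An orbit of the Emden–Fowler system on `(-∞, T)`. For a radial solution `u` with flux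
`F = r^α (u')^β`, in the time `t = log r`, the variables are `v = u^{-m}`, `exp p = r F' / F` and
`exp q = m u^{-m-1} r u'`; the parameters are `δ = α - β`, `θ = γ - α + β`, `κ = (m + 1) / m` and
`c = β log m`. The last field records that the three variables determine the time. -/
structure IsOrbit (β δ θ κ c T : ℝ) (v p q : ℝ → ℝ) : Prop where
  v_pos : ∀ t < T, 0 < v t
  deriv_v : ∀ t < T, HasDerivAt v (-Real.exp (q t)) t
  deriv_p : ∀ t < T, HasDerivAt p (-(Real.exp (p t) - δ) - (Real.exp (q t) - θ)) t
  deriv_q : ∀ t < T, HasDerivAt q ((Real.exp (p t) - δ) / β - κ * (Real.exp (q t) / v t)) t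
  level : ∀ t < T, p t + β * q t = v t + κ * β * Real.log (v t) + θ * t + c

namespace IsOrbit

variable {β δ θ κ c T : ℝ} {v p q : ℝ → ℝ}

theorem v_anti (h : IsOrbit β δ θ κ c T v p q) {s t : ℝ} (hst : s ≤ t) (ht : t < T) :
    v t ≤ v s := by
  have := le_of_hasDerivAt_nonneg (f := fun x => -v x) (f' := fun x => Real.exp (q x)) hst
    (fun x hx => (h.deriv_v x (hx.2.trans_lt ht)).continuousAt.neg.continuousWithinAt)
    (fun x hx => (h.deriv_v x (hx.2.trans ht)).neg.congr_deriv (neg_neg _))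
    (fun x _ => (Real.exp_pos _).le)
  linarith

/-- `s = exp (-p)` satisfies `s' ≥ 1 - (δ + θ) s`, so a value `s < 1 / (δ + θ)` would force `s` to
become negative backwards. -/
theorem exp_p_le (hδ : 0 < δ) (hθ : 0 < θ) (h : IsOrbit β δ θ κ c T v p q) {t : ℝ} (ht : t < T) :
    Real.exp (p t) ≤ δ + θ := by
  have := div_le_of_backward (s := fun t => Real.exp (-p t))
    (s' := fun t => Real.exp (-p t) * (-(-(Real.exp (p t) - δ) - (Real.exp (q t) - θ))))
    (T := T) (b := 1) (k := δ + θ) (by linarith) (fun t _ => Real.exp_pos _)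
    (fun t ht => (h.deriv_p t ht).neg.exp) ?_ t ht
  · rw [Real.exp_neg, one_div] at this
    exact (inv_le_inv₀ (by linarith) (Real.exp_pos _)).1 this
  · intro t ht
    have e : Real.exp (-p t) * Real.exp (p t) = 1 := by rw [← Real.exp_add]; simp
    have := mul_pos (Real.exp_pos (-p t)) (Real.exp_pos (q t))
    nlinarith

/-- Upper bound for the level `w = p + β q`: since `w' ≤ θ - exp q` and
`exp q ≥ (exp w / (δ + θ)) ^ (1 / β)`, a larger value would blow up backwards. -/
theorem level_le (hβ : 0 < β) (hδ : 0 < δ) (hθ : 0 < θ) (hκ : 0 < κ)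
    (h : IsOrbit β δ θ κ c T v p q) {t : ℝ} (ht : t < T) :
    p t + β * q t ≤ Real.log (δ + θ) + β * Real.log θ := by
  have hp : ∀ t < T, p t ≤ Real.log (δ + θ) := fun t ht =>
    (Real.le_log_iff_exp_le (by linarith)).2 (h.exp_p_le hδ hθ ht)
  have := div_le_of_backward (s := fun t => Real.exp (-((p t + β * q t) / β)))
    (s' := fun t => Real.exp (-((p t + β * q t) / β)) *
      (-((-(Real.exp (p t) - δ) - (Real.exp (q t) - θ)) + β * ((Real.exp (p t) - δ) / β
        - κ * (Real.exp (q t) / v t))) / β))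
    (T := T) (b := Real.exp (-(Real.log (δ + θ) / β)) / β) (k := θ / β) (by positivity)
    (fun t _ => Real.exp_pos _)
    (fun t ht => ?_) ?_ t ht
  · rw [div_div_div_cancel_right₀ hβ.ne', div_le_iff₀ hθ] at this
    have h1 : -(Real.log (δ + θ) / β) ≤ -((p t + β * q t) / β) + Real.log θ := by
      rwa [← Real.exp_le_exp, Real.exp_add, Real.exp_log hθ]
    have h2 := mul_le_mul_of_nonneg_left h1 hβ.le
    have e1 : β * -(Real.log (δ + θ) / β) = -Real.log (δ + θ) := by field_simp
    have e2 : β * (-((p t + β * q t) / β) + Real.log θ) = -(p t + β * q t) + β * Real.log θ := by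
      field_simp
    linarith
  · have h1 := (((h.deriv_p t ht).add ((h.deriv_q t ht).const_mul β)).div_const β).neg.exp
    refine h1.congr_deriv ?_
    congr 1
    exact (neg_div _ _).symm
  · intro t ht
    set w := p t + β * q t with hw
    have e0 : Real.exp (-(w / β)) * Real.exp (q t) = Real.exp (-(p t / β)) := by
      rw [← Real.exp_add]; congr 1; rw [hw]; field_simp; ring
    have e1 : Real.exp (-(Real.log (δ + θ) / β)) ≤ Real.exp (-(p t / β)) := by
      apply Real.exp_le_exp.2
      have := hp t ht
      have := div_le_div_of_nonneg_right this hβ.le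
      linarith
    have e2 : 0 ≤ Real.exp (-(w / β)) * (κ * (Real.exp (q t) / v t)) := by
      have := h.v_pos t ht
      positivity
    have e3 : Real.exp (-(w / β)) * (-((-(Real.exp (p t) - δ) - (Real.exp (q t) - θ))
        + β * ((Real.exp (p t) - δ) / β - κ * (Real.exp (q t) / v t))) / β)
        = (Real.exp (-(w / β)) * Real.exp (q t) - θ * Real.exp (-(w / β))) / β +
          Real.exp (-(w / β)) * (κ * (Real.exp (q t) / v t)) := by
      field_simp
      ring
    rw [e3, e0]
    have e4 : Real.exp (-(Real.log (δ + θ) / β)) / β - θ / β * Real.exp (-(w / β))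
      = (Real.exp (-(Real.log (δ + θ) / β)) - θ * Real.exp (-(w / β))) / β := by ring
    rw [e4]
    have := div_le_div_of_nonneg_right (sub_le_sub_right e1 (θ * Real.exp (-(w / β)))) hβ.le
    linarith

/-- Upper bound for `q`: by the bound on the level, `(exp (β q))' ≤ const - δ exp (β q)`, so a
larger value would make `q` and then `p` tend to infinity backwards. -/
theorem exists_q_le (hβ : 0 < β) (hδ : 0 < δ) (hθ : 0 < θ) (hκ : 0 < κ) :
    ∃ M : ℝ, ∀ (c T : ℝ) (v p q : ℝ → ℝ), IsOrbit β δ θ κ c T v p q → ∀ t < T, q t ≤ M := by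
  set W := Real.log (δ + θ) + β * Real.log θ with hW
  refine ⟨(W - Real.log δ) / β, fun c T v p q h t ht => ?_⟩
  by_contra hlt
  push Not at hlt
  rw [div_lt_iff₀ hβ] at hlt
  have hlim : Tendsto (fun t => Real.exp (β * q t)) atBot atTop := by
    refine tendsto_atTop_of_backward (k := δ) (b := Real.exp W) hδ ht
      (fun t ht => ((h.deriv_q t ht).const_mul β).exp) ?_ ?_
    · intro t ht
      have e0 : Real.exp (β * q t) * Real.exp (p t) ≤ Real.exp W := by
        rw [← Real.exp_add, Real.exp_le_exp]
        linarith [h.level_le hβ hδ hθ hκ ht]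
      have e2 : 0 ≤ Real.exp (β * q t) * (β * (κ * (Real.exp (q t) / v t))) := by
        have := h.v_pos t ht
        positivity
      have e3 : Real.exp (β * q t) * (β * ((Real.exp (p t) - δ) / β - κ * (Real.exp (q t) / v t)))
        = Real.exp (β * q t) * Real.exp (p t) - δ * Real.exp (β * q t)
          - Real.exp (β * q t) * (β * (κ * (Real.exp (q t) / v t))) := by
        field_simp
      linarith
    · conv_lhs => rw [← Real.exp_log hδ, ← Real.exp_sub]
      rw [Real.exp_lt_exp]
      linarith
  have hq : Tendsto q atBot atTop := by
    have h1 := Real.tendsto_log_atTop.comp hlim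
    have h2 : Tendsto (fun t => β * q t) atBot atTop := by
      refine h1.congr fun t => ?_
      simp
    exact (tendsto_const_mul_atTop_of_pos hβ).1 h2
  have hp : Tendsto p atBot atTop := by
    refine tendsto_atTop_of_deriv_le one_pos h.deriv_p ?_
    filter_upwards [(Real.tendsto_exp_atTop.comp hq).eventually_ge_atTop (δ + θ + 1)] with t ht
    simp only [Function.comp_apply] at ht
    linarith [Real.exp_pos (p t)]
  obtain ⟨s, hs1, hs2⟩ := ((hp.eventually_gt_atTop (Real.log (δ + θ))).and
    (eventually_lt_atBot T)).exists
  have := (Real.le_log_iff_exp_le (by linarith)).2 (h.exp_p_le hδ hθ hs2)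
  linarith

/-- Where `q` is bounded below, so is `p`: if `p` were very negative, it would have been so for a
long time before, and `q`, decreasing all along, would have exceeded its upper bound. -/
theorem exists_le_p (hβ : 0 < β) (hδ : 0 < δ) (hθ : 0 < θ) (hκ : 0 < κ) (η : ℝ) :
    ∃ M : ℝ, ∀ (c T : ℝ) (v p q : ℝ → ℝ), IsOrbit β δ θ κ c T v p q →
      ∀ t < T, η ≤ q t → M ≤ p t := by
  obtain ⟨Q, hQ⟩ := exists_q_le hβ hδ hθ hκ
  set S := 2 * β * (|Q - η| + 1) / δ with hS
  have hSpos : 0 < S := by positivity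
  refine ⟨Real.log (δ / 2) - Real.exp Q * S, fun c T v p q h t ht hη => ?_⟩
  by_contra hlt
  push Not at hlt
  have h1 : ∀ s ∈ Icc (t - S) t, p s ≤ Real.log (δ / 2) := by
    intro s hs
    have := le_of_hasDerivAt_nonneg (f := fun x => p x + Real.exp Q * x)
      (f' := fun x => (-(Real.exp (p x) - δ) - (Real.exp (q x) - θ)) + Real.exp Q) hs.2 ?_ ?_ ?_
    · have h3 : Real.exp Q * t - Real.exp Q * s ≤ Real.exp Q * S := by
        rw [← mul_sub]
        exact mul_le_mul_of_nonneg_left (by linarith [hs.1]) (Real.exp_pos _).le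
      linarith
    · intro x hx
      have := (h.deriv_p x (hx.2.trans_lt ht)).continuousAt
      exact ContinuousAt.continuousWithinAt (by fun_prop)
    · intro x hx
      exact (h.deriv_p x (hx.2.trans ht)).add (by
        simpa using (hasDerivAt_id x).const_mul (Real.exp Q))
    · intro x hx
      have e1 := Real.exp_le_exp.2 (hQ c T v p q h x (hx.2.trans ht))
      have e2 := h.exp_p_le hδ hθ (hx.2.trans ht)
      linarith
  have h2 := le_of_hasDerivAt_nonneg (f := fun x => -(q x + δ / (2 * β) * x))
    (f' := fun x => -(((Real.exp (p x) - δ) / β - κ * (Real.exp (q x) / v x)) + δ / (2 * β)))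
    (a := t - S) (b := t) (by linarith) ?_ ?_ ?_
  · have h3 := hQ c T v p q h (t - S) (by linarith)
    have h4 : δ / (2 * β) * S = |Q - η| + 1 := by rw [hS]; field_simp
    have h5 := le_abs_self (Q - η)
    have h6 : δ / (2 * β) * (t - S) = δ / (2 * β) * t - δ / (2 * β) * S := by ring
    linarith
  · intro x hx
    have := (h.deriv_q x (hx.2.trans_lt ht)).continuousAt
    exact ContinuousAt.continuousWithinAt (by fun_prop)
  · intro x hx
    exact ((h.deriv_q x (hx.2.trans ht)).add (by
        simpa using (hasDerivAt_id x).const_mul (δ / (2 * β)))).neg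
  · intro x hx
    have e1 : Real.exp (p x) ≤ δ / 2 := by
      have := Real.exp_le_exp.2 (h1 x ⟨hx.1.le, hx.2.le⟩)
      rwa [Real.exp_log (by positivity)] at this
    have e2 : 0 ≤ κ * (Real.exp (q x) / v x) := by
      have := h.v_pos x (hx.2.trans ht)
      positivity
    have e3 : (Real.exp (p x) - δ) / β ≤ (δ / 2 - δ) / β :=
      div_le_div_of_nonneg_right (by linarith) hβ.le
    have e4 : (δ / 2 - δ) / β = - (δ / (2 * β)) := by field_simp; ring
    linarith

/-- If `exp q ≤ e` from `-∞` on, then `exp p ≥ δ + θ - e`: otherwise `p` would tend to `-∞`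
backwards, which forces `q` to tend to `+∞`. -/
theorem le_exp_p_of_q_le (hβ : 0 < β) (hδ : 0 < δ) (hκ : 0 < κ)
    (h : IsOrbit β δ θ κ c T v p q) {t e : ℝ} (ht : t < T) (he : e < δ + θ)
    (hq' : ∀ s ≤ t, Real.exp (q s) ≤ e) {s : ℝ} (hs : s < t) : δ + θ - e ≤ Real.exp (p s) := by
  by_contra hlt
  push Not at hlt
  have hpos : 0 < δ + θ - e := by linarith
  have h1 : Tendsto (fun t => Real.exp (-p t)) atBot atTop := by
    refine tendsto_atTop_of_backward (T := t) (b := 1) (k := δ + θ - e) hpos hs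
      (fun t ht' => (h.deriv_p t (ht'.trans ht)).neg.exp) ?_ ?_
    · intro r hr
      have e1 : Real.exp (-p r) * Real.exp (p r) = 1 := by rw [← Real.exp_add]; simp
      have e2 := hq' r hr.le
      have e3 := mul_le_mul_of_nonneg_left e2 (Real.exp_pos (-p r)).le
      simp only [Pi.neg_apply]
      nlinarith
    · rw [Real.exp_neg, one_div]
      exact (inv_lt_inv₀ hpos (Real.exp_pos _)).2 hlt
  have h2 : Tendsto q atBot atTop := by
    refine tendsto_atTop_of_deriv_le (k := δ / (2 * β)) (by positivity) h.deriv_q ?_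
    filter_upwards [h1.eventually_ge_atTop (2 / δ), eventually_lt_atBot T] with r hr hrT
    have e1 : Real.exp (p r) ≤ δ / 2 := by
      rw [Real.exp_neg] at hr
      have := inv_anti₀ (by positivity) hr
      rwa [inv_inv, inv_div] at this
    have e2 : 0 ≤ κ * (Real.exp (q r) / v r) := by
      have := h.v_pos r hrT
      positivity
    have e3 : (Real.exp (p r) - δ) / β ≤ (δ / 2 - δ) / β :=
      div_le_div_of_nonneg_right (by linarith) hβ.le
    have e4 : (δ / 2 - δ) / β = - (δ / (2 * β)) := by field_simp; ring
    linarith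
  obtain ⟨r, hr1, hr2⟩ := (((Real.tendsto_exp_atTop.comp h2).eventually_gt_atTop e).and
    (eventually_le_atBot t)).exists
  exact absurd hr1 (not_lt.2 (hq' r hr2))

/-- As long as `exp q` stays small from `-∞` on, `exp p ≥ δ + θ - η`, so `exp q` grows
exponentially and `v`, the integral of `-exp q`, has hardly changed. -/
theorem exists_v_le_of_q_le (hβ : 0 < β) (hδ : 0 < δ) (hθ : 0 < θ) (hκ : 0 < κ) :
    ∃ η : ℝ, ∀ (c T : ℝ) (v p q : ℝ → ℝ), IsOrbit β δ θ κ c T v p q →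
      ∀ t < T, (∀ s ≤ t, q s ≤ η) → 1 ≤ v t → ∀ s ≤ t, v s ≤ v t + 1 := by
  obtain ⟨e, he0, he1, he2, he3⟩ : ∃ e : ℝ, 0 < e ∧ e ≤ θ / 4 ∧ κ * e ≤ θ / (4 * β) ∧
      2 * β * e / θ ≤ 1 := by
    refine ⟨min (θ / 4) (min (θ / (4 * β) / κ) (θ / (2 * β))), by positivity, min_le_left _ _,
      ?_, ?_⟩
    · have := (min_le_right (θ / 4) (min (θ / (4 * β) / κ) (θ / (2 * β)))).trans (min_le_left _ _)
      calc _ ≤ κ * (θ / (4 * β) / κ) := mul_le_mul_of_nonneg_left this hκ.le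
        _ = _ := by field_simp
    · have := (min_le_right (θ / 4) (min (θ / (4 * β) / κ) (θ / (2 * β)))).trans (min_le_right _ _)
      rw [div_le_one hθ]
      calc _ ≤ 2 * β * (θ / (2 * β)) := mul_le_mul_of_nonneg_left this (by positivity)
        _ = _ := by field_simp
  refine ⟨Real.log e, fun c T v p q h t ht hq hv s hs => ?_⟩
  have hq' : ∀ s ≤ t, Real.exp (q s) ≤ e := fun s hs =>
    (Real.le_log_iff_exp_le he0).1 (hq s hs)
  have hpl : ∀ s < t, δ + θ - e ≤ Real.exp (p s) := fun s hs =>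
    h.le_exp_p_of_q_le hβ hδ hκ ht (by linarith) hq' hs
  have h2 := le_of_hasDerivAt_nonneg (f := fun x => Real.exp (q x) + θ / (2 * β) * v x)
    (f' := fun x => Real.exp (q x) * ((Real.exp (p x) - δ) / β - κ * (Real.exp (q x) / v x))
      + θ / (2 * β) * (-Real.exp (q x))) hs ?_ ?_ ?_
  · have h3 := hq' t le_rfl
    have h4 := Real.exp_pos (q s)
    have h5 : θ / (2 * β) * (v s - v t) ≤ e := by linarith
    have h6 : v s - v t = 2 * β * (θ / (2 * β) * (v s - v t)) / θ := by field_simp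
    have h7 : 2 * β * (θ / (2 * β) * (v s - v t)) / θ ≤ 2 * β * e / θ :=
      div_le_div_of_nonneg_right (mul_le_mul_of_nonneg_left h5 (by positivity)) hθ.le
    linarith
  · intro x hx
    have h3 := (h.deriv_q x (hx.2.trans_lt ht)).continuousAt
    have h4 := (h.deriv_v x (hx.2.trans_lt ht)).continuousAt
    exact ContinuousAt.continuousWithinAt (by fun_prop)
  · intro x hx
    exact (h.deriv_q x (hx.2.trans ht)).exp.add ((h.deriv_v x (hx.2.trans ht)).const_mul _)
  · intro x hx
    have e1 := hpl x hx.2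
    have e2 := hq' x hx.2.le
    have e3 := h.v_anti hx.2.le ht
    have e4 : Real.exp (q x) / v x ≤ e := by
      rw [div_le_iff₀ (by linarith)]
      nlinarith
    have e5 : (3 * θ / 4) / β ≤ (Real.exp (p x) - δ) / β :=
      div_le_div_of_nonneg_right (by linarith) hβ.le
    have e6 : (3 * θ / 4) / β = θ / (2 * β) + θ / (4 * β) := by field_simp; ring
    have e7 := mul_le_mul_of_nonneg_left e4 hκ.le
    have e8 : 0 ≤ (Real.exp (p x) - δ) / β - κ * (Real.exp (q x) / v x) - θ / (2 * β) := by
      linarith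
    nlinarith [mul_nonneg (Real.exp_pos (q x)).le e8]

/-- An orbit with a large value of `v` before the time `N` must have left the region where `q` is
very negative before `N`. -/
theorem exists_le_q (hβ : 0 < β) (hδ : 0 < δ) (hθ : 0 < θ) (hκ : 0 < κ) :
    ∃ η : ℝ, ∀ c N : ℝ, ∃ B : ℝ, ∀ (T : ℝ) (v p q : ℝ → ℝ), IsOrbit β δ θ κ c T v p q →
      N < T → (∃ t ≤ N, B < v t) → ∃ t ≤ N, η ≤ q t := by
  obtain ⟨η, hη⟩ := exists_v_le_of_q_le hβ hδ hθ hκ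
  refine ⟨η, fun c N => ⟨max 1 (Real.log (δ + θ) + β * Real.log θ - θ * N - c) + 1,
    fun T v p q h hN ⟨t, htN, ht⟩ => ?_⟩⟩
  by_contra hcon
  push Not at hcon
  have h1 : 1 ≤ max 1 (Real.log (δ + θ) + β * Real.log θ - θ * N - c) := le_max_left _ _
  rcases le_or_gt 1 (v N) with hv | hv
  · have h2 := hη c T v p q h N hN (fun s hs => (hcon s hs).le) hv t htN
    have h3 := h.level N hN
    have h4 := h.level_le hβ hδ hθ hκ hN
    have h5 := Real.log_nonneg hv
    have h6 : 0 ≤ κ * β * Real.log (v N) := by positivity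
    have h7 := le_max_right 1 (Real.log (δ + θ) + β * Real.log θ - θ * N - c)
    linarith
  · have hcont : ContinuousOn v (Icc t N) := fun x hx =>
      (h.deriv_v x (hx.2.trans_lt hN)).continuousAt.continuousWithinAt
    obtain ⟨s, hs, hvs⟩ := intermediate_value_Icc' htN hcont
      (show (1 : ℝ) ∈ Icc (v N) (v t) from ⟨hv.le, by linarith⟩)
    have h2 := hη c T v p q h s (hs.2.trans_lt hN) (fun r hr => (hcon r (hr.trans hs.2)).le)
      hvs.ge t hs.1
    linarith

/-- If `v` has a finite limit at `-∞`, the integral of `exp q = -v'` there is finite; as `exp q` grows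
at most exponentially, it tends to zero. -/
theorem tendsto_exp_q (hβ : 0 < β) (hδ : 0 < δ) (hθ : 0 < θ) (hκ : 0 < κ)
    (h : IsOrbit β δ θ κ c T v p q) {A : ℝ} (hv : Tendsto v atBot (𝓝 A)) :
    Tendsto (fun t => Real.exp (q t)) atBot (𝓝 0) := by
  have key : ∀ t < T, Real.exp (q t) ≤ (v (t - 1) - v t) * Real.exp (θ / β) := by
    intro t ht
    have h1 : ∀ x ∈ Icc (t - 1) t, q t - θ / β ≤ q x := by
      intro x hx
      have := le_of_hasDerivAt_nonneg (f := fun x => -(q x - θ / β * x))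
        (f' := fun x => -(((Real.exp (p x) - δ) / β - κ * (Real.exp (q x) / v x)) - θ / β)) hx.2
        (fun y hy => ?_) (fun y hy => ?_) (fun y hy => ?_)
      · have h2 : θ / β * (t - x) ≤ θ / β * 1 :=
          mul_le_mul_of_nonneg_left (by linarith [hx.1]) (by positivity)
        linarith
      · have := (h.deriv_q y (hy.2.trans_lt ht)).continuousAt
        exact ContinuousAt.continuousWithinAt (by fun_prop)
      · exact ((h.deriv_q y (hy.2.trans ht)).sub (by
          simpa using (hasDerivAt_id y).const_mul (θ / β))).neg
      · have e1 := h.exp_p_le hδ hθ (hy.2.trans ht)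
        have e2 : 0 ≤ κ * (Real.exp (q y) / v y) := by
          have := h.v_pos y (hy.2.trans ht)
          positivity
        have e3 : (Real.exp (p y) - δ) / β ≤ θ / β :=
          div_le_div_of_nonneg_right (by linarith) hβ.le
        linarith
    have h2 := le_of_hasDerivAt_nonneg (f := fun x => -(v x + Real.exp (q t - θ / β) * x))
      (f' := fun x => -(-Real.exp (q x) + Real.exp (q t - θ / β))) (show t - 1 ≤ t by linarith)
      (fun y hy => ?_) (fun y hy => ?_) (fun y hy => ?_)
    · have e1 : Real.exp (q t) = Real.exp (q t - θ / β) * Real.exp (θ / β) := by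
        rw [← Real.exp_add]; congr 1; ring
      rw [e1]
      exact mul_le_mul_of_nonneg_right (by linarith) (Real.exp_pos _).le
    · have := (h.deriv_v y (hy.2.trans_lt ht)).continuousAt
      exact ContinuousAt.continuousWithinAt (by fun_prop)
    · exact ((h.deriv_v y (hy.2.trans ht)).add (by
          simpa using (hasDerivAt_id y).const_mul (Real.exp (q t - θ / β)))).neg
    · have := Real.exp_le_exp.2 (h1 y ⟨hy.1.le, hy.2.le⟩)
      linarith
  have hlim : Tendsto (fun t => (v (t - 1) - v t) * Real.exp (θ / β)) atBot (𝓝 0) := by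
    have h1 : Tendsto (fun t : ℝ => t - 1) atBot atBot := tendsto_atBot_add_const_right _ _ tendsto_id
    simpa using ((hv.comp h1).sub hv).mul_const (Real.exp (θ / β))
  refine tendsto_of_tendsto_of_tendsto_of_le_of_le' tendsto_const_nhds hlim
    (Eventually.of_forall fun t => (Real.exp_pos _).le) ?_
  filter_upwards [eventually_lt_atBot T] with t ht using key t ht

/-- Together with `eq_of_tendsto`: a regular orbit is determined by the limit of `v` at `-∞`, because
it forces `exp p → δ + θ`. -/
theorem tendsto_p (hβ : 0 < β) (hδ : 0 < δ) (hθ : 0 < θ) (hκ : 0 < κ)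
    (h : IsOrbit β δ θ κ c T v p q) {A : ℝ} (hv : Tendsto v atBot (𝓝 A)) :
    Tendsto p atBot (𝓝 (Real.log (δ + θ))) := by
  have hq := h.tendsto_exp_q hβ hδ hθ hκ hv
  have hP : Tendsto (fun t => Real.exp (p t)) atBot (𝓝 (δ + θ)) := by
    rw [tendsto_order]
    constructor
    · intro b hb
      have he : 0 < min ((δ + θ - b) / 2) ((δ + θ) / 2) := by
        have : 0 < δ + θ - b := by linarith
        positivity
      obtain ⟨t, ht, htT⟩ := ((eventually_forall_le_atBot.2 (hq.eventually (Iic_mem_nhds he))).and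
        (eventually_lt_atBot T)).exists
      filter_upwards [eventually_lt_atBot t] with s hs
      have h1 := h.le_exp_p_of_q_le hβ hδ hκ htT
        (e := min ((δ + θ - b) / 2) ((δ + θ) / 2))
        (by linarith [min_le_right ((δ + θ - b) / 2) ((δ + θ) / 2)]) ht hs
      linarith [min_le_left ((δ + θ - b) / 2) ((δ + θ) / 2)]
    · intro b hb
      filter_upwards [eventually_lt_atBot T] with s hs
      exact (h.exp_p_le hδ hθ hs).trans_lt hb
  simpa using hP.log (by positivity)

end IsOrbit

/-! ### The Lyapunov function and capture near the equilibrium -/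

theorem mul_sub_log_le (a x : ℝ) (ha : 0 < a) :
    Real.exp x - a - a * (x - Real.log a) ≤ (Real.exp x - a) ^ 2 / Real.exp x := by
  have h1 := Real.add_one_le_exp (Real.log a - x)
  rw [Real.exp_sub, Real.exp_log ha] at h1
  have h2 := mul_le_mul_of_nonneg_left h1 ha.le
  have h3 : (Real.exp x - a) ^ 2 / Real.exp x
      = Real.exp x - 2 * a + a * (a / Real.exp x) := by
    have := Real.exp_pos x
    field_simp
    ring
  rw [h3]
  linarith

theorem le_mul_sub_log (a x : ℝ) (ha : 0 < a) :
    (Real.exp x - a) ^ 2 / (2 * (Real.exp x + a)) ≤ Real.exp x - a - a * (x - Real.log a) := by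
  set s := Real.exp ((x - Real.log a) / 2) with hs
  have hs0 : 0 < s := Real.exp_pos _
  have h1 := Real.add_one_le_exp ((x - Real.log a) / 2)
  rw [← hs] at h1
  have h2 : Real.exp x = a * s ^ 2 := by
    rw [hs, ← Real.exp_nat_mul]
    conv_rhs => rw [← Real.exp_log ha, ← Real.exp_add]
    simp
    ring
  rw [h2, div_le_iff₀ (by positivity)]
  have h3 : a * (s - 1) ^ 2 ≤ a * s ^ 2 - a - a * (x - Real.log a) := by nlinarith
  calc (a * s ^ 2 - a) ^ 2 ≤ a * (s - 1) ^ 2 * (2 * (a * s ^ 2 + a)) := by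
        have : 0 ≤ a ^ 2 * (s - 1) ^ 4 := by positivity
        nlinarith
    _ ≤ _ := mul_le_mul_of_nonneg_right h3 (by positivity)

/-- The Lyapunov function of the Lotka–Volterra system
`p' = -(exp p - δ) - (exp q - θ)`, `q' = (exp p - δ) / β`, to which the Emden–Fowler system reduces
in the limit `v → ∞`. It vanishes only at the equilibrium `exp p = δ`, `exp q = θ`. -/
def lyapunov (β δ θ p q : ℝ) : ℝ :=
  (Real.exp p - δ - δ * (p - Real.log δ)) / β + (Real.exp q - θ - θ * (q - Real.log θ))

section

variable {β δ θ : ℝ}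

theorem lyapunov_le {M : ℝ} (hβ : 0 < β) (hδ : 0 < δ) (hθ : 0 < θ) {p q : ℝ} (hM : 0 < M)
    (hp : M ≤ Real.exp p) (hq : M ≤ Real.exp q) :
    lyapunov β δ θ p q ≤ (1 / β + 1) / M * ((Real.exp p - δ) ^ 2 + (Real.exp q - θ) ^ 2) := by
  have h1 := mul_sub_log_le δ p hδ
  have h2 := mul_sub_log_le θ q hθ
  have h3 : (Real.exp p - δ) ^ 2 / Real.exp p ≤ (Real.exp p - δ) ^ 2 / M :=
    div_le_div_of_nonneg_left (sq_nonneg _) hM hp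
  have h4 : (Real.exp q - θ) ^ 2 / Real.exp q ≤ (Real.exp q - θ) ^ 2 / M :=
    div_le_div_of_nonneg_left (sq_nonneg _) hM hq
  have h5 := div_le_div_of_nonneg_right (h1.trans h3) hβ.le
  have h6 : (1 / β + 1) / M * ((Real.exp p - δ) ^ 2 + (Real.exp q - θ) ^ 2)
      = (Real.exp p - δ) ^ 2 / M / β + (Real.exp q - θ) ^ 2 / M
        + ((Real.exp p - δ) ^ 2 / M + (Real.exp q - θ) ^ 2 / M / β) := by
    field_simp
    ring
  have h7 : 0 ≤ (Real.exp p - δ) ^ 2 / M + (Real.exp q - θ) ^ 2 / M / β := by positivity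
  rw [h6, lyapunov]
  linarith

/-- With `lyapunov_le`: on bounded sets away from `exp p = 0` and `exp q = 0`, the Lyapunov function
is comparable to the squared distance to the equilibrium. -/
theorem le_lyapunov {G : ℝ} (hβ : 0 < β) (hδ : 0 < δ) (hθ : 0 < θ) {p q : ℝ}
    (hδG : δ ≤ G) (hθG : θ ≤ G) (hp : Real.exp p ≤ G) (hq : Real.exp q ≤ G) :
    1 / (4 * G * (1 + β)) * ((Real.exp p - δ) ^ 2 + (Real.exp q - θ) ^ 2)
      ≤ lyapunov β δ θ p q := by
  have hG : 0 < G := hδ.trans_le hδG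
  have h1 := le_mul_sub_log δ p hδ
  have h2 := le_mul_sub_log θ q hθ
  have h3 : (Real.exp p - δ) ^ 2 / (4 * G) ≤ (Real.exp p - δ) ^ 2 / (2 * (Real.exp p + δ)) :=
    div_le_div_of_nonneg_left (sq_nonneg _) (by positivity) (by linarith)
  have h4 : (Real.exp q - θ) ^ 2 / (4 * G) ≤ (Real.exp q - θ) ^ 2 / (2 * (Real.exp q + θ)) :=
    div_le_div_of_nonneg_left (sq_nonneg _) (by positivity) (by linarith)
  have h5 := div_le_div_of_nonneg_right (h3.trans h1) hβ.le
  have h6 : 1 / (4 * G * (1 + β)) * (Real.exp p - δ) ^ 2 ≤ (Real.exp p - δ) ^ 2 / (4 * G) / β := by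
    rw [div_div, one_div, inv_mul_eq_div]
    exact div_le_div_of_nonneg_left (sq_nonneg _) (by positivity) (by nlinarith)
  have h7 : 1 / (4 * G * (1 + β)) * (Real.exp q - θ) ^ 2 ≤ (Real.exp q - θ) ^ 2 / (4 * G) := by
    rw [one_div, inv_mul_eq_div]
    exact div_le_div_of_nonneg_left (sq_nonneg _) (by positivity) (by nlinarith)
  rw [lyapunov]
  linarith

theorem le_of_lyapunov_le {C : ℝ} (hβ : 0 < β) (hδ : 0 < δ) (hθ : 0 < θ) {p q : ℝ}
    (h : lyapunov β δ θ p q ≤ C) :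
    Real.log δ - (C * β + δ) / δ ≤ p ∧ Real.log θ - (C + θ) / θ ≤ q := by
  have h1 := le_mul_sub_log δ p hδ
  have h2 := le_mul_sub_log θ q hθ
  have h3 : 0 ≤ (Real.exp p - δ) ^ 2 / (2 * (Real.exp p + δ)) := by positivity
  have h4 : 0 ≤ (Real.exp q - θ) ^ 2 / (2 * (Real.exp q + θ)) := by positivity
  have h5 := div_nonneg (h3.trans h1) hβ.le
  rw [lyapunov] at h
  have h6 : (Real.exp p - δ - δ * (p - Real.log δ)) / β ≤ C := by linarith
  rw [div_le_iff₀ hβ] at h6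
  have h7 := Real.exp_pos p
  have h8 := Real.exp_pos q
  constructor
  · have : Real.log δ - p ≤ (C * β + δ) / δ := by
      rw [le_div_iff₀ hδ]; linarith
    linarith
  · have : Real.log θ - q ≤ (C + θ) / θ := by
      rw [le_div_iff₀ hθ]; linarith
    linarith

end

/-- Adding a small multiple of the cross term makes the Lyapunov function of the Lotka–Volterra
system strict on bounded sets; the term `κ exp q / v`, of size `ξ = 1 / v`, only contributes a
small constant. Here `X = exp p - δ`, `Y = exp q - θ`. -/
theorem strict_lyapunov_ineq {β κ G M μ X Y P y ξ Z : ℝ} (hβ : 0 < β) (hκ : 0 < κ) (hG : 0 < G)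
    (hM : 0 < M) (hμ : 0 < μ) (hμ1 : μ ≤ 1)
    (hμ2 : μ * (G / β + G ^ 2 / (2 * M)) ≤ 1 / (2 * β)) (hX : |X| ≤ G) (hY : |Y| ≤ G)
    (hMP : M ≤ P) (hPG : P ≤ G) (hy : 0 ≤ y) (hyG : y ≤ G) (hξ : 0 ≤ ξ) (hξZ : ξ ≤ Z) :
    -X ^ 2 / β - κ * Y * y * ξ + μ * (-P * X * Y - P * Y ^ 2 + y * X ^ 2 / β - κ * X * y ^ 2 * ξ)
      ≤ -min (1 / (2 * β)) (μ * M / 2) * (X ^ 2 + Y ^ 2) + (κ * G ^ 2 + κ * G ^ 3) * Z := by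
  have e1 : -κ * Y * y * ξ ≤ κ * G ^ 2 * Z := by
    have a1 : -Y * y ≤ G * G := by
      have : -Y ≤ G := (neg_le_abs Y).trans hY
      calc -Y * y ≤ G * y := mul_le_mul_of_nonneg_right this hy
        _ ≤ G * G := mul_le_mul_of_nonneg_left hyG hG.le
    have a2 : -Y * y * ξ ≤ G * G * Z :=
      calc -Y * y * ξ ≤ G * G * ξ := mul_le_mul_of_nonneg_right a1 hξ
        _ ≤ _ := mul_le_mul_of_nonneg_left hξZ (by positivity)
    nlinarith
  have e2 : μ * (-κ * X * y ^ 2 * ξ) ≤ κ * G ^ 3 * Z := by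
    have a0 : y ^ 2 ≤ G ^ 2 := pow_le_pow_left₀ hy hyG 2
    have a1 : -X * y ^ 2 ≤ G * G ^ 2 := by
      have : -X ≤ G := (neg_le_abs X).trans hX
      calc -X * y ^ 2 ≤ G * y ^ 2 := mul_le_mul_of_nonneg_right this (by positivity)
        _ ≤ G * G ^ 2 := mul_le_mul_of_nonneg_left a0 hG.le
    have a2 : -X * y ^ 2 * ξ ≤ G * G ^ 2 * Z :=
      calc -X * y ^ 2 * ξ ≤ G * G ^ 2 * ξ := mul_le_mul_of_nonneg_right a1 hξ
        _ ≤ _ := mul_le_mul_of_nonneg_left hξZ (by positivity)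
    have a3 : -κ * X * y ^ 2 * ξ ≤ κ * G ^ 3 * Z := by nlinarith
    have a4 : 0 ≤ κ * G ^ 3 * Z := by
      have := hξ.trans hξZ
      positivity
    nlinarith
  have e3 : -P * X * Y ≤ M / 2 * Y ^ 2 + G ^ 2 / (2 * M) * X ^ 2 := by
    have a1 : -P * X * Y ≤ G * |X| * |Y| := by
      have : -(X * Y) ≤ |X| * |Y| := by rw [← abs_mul]; exact neg_le_abs _
      have h0 : 0 ≤ |X| * |Y| := by positivity
      have hP : 0 ≤ P := hM.le.trans hMP
      nlinarith
    have a2 : M / 2 * Y ^ 2 + G ^ 2 / (2 * M) * X ^ 2 - G * |X| * |Y|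
        = (M * |Y| - G * |X|) ^ 2 / (2 * M) := by
      rw [← sq_abs X, ← sq_abs Y]
      field_simp
      ring
    have a3 : 0 ≤ (M * |Y| - G * |X|) ^ 2 / (2 * M) := by positivity
    linarith
  have e4 : -P * Y ^ 2 ≤ -M * Y ^ 2 := by nlinarith [sq_nonneg Y]
  have e5 : y * X ^ 2 / β ≤ G / β * X ^ 2 := by
    rw [mul_div_right_comm]
    exact mul_le_mul_of_nonneg_right (div_le_div_of_nonneg_right hyG hβ.le) (sq_nonneg X)
  have e6 : μ * (-P * X * Y - P * Y ^ 2 + y * X ^ 2 / β)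
      ≤ μ * ((G / β + G ^ 2 / (2 * M)) * X ^ 2 - M / 2 * Y ^ 2) :=
    mul_le_mul_of_nonneg_left (by linarith) hμ.le
  have e7 := mul_le_mul_of_nonneg_right hμ2 (sq_nonneg X)
  have e8 := mul_le_mul_of_nonneg_right (min_le_left (1 / (2 * β)) (μ * M / 2)) (sq_nonneg X)
  have e9 := mul_le_mul_of_nonneg_right (min_le_right (1 / (2 * β)) (μ * M / 2)) (sq_nonneg Y)
  have e10 : -X ^ 2 / β = -(1 / (2 * β) * X ^ 2) - (1 / (2 * β) * X ^ 2) := by field_simp; ring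
  rw [e10]
  linarith

theorem abs_mul_mul_le {μ : ℝ} (hμ : 0 ≤ μ) (X Y : ℝ) :
    |μ * (X * Y)| ≤ μ / 2 * (X ^ 2 + Y ^ 2) := by
  rw [abs_mul, abs_of_nonneg hμ, abs_mul, ← sq_abs X, ← sq_abs Y]
  nlinarith [mul_nonneg hμ (sq_nonneg (|X| - |Y|))]

namespace IsOrbit

variable {β δ θ κ : ℝ}

theorem hasDerivAt_lyapunov_add (hβ : 0 < β) {c T : ℝ} {v p q : ℝ → ℝ}
    (h : IsOrbit β δ θ κ c T v p q) (μ : ℝ) {t : ℝ} (ht : t < T) :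
    HasDerivAt (fun t => lyapunov β δ θ (p t) (q t)
        + μ * ((Real.exp (p t) - δ) * (Real.exp (q t) - θ)))
      (-(Real.exp (p t) - δ) ^ 2 / β - κ * (Real.exp (q t) - θ) * Real.exp (q t) * (1 / v t)
        + μ * (-Real.exp (p t) * (Real.exp (p t) - δ) * (Real.exp (q t) - θ)
          - Real.exp (p t) * (Real.exp (q t) - θ) ^ 2
          + Real.exp (q t) * (Real.exp (p t) - δ) ^ 2 / β
          - κ * (Real.exp (p t) - δ) * Real.exp (q t) ^ 2 * (1 / v t))) t := by
  have hp := h.deriv_p t ht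
  have hq := h.deriv_q t ht
  have hv := h.v_pos t ht
  have h1 := ((((hp.exp.sub_const δ).sub ((hp.sub_const (Real.log δ)).const_mul δ)).div_const β).add
    ((hq.exp.sub_const θ).sub ((hq.sub_const (Real.log θ)).const_mul θ))).add
    (((hp.exp.sub_const δ).mul (hq.exp.sub_const θ)).const_mul μ)
  refine h1.congr_deriv ?_
  field_simp
  ring

/-- As long as `v` is large, an orbit that starts with a bounded value of the Lyapunov function
keeps a bounded value, and after a time that depends on the bounds only, a small one. -/
theorem exists_lyapunov_le (hβ : 0 < β) (hδ : 0 < δ) (hθ : 0 < θ) (hκ : 0 < κ) {V₀ ε : ℝ}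
    (hV₀ : 0 ≤ V₀) (hε : 0 < ε) :
    ∃ R > 0, ∃ τ ≥ 0, ∀ (c T : ℝ) (v p q : ℝ → ℝ), IsOrbit β δ θ κ c T v p q →
      ∀ t₀ t₁, t₀ ≤ t₁ → t₁ < T → R ≤ v t₁ → lyapunov β δ θ (p t₀) (q t₀) ≤ V₀ →
        lyapunov β δ θ (p t₁) (q t₁) ≤ 3 * V₀ + 1 ∧
        (t₀ + τ ≤ t₁ → lyapunov β δ θ (p t₁) (q t₁) ≤ ε) := by
  obtain ⟨Q, hQ⟩ := exists_q_le hβ hδ hθ hκ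
  set G := δ + θ + Real.exp Q with hG
  have hexpQ := Real.exp_pos Q
  have hG0 : 0 < G := by positivity
  set V₁ := 3 * V₀ + 1 with hV₁
  set M := Real.exp (min (Real.log δ - (V₁ * β + δ) / δ) (Real.log θ - (V₁ + θ) / θ)) with hM
  have hM0 : 0 < M := Real.exp_pos _
  set k₁ := 1 / (4 * G * (1 + β)) with hk₁
  have hk₁0 : 0 < k₁ := by positivity
  set k₂ := (1 / β + 1) / M with hk₂
  have hk₂0 : 0 < k₂ := by positivity
  obtain ⟨μ, hμ0, hμ1, hμk, hμ2⟩ : ∃ μ : ℝ, 0 < μ ∧ μ ≤ 1 ∧ μ ≤ k₁ ∧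
      μ * (G / β + G ^ 2 / (2 * M)) ≤ 1 / (2 * β) := by
    refine ⟨min 1 (min k₁ (1 / (2 * β) / (G / β + G ^ 2 / (2 * M)))), by positivity,
      min_le_left _ _, (min_le_right _ _).trans (min_le_left _ _), ?_⟩
    rw [← le_div_iff₀ (by positivity)]
    exact (min_le_right _ _).trans (min_le_right _ _)
  set c₁ := min (1 / (2 * β)) (μ * M / 2) with hc₁
  have hc₁0 : 0 < c₁ := by positivity
  set c₂ := c₁ / (k₂ + 1) with hc₂
  have hc₂0 : 0 < c₂ := by positivity
  set K := κ * G ^ 2 + κ * G ^ 3 with hK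
  have hK0 : 0 < K := by positivity
  have hm : 0 < min (1 / 4) (ε / 4) := by positivity
  -- For `v ≥ R`, the modified Lyapunov function `L` satisfies `L' ≤ -c₂ L + K / R` as long as the
  -- Lyapunov function stays below `V₁`, and `K / (c₂ R)` is as small as needed for both claims.
  set R := K / (c₂ * min (1 / 4) (ε / 4)) with hR
  have hR0 : 0 < R := by positivity
  clear_value R K c₂ c₁ k₂ k₁ M V₁ G
  refine ⟨R, hR0, 6 * V₀ / (ε * c₂), by positivity, fun c T v p q h t₀ t₁ ht01 ht1 hv hV => ?_⟩
  obtain ⟨V, hVdef⟩ : ∃ V : ℝ → ℝ, V = fun t => lyapunov β δ θ (p t) (q t) := ⟨_, rfl⟩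
  obtain ⟨L, hLdef⟩ : ∃ L : ℝ → ℝ, L = fun t => lyapunov β δ θ (p t) (q t)
    + μ * ((Real.exp (p t) - δ) * (Real.exp (q t) - θ)) := ⟨_, rfl⟩
  have hVt : ∀ t, lyapunov β δ θ (p t) (q t) = V t := fun t => by rw [hVdef]
  have hL : ∀ t, L t = V t + μ * ((Real.exp (p t) - δ) * (Real.exp (q t) - θ)) := fun t => by
    rw [hLdef, hVdef]
  have hLderiv := fun (t : ℝ) (ht : t < T) => h.hasDerivAt_lyapunov_add hβ μ ht
  rw [← hLdef] at hLderiv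
  rw [hVt] at hV ⊢
  have hpG : ∀ t < T, Real.exp (p t) ≤ G := fun t ht => by
    have := h.exp_p_le hδ hθ ht
    linarith
  have hqG : ∀ t < T, Real.exp (q t) ≤ G := fun t ht => by
    have := Real.exp_le_exp.2 (hQ c T v p q h t ht)
    linarith
  have hlow : ∀ t < T, k₁ * ((Real.exp (p t) - δ) ^ 2 + (Real.exp (q t) - θ) ^ 2) ≤ V t :=
    fun t ht => by
      rw [← hVt, hk₁]
      exact le_lyapunov hβ hδ hθ (by linarith) (by linarith) (hpG t ht) (hqG t ht)
  have hcross : ∀ t < T, |μ * ((Real.exp (p t) - δ) * (Real.exp (q t) - θ))| ≤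
      μ / 2 * ((Real.exp (p t) - δ) ^ 2 + (Real.exp (q t) - θ) ^ 2) := by
    exact fun t _ => abs_mul_mul_le hμ0.le _ _
  have hcross' : ∀ t < T, |μ * ((Real.exp (p t) - δ) * (Real.exp (q t) - θ))| ≤ V t / 2 := by
    intro t ht
    have h1 := hcross t ht
    have h2 := hlow t ht
    have h3 : 0 ≤ (Real.exp (p t) - δ) ^ 2 + (Real.exp (q t) - θ) ^ 2 := by positivity
    have h4 := h1.trans (mul_le_mul_of_nonneg_right (show μ / 2 ≤ k₁ / 2 by linarith) h3)
    rw [div_mul_eq_mul_div] at h4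
    exact h4.trans (div_le_div_of_nonneg_right h2 zero_le_two)
  have hKR : K * (1 / R) / c₂ ≤ min (1 / 4) (ε / 4) := by
    rw [hR]
    apply le_of_eq
    field_simp
  have hcontV : ∀ t < T, ContinuousAt V t := fun t ht => by
    have h1 := (h.deriv_p t ht).continuousAt
    have h2 := (h.deriv_q t ht).continuousAt
    simp only [hVdef, lyapunov]
    fun_prop
  have hcontL : ∀ t < T, ContinuousAt L t := fun t ht =>
    (hLderiv t ht).continuousAt
  have hdecay : ∀ s, t₀ ≤ s → s ≤ t₁ → (∀ t ∈ Ioo t₀ s, V t ≤ V₁) →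
      V s ≤ 2 * (min (1 / 4) (ε / 4)) + 3 * V₀ * Real.exp (-(c₂ * (s - t₀))) := by
    intro s hs0 hs1 hb
    have h1 := mul_exp_le_mul_exp (f := fun t => -(L t - K * (1 / R) / c₂)) (k := c₂) hs0
      (fun x hx => ((hcontL x ((hx.2.trans hs1).trans_lt ht1)).sub
        continuousAt_const).neg.continuousWithinAt)
      (fun x hx => ((hLderiv x ((hx.2.le.trans hs1).trans_lt ht1)).sub_const _).neg) ?_
    · have h2 : (L s - K * (1 / R) / c₂) ≤
          (L t₀ - K * (1 / R) / c₂) * Real.exp (-(c₂ * (s - t₀))) := by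
        have h3 := mul_le_mul_of_nonneg_right h1 (Real.exp_pos (-(c₂ * s))).le
        have e1 : Real.exp (c₂ * s) * Real.exp (-(c₂ * s)) = 1 := by
          rw [← Real.exp_add]; simp
        have e2 : Real.exp (c₂ * t₀) * Real.exp (-(c₂ * s)) = Real.exp (-(c₂ * (s - t₀))) := by
          rw [← Real.exp_add]; congr 1; ring
        rw [mul_assoc, e2, mul_assoc, e1] at h3
        linarith
      have h3 : L t₀ ≤ 3 / 2 * V₀ := by
        have := (le_abs_self _).trans (hcross' t₀ (ht01.trans_lt ht1))
        rw [hL]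
        linarith
      have h4 : V s ≤ 2 * L s := by
        have := (neg_le_abs _).trans (hcross' s (hs1.trans_lt ht1))
        rw [hL]
        linarith
      have h5 := Real.exp_pos (-(c₂ * (s - t₀)))
      have h6 : 0 ≤ K * (1 / R) / c₂ := by positivity
      have h7 := mul_le_mul_of_nonneg_right h3 h5.le
      have h8 := mul_nonneg h6 h5.le
      linarith
    · intro x hx
      have hxT : x < T := (hx.2.le.trans hs1).trans_lt ht1
      obtain ⟨hp1, hq1⟩ := le_of_lyapunov_le hβ hδ hθ ((hVt x).trans_le (hb x hx))
      have hMp : M ≤ Real.exp (p x) := by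
        rw [hM]; exact Real.exp_le_exp.2 ((min_le_left _ _).trans hp1)
      have hMq : M ≤ Real.exp (q x) := by
        rw [hM]; exact Real.exp_le_exp.2 ((min_le_right _ _).trans hq1)
      have hvx : R ≤ v x := hv.trans (h.v_anti (hx.2.le.trans hs1) ht1)
      have h2 := strict_lyapunov_ineq (X := Real.exp (p x) - δ) (Y := Real.exp (q x) - θ)
        (P := Real.exp (p x)) (y := Real.exp (q x)) (ξ := 1 / v x) (Z := 1 / R)
        hβ hκ hG0 hM0 hμ0 hμ1 hμ2
        (abs_le.2 ⟨by linarith [Real.exp_pos (p x)], by linarith [hpG x hxT]⟩)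
        (abs_le.2 ⟨by linarith [Real.exp_pos (q x)], by linarith [hqG x hxT]⟩)
        hMp (hpG x hxT) (Real.exp_pos _).le (hqG x hxT) (one_div_nonneg.2 (h.v_pos x hxT).le)
        (one_div_le_one_div_of_le hR0 hvx)
      rw [← hc₁, ← hK] at h2
      have h3 : L x ≤ (k₂ + 1) * ((Real.exp (p x) - δ) ^ 2 + (Real.exp (q x) - θ) ^ 2) := by
        have a1 := lyapunov_le hβ hδ hθ hM0 hMp hMq
        rw [hVt, ← hk₂] at a1
        have a2 := (le_abs_self _).trans (hcross x hxT)
        have a3 : 0 ≤ (Real.exp (p x) - δ) ^ 2 + (Real.exp (q x) - θ) ^ 2 := by positivity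
        have a4 := a2.trans (mul_le_mul_of_nonneg_right (show μ / 2 ≤ 1 by linarith) a3)
        rw [hL, add_mul]
        exact add_le_add a1 a4
      have h4 : c₂ * L x ≤ c₁ * ((Real.exp (p x) - δ) ^ 2 + (Real.exp (q x) - θ) ^ 2) := by
        have := mul_le_mul_of_nonneg_left h3 hc₂0.le
        have e : c₂ * (k₂ + 1) = c₁ := by rw [hc₂]; field_simp
        rwa [← mul_assoc, e] at this
      have e : c₂ * -(L x - K * (1 / R) / c₂) = K * (1 / R) - c₂ * L x := by field_simp; ring
      rw [e]
      have h5 : ∀ d D, d ≤ -c₁ * D + K * (1 / R) → c₂ * L x ≤ c₁ * D →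
          0 ≤ -d + (K * (1 / R) - c₂ * L x) := fun d D h5 h6 => by linarith
      exact h5 _ _ h2 h4
  have hexp1 : ∀ s, t₀ ≤ s → Real.exp (-(c₂ * (s - t₀))) ≤ 1 := fun s hs => by
    rw [Real.exp_le_one_iff]
    nlinarith
  have hmin1 : min (1 / 4) (ε / 4) ≤ 1 / 4 := min_le_left _ _
  have hmin2 : min (1 / 4) (ε / 4) ≤ ε / 4 := min_le_right _ _
  -- The bound `V ≤ V₁` cannot be violated for the first time: the decay estimate up to that time
  -- would give `V < V₁` there.
  have hall : ∀ t ∈ Icc t₀ t₁, V t ≤ V₁ := by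
    by_contra hcon
    push Not at hcon
    obtain ⟨t, ht, hVt⟩ := hcon
    have hcomp : IsCompact (Icc t₀ t ∩ {s | V₁ ≤ V s}) := by
      have hcl : IsClosed (Icc t₀ t ∩ V ⁻¹' Ici V₁) :=
        ContinuousOn.preimage_isClosed_of_isClosed
          (fun x hx => (hcontV x ((hx.2.trans ht.2).trans_lt ht1)).continuousWithinAt)
          isClosed_Icc isClosed_Ici
      exact isCompact_Icc.of_isClosed_subset hcl inter_subset_left
    obtain ⟨s, hs, hmin⟩ := hcomp.exists_isLeast ⟨t, ⟨ht.1, le_rfl⟩, hVt.le⟩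
    have h1 := hdecay s hs.1.1 (hs.1.2.trans ht.2) (fun x hx => by
      by_contra hlt
      push Not at hlt
      have := hmin ⟨⟨hx.1.le, hx.2.le.trans hs.1.2⟩, hlt.le⟩
      linarith [hx.2])
    have h2 : V₁ ≤ V s := hs.2
    have h3 := mul_le_mul_of_nonneg_left (hexp1 s hs.1.1) (show 0 ≤ 3 * V₀ by linarith)
    linarith
  refine ⟨hV₁ ▸ hall t₁ ⟨ht01, le_rfl⟩, fun hτ => ?_⟩
  have h1 := hdecay t₁ ht01 le_rfl (fun x hx => hall x ⟨hx.1.le, hx.2.le⟩)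
  have h2 : 3 * V₀ * Real.exp (-(c₂ * (t₁ - t₀))) ≤ ε / 2 := by
    rw [Real.exp_neg, ← div_eq_mul_inv, div_le_iff₀ (Real.exp_pos _)]
    have h3 := Real.add_one_le_exp (c₂ * (t₁ - t₀))
    have h4 : 6 * V₀ / ε ≤ c₂ * (t₁ - t₀) := by
      have := mul_le_mul_of_nonneg_left (show 6 * V₀ / (ε * c₂) ≤ t₁ - t₀ by linarith) hc₂0.le
      have e : c₂ * (6 * V₀ / (ε * c₂)) = 6 * V₀ / ε := by field_simp
      rwa [e] at this
    have h5 : ε / 2 * (6 * V₀ / ε) = 3 * V₀ := by field_simp; ring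
    have h6 := mul_le_mul_of_nonneg_left (h4.trans (by linarith : c₂ * (t₁ - t₀) ≤
      Real.exp (c₂ * (t₁ - t₀)))) (half_pos hε).le
    linarith
  linarith

/-- Orbits on `(-∞, T')` with `T'` close to `-∞` that reach a large value of `v` before the time
`N` are, from a fixed time after `N` on, close to the equilibrium, with `v` large. -/
theorem exists_capture (hβ : 0 < β) (hδ : 0 < δ) (hθ : 0 < θ) (hκ : 0 < κ) (c : ℝ) {ε : ℝ}
    (hε : 0 < ε) (R₀ : ℝ) :
    ∃ T : ℝ, ∃ τ ≥ 0, ∃ B : ℝ → ℝ, ∀ T' ≤ T, ∀ v p q : ℝ → ℝ, IsOrbit β δ θ κ c T' v p q →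
      ∀ N < T', (∃ t ≤ N, B N < v t) → ∀ t, N + τ ≤ t → t < T' →
        |Real.exp (p t) - δ| ≤ ε ∧ |Real.exp (q t) - θ| ≤ ε ∧ R₀ ≤ v t := by
  obtain ⟨η, hη⟩ := exists_le_q hβ hδ hθ hκ
  choose B hB using hη c
  obtain ⟨M, hM⟩ := exists_le_p hβ hδ hθ hκ η
  obtain ⟨Q, hQ⟩ := exists_q_le hβ hδ hθ hκ
  set G := δ + θ + Real.exp Q with hG
  have hexpQ := Real.exp_pos Q
  have hG0 : 0 < G := by positivity
  set V₀ := (1 / β + 1) / Real.exp (min M η) * (G ^ 2 + G ^ 2) with hV₀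
  have hV₀0 : 0 ≤ V₀ := by positivity
  obtain ⟨R, hR0, τ, hτ, hlyap⟩ := exists_lyapunov_le hβ hδ hθ hκ hV₀0
    (show 0 < 1 / (4 * G * (1 + β)) * ε ^ 2 by positivity)
  set R₁ := max R R₀ with hR₁
  set V₁ := 3 * V₀ + 1 with hV₁
  set W := (Real.log δ - (V₁ * β + δ) / δ) + β * (Real.log θ - (V₁ + θ) / θ) with hW
  -- A bound on the Lyapunov function bounds the level below by `W`, and before this time a level of
  -- at least `W` requires `v > R₁`.
  refine ⟨(W - c - (R₁ + κ * β * Real.log R₁) - 1) / θ, τ, hτ, B,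
    fun T' hT v p q h N hN hbig t ht htT => ?_⟩
  obtain ⟨t₀, ht₀N, hηt⟩ := hB N T' v p q h hN hbig
  have ht₀T : t₀ < T' := ht₀N.trans_lt hN
  have hMt := hM c T' v p q h t₀ ht₀T hηt
  have hpG : ∀ t < T', Real.exp (p t) ≤ G := fun t ht => by
    have := h.exp_p_le hδ hθ ht
    linarith
  have hqG : ∀ t < T', Real.exp (q t) ≤ G := fun t ht => by
    have := Real.exp_le_exp.2 (hQ c T' v p q h t ht)
    linarith
  have hVt₀ : lyapunov β δ θ (p t₀) (q t₀) ≤ V₀ := by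
    refine (lyapunov_le hβ hδ hθ (Real.exp_pos (min M η))
      (Real.exp_le_exp.2 ((min_le_left _ _).trans hMt))
      (Real.exp_le_exp.2 ((min_le_right _ _).trans hηt))).trans ?_
    refine mul_le_mul_of_nonneg_left (add_le_add ?_ ?_) (by positivity)
    · exact sq_le_sq' (by linarith [Real.exp_pos (p t₀)]) (by linarith [hpG t₀ ht₀T])
    · exact sq_le_sq' (by linarith [Real.exp_pos (q t₀)]) (by linarith [hqG t₀ ht₀T])
  have hvlarge : ∀ s < T', lyapunov β δ θ (p s) (q s) ≤ V₁ → R₁ < v s := by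
    intro s hs hV
    by_contra hle
    push Not at hle
    obtain ⟨h1, h2⟩ := le_of_lyapunov_le hβ hδ hθ hV
    have h3 := h.level s hs
    have h4 := mul_le_mul_of_nonneg_left h2 hβ.le
    have h5 := mul_le_mul_of_nonneg_left (Real.log_le_log (h.v_pos s hs) hle)
      (mul_pos hκ hβ).le
    have h6 := (hs.le.trans hT)
    rw [le_div_iff₀ hθ] at h6
    nlinarith
  -- Thus `v` cannot drop to `R₁`: up to that time the Lyapunov function would be bounded by `V₁`,
  -- and so would it at that time, where it forces `v > R₁`.
  have hvt : ∀ s, t₀ ≤ s → s < T' → R₁ ≤ v s := by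
    intro s hs hsT
    by_contra hlt
    push Not at hlt
    have h0 := hvlarge t₀ ht₀T (by linarith)
    obtain ⟨r, hr, hvr⟩ := intermediate_value_Icc' hs
      (fun x hx => (h.deriv_v x (hx.2.trans_lt hsT)).continuousAt.continuousWithinAt)
      (show R₁ ∈ Icc (v s) (v t₀) from ⟨hlt.le, h0.le⟩)
    have hrT := hr.2.trans_lt hsT
    have h1 := (hlyap c T' v p q h t₀ r hr.1 hrT (by rw [hvr]; exact le_max_left _ _) hVt₀).1
    linarith [hvlarge r hrT h1]
  have ht₀t : t₀ ≤ t := by linarith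
  have hvR := hvt t ht₀t htT
  have hfin := (hlyap c T' v p q h t₀ t ht₀t htT ((le_max_left _ _).trans hvR) hVt₀).2 (by linarith)
  have hlow := (le_lyapunov hβ hδ hθ (G := G) (by linarith) (by linarith) (hpG t htT)
    (hqG t htT)).trans hfin
  have hsum := le_of_mul_le_mul_left hlow (by positivity)
  refine ⟨?_, ?_, (le_max_right _ _).trans hvR⟩
  · exact abs_le_of_sq_le_sq (by linarith [sq_nonneg (Real.exp (q t) - θ)]) hε.le
  · exact abs_le_of_sq_le_sq (by linarith [sq_nonneg (Real.exp (p t) - δ)]) hε.le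

end IsOrbit

/-! ### Perturbed linear systems: contraction and rotation -/

/-- The linear system `X' = -δ X - θ Y`, `Y' = (δ / β) X` contracts exponentially, and so does every
small perturbation of it: a quadratic form with a small cross term is a strict Lyapunov
function. -/
theorem exists_contraction {β δ θ : ℝ} (hβ : 0 < β) (hδ : 0 < δ) (hθ : 0 < θ) :
    ∃ ε > 0, ∃ C > 0, ∃ k > 0, ∀ (X Y e₁ e₂ : ℝ → ℝ) (s t : ℝ), s ≤ t →
      (∀ r ∈ Icc s t, HasDerivAt X (-δ * X r - θ * Y r + e₁ r) r) →
      (∀ r ∈ Icc s t, HasDerivAt Y (δ / β * X r + e₂ r) r) →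
      (∀ r ∈ Icc s t, |e₁ r| ≤ ε * (|X r| + |Y r|)) →
      (∀ r ∈ Icc s t, |e₂ r| ≤ ε * (|X r| + |Y r|)) →
      X t ^ 2 + Y t ^ 2 ≤ C * Real.exp (-(k * (t - s))) * (X s ^ 2 + Y s ^ 2) := by
  obtain ⟨a, ha⟩ : ∃ a, a = δ / β := ⟨_, rfl⟩
  have ha0 : 0 < a := by rw [ha]; positivity
  -- The quadratic form is `a X² + θ Y² + 2 μ X Y`. Without the cross term, it only decreases
  -- through `X`; the last condition on `μ` keeps half of this decrease.
  obtain ⟨μ, hμ0, hμa, hμθ, hμ1⟩ : ∃ μ : ℝ, 0 < μ ∧ μ ≤ a / 2 ∧ μ ≤ θ / 2 ∧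
      μ * (2 * a + δ ^ 2 / θ) ≤ δ * a := by
    refine ⟨min (a / 2) (min (θ / 2) (δ * a / (2 * a + δ ^ 2 / θ))), by positivity,
      min_le_left _ _, (min_le_right _ _).trans (min_le_left _ _), ?_⟩
    rw [← le_div_iff₀ (by positivity)]
    exact (min_le_right _ _).trans (min_le_right _ _)
  obtain ⟨c₀, hc₀, hc₀1, hc₀2⟩ : ∃ c₀ : ℝ, 0 < c₀ ∧ c₀ ≤ δ * a ∧ c₀ ≤ μ * θ :=
    ⟨min (δ * a) (μ * θ), by positivity, min_le_left _ _, min_le_right _ _⟩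
  obtain ⟨K, hK⟩ : ∃ K, K = 2 * (2 * a + 2 * θ + 4 * μ) := ⟨_, rfl⟩
  have hK0 : 0 < K := by rw [hK]; positivity
  obtain ⟨k₁, hk₁, hk₁a, hk₁θ⟩ : ∃ k₁ : ℝ, 0 < k₁ ∧ k₁ ≤ a / 2 ∧ k₁ ≤ θ / 2 :=
    ⟨min (a / 2) (θ / 2), by positivity, min_le_left _ _, min_le_right _ _⟩
  obtain ⟨k₂, hk₂⟩ : ∃ k₂, k₂ = a + θ + μ := ⟨_, rfl⟩
  have hk₂0 : 0 < k₂ := by rw [hk₂]; positivity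
  refine ⟨c₀ / (2 * K), by positivity, k₂ / k₁, by positivity, c₀ / 2 / k₂, by positivity,
    fun X Y e₁ e₂ s t hst hX hY he₁ he₂ => ?_⟩
  rw [← ha] at hY
  have hlow : ∀ x y : ℝ, k₁ * (x ^ 2 + y ^ 2) ≤ a * x ^ 2 + θ * y ^ 2 + 2 * μ * (x * y) := by
    intro x y
    have h1 := mul_le_mul_of_nonneg_right hk₁a (sq_nonneg x)
    have h2 := mul_le_mul_of_nonneg_right hk₁θ (sq_nonneg y)
    have h3 := mul_le_mul_of_nonneg_right hμa (sq_nonneg x)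
    have h4 := mul_le_mul_of_nonneg_right hμθ (sq_nonneg y)
    have h5 := mul_nonneg hμ0.le (sq_nonneg (x + y))
    linarith
  have hup : ∀ x y : ℝ, a * x ^ 2 + θ * y ^ 2 + 2 * μ * (x * y) ≤ k₂ * (x ^ 2 + y ^ 2) := by
    intro x y
    have h5 := mul_nonneg hμ0.le (sq_nonneg (x - y))
    have h6 := mul_nonneg ha0.le (sq_nonneg y)
    have h7 := mul_nonneg hθ.le (sq_nonneg x)
    rw [hk₂]
    linarith
  have hder : ∀ r ∈ Icc s t, HasDerivAt (fun r => -(a * X r ^ 2 + θ * Y r ^ 2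
      + 2 * μ * (X r * Y r)))
      (-(a * (2 * X r * (-δ * X r - θ * Y r + e₁ r)) + θ * (2 * Y r * (a * X r + e₂ r))
        + 2 * μ * ((-δ * X r - θ * Y r + e₁ r) * Y r + X r * (a * X r + e₂ r)))) r := by
    intro r hr
    have h1 := hX r hr
    have h2 := hY r hr
    refine (((((h1.pow 2).const_mul a).add ((h2.pow 2).const_mul θ)).add
      ((h1.mul h2).const_mul (2 * μ))).neg).congr_deriv ?_
    simp
  have hineq : ∀ x y f₁ f₂ : ℝ, |f₁| ≤ c₀ / (2 * K) * (|x| + |y|) →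
      |f₂| ≤ c₀ / (2 * K) * (|x| + |y|) →
      a * (2 * x * (-δ * x - θ * y + f₁)) + θ * (2 * y * (a * x + f₂))
        + 2 * μ * ((-δ * x - θ * y + f₁) * y + x * (a * x + f₂)) ≤
      -(c₀ / 2) * (x ^ 2 + y ^ 2) := by
    intro x y f₁ f₂ h1 h2
    have hz : 0 ≤ |x| + |y| := by positivity
    have hprod : ∀ z f : ℝ, |z| ≤ |x| + |y| → |f| ≤ c₀ / (2 * K) * (|x| + |y|) →
        z * f ≤ c₀ / (2 * K) * (|x| + |y|) ^ 2 := by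
      intro z f hz1 hf
      calc z * f ≤ |z| * |f| := by rw [← abs_mul]; exact le_abs_self _
        _ ≤ (|x| + |y|) * (c₀ / (2 * K) * (|x| + |y|)) :=
            mul_le_mul hz1 hf (abs_nonneg _) hz
        _ = _ := by ring
    have hx' : |x| ≤ |x| + |y| := by linarith [abs_nonneg y]
    have hy' : |y| ≤ |x| + |y| := by linarith [abs_nonneg x]
    have p1 := mul_le_mul_of_nonneg_left (hprod x f₁ hx' h1) (show 0 ≤ 2 * a by positivity)
    have p2 := mul_le_mul_of_nonneg_left (hprod y f₂ hy' h2) (show 0 ≤ 2 * θ by positivity)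
    have p3 := mul_le_mul_of_nonneg_left (hprod y f₁ hy' h1) (show 0 ≤ 2 * μ by positivity)
    have p4 := mul_le_mul_of_nonneg_left (hprod x f₂ hx' h2) (show 0 ≤ 2 * μ by positivity)
    have p5 : (|x| + |y|) ^ 2 ≤ 2 * (x ^ 2 + y ^ 2) := by
      rw [← sq_abs x, ← sq_abs y]; nlinarith [sq_nonneg (|x| - |y|)]
    have p6 : (2 * a + 2 * θ + 4 * μ) * (c₀ / (2 * K) * (|x| + |y|) ^ 2)
        ≤ c₀ / 2 * (x ^ 2 + y ^ 2) := by
      have e1 : c₀ / 2 * (x ^ 2 + y ^ 2)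
          = (2 * a + 2 * θ + 4 * μ) * (c₀ / (2 * K) * (2 * (x ^ 2 + y ^ 2))) := by
        rw [hK]; field_simp
      rw [e1]
      exact mul_le_mul_of_nonneg_left (mul_le_mul_of_nonneg_left p5 (by positivity))
        (by positivity)
    have p7 : -(2 * δ * (x * y)) ≤ θ * y ^ 2 + δ ^ 2 / θ * x ^ 2 := by
      have e1 : θ * y ^ 2 + δ ^ 2 / θ * x ^ 2 + 2 * δ * (x * y) = (θ * y + δ * x) ^ 2 / θ := by
        field_simp; ring
      have : 0 ≤ (θ * y + δ * x) ^ 2 / θ := by positivity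
      linarith
    have p8 := mul_le_mul_of_nonneg_left p7 hμ0.le
    have p9 := mul_le_mul_of_nonneg_right hμ1 (sq_nonneg x)
    have p10 := mul_le_mul_of_nonneg_right hc₀1 (sq_nonneg x)
    have p11 := mul_le_mul_of_nonneg_right hc₀2 (sq_nonneg y)
    linarith
  have key := mul_exp_le_mul_exp (k := c₀ / 2 / k₂) hst
    (fun x hx => (hder x hx).continuousAt.continuousWithinAt)
    (fun x hx => hder x ⟨hx.1.le, hx.2.le⟩) (fun x hx => by
      have hx' : x ∈ Icc s t := ⟨hx.1.le, hx.2.le⟩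
      have h1 := hineq (X x) (Y x) (e₁ x) (e₂ x) (he₁ x hx') (he₂ x hx')
      have h2 := mul_le_mul_of_nonneg_left (hup (X x) (Y x))
        (show 0 ≤ c₀ / 2 / k₂ by positivity)
      rw [← mul_assoc (c₀ / 2 / k₂) k₂, div_mul_cancel₀ _ hk₂0.ne'] at h2
      linarith)
  have h1 := hlow (X t) (Y t)
  have h2 := hup (X s) (Y s)
  have h3 := mul_le_mul_of_nonneg_right h2 (Real.exp_pos (-(c₀ / 2 / k₂ * (t - s)))).le
  have h4 := mul_le_mul_of_nonneg_right key (Real.exp_pos (-(c₀ / 2 / k₂ * t))).le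
  have e1 : Real.exp (c₀ / 2 / k₂ * t) * Real.exp (-(c₀ / 2 / k₂ * t)) = 1 := by
    rw [← Real.exp_add]; simp
  have e2 : Real.exp (c₀ / 2 / k₂ * s) * Real.exp (-(c₀ / 2 / k₂ * t))
      = Real.exp (-(c₀ / 2 / k₂ * (t - s))) := by
    rw [← Real.exp_add]; congr 1; ring
  rw [mul_assoc _ (Real.exp (c₀ / 2 / k₂ * s)), e2, mul_assoc _ (Real.exp (c₀ / 2 / k₂ * t)),
    e1] at h4
  have h5 : k₁ * (X t ^ 2 + Y t ^ 2)
      ≤ k₂ * (X s ^ 2 + Y s ^ 2) * Real.exp (-(c₀ / 2 / k₂ * (t - s))) := by linarith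
  calc X t ^ 2 + Y t ^ 2 = k₁ * (X t ^ 2 + Y t ^ 2) / k₁ := by field_simp
    _ ≤ k₂ * (X s ^ 2 + Y s ^ 2) * Real.exp (-(c₀ / 2 / k₂ * (t - s))) / k₁ :=
        div_le_div_of_nonneg_right h5 hk₁.le
    _ = _ := by ring

/-- If the matrix of the linear system `X' = -δ X - θ Y`, `Y' = (δ / β) X` has non-real
eigenvalues, solutions of small perturbations rotate: `X + β Y` vanishes on every interval of a
fixed length. Indeed `arctan (Y / (X + β Y))` grows at least linearly as long as it is defined. -/
theorem exists_zero_of_rotation {β δ θ : ℝ} (hβ : 0 < β) (hδ : 0 < δ) (hθ : 0 < θ)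
    (hdisc : δ * β < 4 * θ) :
    ∃ ε > 0, ∃ ℓ > 0, ∀ (X Y e₁ e₂ : ℝ → ℝ) (s : ℝ),
      (∀ r ∈ Icc s (s + ℓ), HasDerivAt X (-δ * X r - θ * Y r + e₁ r) r) →
      (∀ r ∈ Icc s (s + ℓ), HasDerivAt Y (δ / β * X r + e₂ r) r) →
      (∀ r ∈ Icc s (s + ℓ), |e₁ r| ≤ ε * (|X r| + |Y r|)) →
      (∀ r ∈ Icc s (s + ℓ), |e₂ r| ≤ ε * (|X r| + |Y r|)) →
      ∃ r ∈ Icc s (s + ℓ), X r + β * Y r = 0 := by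
  obtain ⟨a, ha⟩ : ∃ a, a = δ / β := ⟨_, rfl⟩
  have ha0 : 0 < a := by rw [ha]; positivity
  have haβ : β * a = δ := by rw [ha]; field_simp
  have hdisc' : 0 < 4 * a * θ - δ ^ 2 := by
    have : 4 * a * θ - δ ^ 2 = a * (4 * θ - δ * β) := by rw [← haβ]; ring
    rw [this]
    exact mul_pos ha0 (by linarith)
  obtain ⟨c, hc⟩ : ∃ c, c = (4 * a * θ - δ ^ 2) / (4 * (a + θ)) := ⟨_, rfl⟩
  have hc0 : 0 < c := by rw [hc]; positivity
  have hc1 : 4 * c * (a + θ) = 4 * a * θ - δ ^ 2 := by rw [hc]; field_simp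
  have hca : 0 < a - c := by
    have : 4 * (a - c) * (a + θ) = 4 * a ^ 2 + δ ^ 2 := by linear_combination -hc1
    have h2 : 0 < 4 * (a - c) * (a + θ) := by rw [this]; positivity
    have h3 : 0 < 4 * (a + θ) := by positivity
    nlinarith
  -- With `D = X + β Y`, the numerator of the derivative of `Y / D` is the quadratic form
  -- `a D² - δ Y D + θ Y²`, which is positive definite exactly if the eigenvalues are not real.
  have hform : ∀ D y : ℝ, c * (D ^ 2 + y ^ 2) ≤ a * D ^ 2 - δ * y * D + θ * y ^ 2 := by
    intro D y
    have h1 : 4 * (a - c) * ((a * D ^ 2 - δ * y * D + θ * y ^ 2) - c * (D ^ 2 + y ^ 2))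
        = (2 * (a - c) * D - δ * y) ^ 2 + (2 * c * y) ^ 2 := by
      linear_combination (- y ^ 2) * hc1
    have h2 : 0 ≤ 4 * (a - c) * ((a * D ^ 2 - δ * y * D + θ * y ^ 2) - c * (D ^ 2 + y ^ 2)) := by
      rw [h1]; positivity
    have h3 := nonneg_of_mul_nonneg_right h2 (by positivity)
    linarith
  obtain ⟨ε, hε⟩ : ∃ ε, ε = c / (4 * (1 + β) ^ 2) := ⟨_, rfl⟩
  have hε0 : 0 < ε := by rw [hε]; positivity
  have hεc : ε * (2 * (1 + β) ^ 2) = c / 2 := by rw [hε]; field_simp; ring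
  -- The angle `arctan (Y / D)` grows at the rate `c / 2` at least, and its range has length `π`.
  refine ⟨ε, hε0, 2 * Real.pi / c, by positivity, fun X Y e₁ e₂ s hX hY he₁ he₂ => ?_⟩
  by_contra hcon
  push Not at hcon
  rw [← ha] at hY
  have hineq : ∀ x y f₁ f₂ : ℝ, |f₁| ≤ ε * (|x| + |y|) → |f₂| ≤ ε * (|x| + |y|) →
      c / 2 * ((x + β * y) ^ 2 + y ^ 2) ≤ (a * x + f₂) * (x + β * y)
        - y * ((-δ * x - θ * y + f₁) + β * (a * x + f₂)) := by
    intro x y f₁ f₂ h1 h2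
    obtain ⟨D, hD⟩ : ∃ D, D = x + β * y := ⟨_, rfl⟩
    have hx : x = D - β * y := by rw [hD]; ring
    have h0 := hform D y
    have h3 : |x| + |y| ≤ |D| + (1 + β) * |y| := by
      have : |x| ≤ |D| + β * |y| := by
        rw [hx]
        calc |D - β * y| ≤ |D| + |β * y| := abs_sub _ _
          _ = _ := by rw [abs_mul, abs_of_pos hβ]
      linarith
    have hE : |f₂ * D - y * (f₁ + β * f₂)| ≤ ε * (2 * (1 + β) ^ 2) * (D ^ 2 + y ^ 2) := by
      have g1 := h1.trans (mul_le_mul_of_nonneg_left h3 hε0.le)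
      have g2 := h2.trans (mul_le_mul_of_nonneg_left h3 hε0.le)
      have g3 : |f₁ + β * f₂| ≤ (1 + β) * (ε * (|D| + (1 + β) * |y|)) := by
        calc |f₁ + β * f₂| ≤ |f₁| + β * |f₂| := by
              refine (abs_add_le _ _).trans ?_
              rw [abs_mul, abs_of_pos hβ]
          _ ≤ _ := by linarith [mul_le_mul_of_nonneg_left g2 hβ.le]
      have g4 : (|D| + (1 + β) * |y|) ^ 2 ≤ 2 * (1 + β) ^ 2 * (D ^ 2 + y ^ 2) := by
        rw [← sq_abs D, ← sq_abs y]
        nlinarith [sq_nonneg (|D| - (1 + β) * |y|), mul_nonneg hβ.le (sq_nonneg (|D|)),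
          mul_nonneg (sq_nonneg β) (sq_nonneg (|D|))]
      calc |f₂ * D - y * (f₁ + β * f₂)| ≤ |f₂| * |D| + |y| * |f₁ + β * f₂| := by
            rw [← abs_mul, ← abs_mul]; exact abs_sub _ _
        _ ≤ ε * (|D| + (1 + β) * |y|) * |D| + |y| * ((1 + β) * (ε * (|D| + (1 + β) * |y|))) :=
            add_le_add (mul_le_mul_of_nonneg_right g2 (abs_nonneg _))
              (mul_le_mul_of_nonneg_left g3 (abs_nonneg _))
        _ = ε * (|D| + (1 + β) * |y|) ^ 2 := by ring
        _ ≤ ε * (2 * (1 + β) ^ 2 * (D ^ 2 + y ^ 2)) := mul_le_mul_of_nonneg_left g4 hε0.le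
        _ = _ := by ring
    rw [hεc] at hE
    have hE' := (abs_le.1 hE).1
    have e1 : (a * x + f₂) * (x + β * y) - y * ((-δ * x - θ * y + f₁) + β * (a * x + f₂))
        = (a * D ^ 2 - δ * y * D + θ * y ^ 2) + (f₂ * D - y * (f₁ + β * f₂)) := by
      rw [hx, ← haβ]; ring
    rw [e1, ← hD]
    linarith
  have hder : ∀ r ∈ Icc s (s + 2 * Real.pi / c),
      HasDerivAt (fun r => Real.arctan (Y r / (X r + β * Y r)) - c / 2 * r)
      (1 / (1 + (Y r / (X r + β * Y r)) ^ 2) * (((a * X r + e₂ r) * (X r + β * Y r)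
        - Y r * ((-δ * X r - θ * Y r + e₁ r) + β * (a * X r + e₂ r)))
        / (X r + β * Y r) ^ 2) - c / 2) r := by
    intro r hr
    have h1 := ((hY r hr).div ((hX r hr).add ((hY r hr).const_mul β)) (hcon r hr)).arctan
    exact h1.sub (by simpa using (hasDerivAt_id r).const_mul (c / 2))
  have hlen : 0 ≤ 2 * Real.pi / c := by positivity
  have key := le_of_hasDerivAt_nonneg (show s ≤ s + 2 * Real.pi / c by linarith)
    (fun x hx => (hder x hx).continuousAt.continuousWithinAt)
    (fun x hx => hder x ⟨hx.1.le, hx.2.le⟩) (fun x hx => by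
      have hx' : x ∈ Icc s (s + 2 * Real.pi / c) := ⟨hx.1.le, hx.2.le⟩
      have h1 := hineq (X x) (Y x) (e₁ x) (e₂ x) (he₁ x hx') (he₂ x hx')
      have hD := hcon x hx'
      obtain ⟨D, hDdef⟩ : ∃ D, D = X x + β * Y x := ⟨_, rfl⟩
      rw [← hDdef] at h1 hD ⊢
      have hpos : 0 < D ^ 2 + Y x ^ 2 := by positivity
      have e1 : ∀ z : ℝ, 1 / (1 + (Y x / D) ^ 2) * (z / D ^ 2) = z / (D ^ 2 + Y x ^ 2) := by
        intro z
        field_simp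
      rw [e1, sub_nonneg, le_div_iff₀ hpos]
      exact h1)
  have e1 : c / 2 * (s + 2 * Real.pi / c) = c / 2 * s + Real.pi := by field_simp
  have h1 := Real.arctan_lt_pi_div_two (Y (s + 2 * Real.pi / c) /
    (X (s + 2 * Real.pi / c) + β * Y (s + 2 * Real.pi / c)))
  have h2 := Real.neg_pi_div_two_lt_arctan (Y s / (X s + β * Y s))
  linarith

/-! ### Differences of orbits -/

theorem exp_mul_sub_le (a b : ℝ) : Real.exp b * (a - b) ≤ Real.exp a - Real.exp b := by
  have h1 := mul_le_mul_of_nonneg_left (Real.add_one_le_exp (a - b)) (Real.exp_pos b).le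
  rw [← Real.exp_add, add_sub_cancel] at h1
  linarith

theorem abs_exp_sub_exp_sub_le {k ε a b : ℝ} (ha : |Real.exp a - k| ≤ ε)
    (hb : |Real.exp b - k| ≤ ε) :
    |Real.exp a - Real.exp b - k * (a - b)| ≤ ε * |a - b| := by
  have h1 := exp_mul_sub_le a b
  have h2 := exp_mul_sub_le b a
  rw [abs_le] at ha hb ⊢
  rcases le_total 0 (a - b) with h | h
  · rw [abs_of_nonneg h]
    constructor <;> nlinarith
  · rw [abs_of_nonpos h]
    constructor <;> nlinarith

theorem abs_exp_sub_exp_le {M a b : ℝ} (ha : Real.exp a ≤ M) (hb : Real.exp b ≤ M) :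
    |Real.exp a - Real.exp b| ≤ M * |a - b| := by
  have h1 := exp_mul_sub_le a b
  have h2 := exp_mul_sub_le b a
  have h3 := Real.exp_pos a
  have h4 := Real.exp_pos b
  rw [abs_le]
  rcases le_total 0 (a - b) with h | h
  · rw [abs_of_nonneg h]
    constructor <;> nlinarith
  · rw [abs_of_nonpos h]
    constructor <;> nlinarith

theorem abs_div_sub_div_le {a b x y r : ℝ} (hr : 0 < r) (hb : 0 ≤ b) (hx : r ≤ x) (hy : r ≤ y) :
    |a / x - b / y| ≤ |a - b| / r + b * |x - y| / r ^ 2 := by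
  have hx0 := hr.trans_le hx
  have hy0 := hr.trans_le hy
  have e : a / x - b / y = (a - b) / x - b * (x - y) / (x * y) := by
    field_simp
    ring
  rw [e]
  refine (abs_sub _ _).trans (add_le_add ?_ ?_)
  · rw [abs_div, abs_of_pos hx0]
    exact div_le_div_of_nonneg_left (abs_nonneg _) hr hx
  · rw [abs_div, abs_mul, abs_of_nonneg hb, abs_of_pos (mul_pos hx0 hy0)]
    exact div_le_div_of_nonneg_left (by positivity) (by positivity) (by nlinarith)

namespace IsOrbit

variable {β δ θ κ c T : ℝ} {v p q v₁ p₁ q₁ v₂ p₂ q₂ : ℝ → ℝ}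

/-- The level `v + κ β log v + θ t + c` is increasing in `v` with slope at least `1`, so the difference
of the `v`-components is controlled by the differences of `p` and `q`. -/
theorem abs_v_sub_le (hβ : 0 < β) (hκ : 0 < κ) (h₁ : IsOrbit β δ θ κ c T v₁ p₁ q₁)
    (h₂ : IsOrbit β δ θ κ c T v₂ p₂ q₂) {t : ℝ} (ht : t < T) :
    |v₁ t - v₂ t| ≤ |(p₁ t - p₂ t) + β * (q₁ t - q₂ t)| := by
  have e : (p₁ t - p₂ t) + β * (q₁ t - q₂ t)
      = (v₁ t - v₂ t) + κ * β * (Real.log (v₁ t) - Real.log (v₂ t)) := by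
    linear_combination h₁.level t ht - h₂.level t ht
  have hκβ := mul_pos hκ hβ
  rw [e]
  rcases le_total (v₁ t) (v₂ t) with h | h
  · have h3 := Real.log_le_log (h₁.v_pos t ht) h
    have h4 : κ * β * (Real.log (v₁ t) - Real.log (v₂ t)) ≤ 0 :=
      mul_nonpos_of_nonneg_of_nonpos hκβ.le (by linarith)
    rw [abs_of_nonpos (by linarith), abs_of_nonpos (by linarith)]
    linarith
  · have h3 := Real.log_le_log (h₂.v_pos t ht) h
    have h4 : 0 ≤ κ * β * (Real.log (v₁ t) - Real.log (v₂ t)) :=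
      mul_nonneg hκβ.le (by linarith)
    rw [abs_of_nonneg (by linarith), abs_of_nonneg (by linarith)]
    linarith

theorem v_eq_iff (hβ : 0 < β) (hκ : 0 < κ) (h₁ : IsOrbit β δ θ κ c T v₁ p₁ q₁)
    (h₂ : IsOrbit β δ θ κ c T v₂ p₂ q₂) {t : ℝ} (ht : t < T) :
    v₁ t = v₂ t ↔ (p₁ t - p₂ t) + β * (q₁ t - q₂ t) = 0 := by
  constructor
  · intro h
    have h1 := h₁.level t ht
    have h2 := h₂.level t ht
    rw [h] at h1
    linarith
  · intro h
    have := abs_v_sub_le hβ hκ h₁ h₂ ht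
    rw [h, abs_zero, abs_nonpos_iff] at this
    linarith

/-- The difference of two orbits near the equilibrium solves a small perturbation of the linearized
system. -/
theorem exists_sub_error (hβ : 1 ≤ β) (hθ : 0 < θ) (hκ : 0 < κ) {ε R : ℝ} (hε : 0 < ε)
    (hR : 1 ≤ R) (hRε : κ * (θ + ε) * (1 + β) ≤ ε * R)
    (h₁ : IsOrbit β δ θ κ c T v₁ p₁ q₁) (h₂ : IsOrbit β δ θ κ c T v₂ p₂ q₂) :
    ∃ e₁ e₂ : ℝ → ℝ, ∀ t < T,
      HasDerivAt (fun t => p₁ t - p₂ t) (-δ * (p₁ t - p₂ t) - θ * (q₁ t - q₂ t) + e₁ t) t ∧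
      HasDerivAt (fun t => q₁ t - q₂ t) (δ / β * (p₁ t - p₂ t) + e₂ t) t ∧
      (|Real.exp (p₁ t) - δ| ≤ ε ∧ |Real.exp (q₁ t) - θ| ≤ ε ∧ R ≤ v₁ t →
       |Real.exp (p₂ t) - δ| ≤ ε ∧ |Real.exp (q₂ t) - θ| ≤ ε ∧ R ≤ v₂ t →
        |e₁ t| ≤ 2 * ε * (|p₁ t - p₂ t| + |q₁ t - q₂ t|) ∧
        |e₂ t| ≤ 2 * ε * (|p₁ t - p₂ t| + |q₁ t - q₂ t|)) := by
  have hβ0 : 0 < β := by linarith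
  have hR0 : 0 < R := by linarith
  refine ⟨fun t => -(Real.exp (p₁ t) - Real.exp (p₂ t) - δ * (p₁ t - p₂ t))
      - (Real.exp (q₁ t) - Real.exp (q₂ t) - θ * (q₁ t - q₂ t)),
    fun t => (Real.exp (p₁ t) - Real.exp (p₂ t) - δ * (p₁ t - p₂ t)) / β
      - κ * (Real.exp (q₁ t) / v₁ t - Real.exp (q₂ t) / v₂ t), fun t ht => ⟨?_, ?_, ?_⟩⟩
  · refine ((h₁.deriv_p t ht).sub (h₂.deriv_p t ht)).congr_deriv ?_
    ring
  · refine ((h₁.deriv_q t ht).sub (h₂.deriv_q t ht)).congr_deriv ?_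
    ring
  rintro ⟨a1, a2, a3⟩ ⟨b1, b2, b3⟩
  have hx := abs_exp_sub_exp_sub_le a1 b1
  have hy := abs_exp_sub_exp_sub_le a2 b2
  have hx0 := abs_nonneg (p₁ t - p₂ t)
  have hy0 := abs_nonneg (q₁ t - q₂ t)
  constructor
  · refine (abs_sub _ _).trans ?_
    rw [abs_neg]
    nlinarith
  · refine (abs_sub _ _).trans ?_
    have g1 : |(Real.exp (p₁ t) - Real.exp (p₂ t) - δ * (p₁ t - p₂ t)) / β|
        ≤ ε * |p₁ t - p₂ t| := by
      rw [abs_div, abs_of_pos hβ0]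
      exact (div_le_self (abs_nonneg _) hβ).trans hx
    have m1 : Real.exp (q₁ t) ≤ θ + ε := by linarith [(abs_le.1 a2).2]
    have m2 : Real.exp (q₂ t) ≤ θ + ε := by linarith [(abs_le.1 b2).2]
    have g2 : |Real.exp (q₁ t) / v₁ t - Real.exp (q₂ t) / v₂ t|
        ≤ (θ + ε) * |q₁ t - q₂ t| / R + (θ + ε) * (|p₁ t - p₂ t| + β * |q₁ t - q₂ t|) / R := by
      refine (abs_div_sub_div_le hR0 (Real.exp_pos _).le a3 b3).trans (add_le_add ?_ ?_)
      · exact div_le_div_of_nonneg_right (abs_exp_sub_exp_le m1 m2) hR0.le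
      · have w1 : |v₁ t - v₂ t| ≤ |p₁ t - p₂ t| + β * |q₁ t - q₂ t| := by
          refine (abs_v_sub_le hβ0 hκ h₁ h₂ ht).trans ((abs_add_le _ _).trans ?_)
          rw [abs_mul, abs_of_pos hβ0]
        have w2 : Real.exp (q₂ t) * |v₁ t - v₂ t|
            ≤ (θ + ε) * (|p₁ t - p₂ t| + β * |q₁ t - q₂ t|) :=
          mul_le_mul m2 w1 (abs_nonneg _) (by positivity)
        refine (div_le_div_of_nonneg_right w2 (by positivity)).trans ?_
        exact div_le_div_of_nonneg_left (by positivity) hR0 (by nlinarith)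
    have g3 : (θ + ε) * |q₁ t - q₂ t| / R + (θ + ε) * (|p₁ t - p₂ t| + β * |q₁ t - q₂ t|) / R
        ≤ (θ + ε) * (1 + β) * (|p₁ t - p₂ t| + |q₁ t - q₂ t|) / R := by
      rw [← add_div]
      refine div_le_div_of_nonneg_right ?_ hR0.le
      have : 0 ≤ (θ + ε) * (β * |p₁ t - p₂ t|) := by positivity
      nlinarith
    have g4 : κ * ((θ + ε) * (1 + β) * (|p₁ t - p₂ t| + |q₁ t - q₂ t|) / R)
        ≤ ε * (|p₁ t - p₂ t| + |q₁ t - q₂ t|) := by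
      rw [← mul_div_assoc, div_le_iff₀ hR0]
      nlinarith [mul_le_mul_of_nonneg_right hRε (add_nonneg hx0 hy0)]
    rw [abs_mul, abs_of_pos hκ]
    have g5 := mul_le_mul_of_nonneg_left (g2.trans g3) hκ.le
    have g6 := mul_nonneg hε.le hy0
    linarith

/-- Two orbits along which `v` has the same finite limit and `p` the same limit at `-∞` coincide.
The coefficient in the Gronwall estimate for their difference is a multiple of
`exp q₁ + exp q₂ = -(v₁ + v₂)'`, which is integrable at `-∞`. -/
theorem eq_of_tendsto (hβ : 0 < β) (hκ : 0 < κ)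
    (h₁ : IsOrbit β δ θ κ c T v₁ p₁ q₁) (h₂ : IsOrbit β δ θ κ c T v₂ p₂ q₂) {A P : ℝ} (hA : 0 < A)
    (hv₁ : Tendsto v₁ atBot (𝓝 A)) (hv₂ : Tendsto v₂ atBot (𝓝 A))
    (hp₁ : Tendsto p₁ atBot (𝓝 P)) (hp₂ : Tendsto p₂ atBot (𝓝 P)) :
    ∀ t < T, v₁ t = v₂ t := by
  intro t ht
  obtain ⟨r, hr0, hr1, hr2⟩ : ∃ r, 0 < r ∧ r ≤ v₁ t ∧ r ≤ v₂ t :=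
    ⟨min (v₁ t) (v₂ t), lt_min (h₁.v_pos _ ht) (h₂.v_pos _ ht), min_le_left _ _,
      min_le_right _ _⟩
  obtain ⟨S, hS⟩ : ∃ S : ℝ → ℝ, S = fun s => (p₁ s - p₂ s) ^ 2
      + ((p₁ s - p₂ s) + β * (q₁ s - q₂ s)) ^ 2 := ⟨_, rfl⟩
  obtain ⟨K, hK⟩ : ∃ K, K = 2 * (4 / β + 2 * κ / r + 2 * κ * β / r ^ 2) := ⟨_, rfl⟩
  have hK0 : 0 < K := by rw [hK]; positivity
  have hder : ∀ s ≤ t, HasDerivAt S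
      (2 * (p₁ s - p₂ s) * (-(Real.exp (p₁ s) - Real.exp (p₂ s))
        - (Real.exp (q₁ s) - Real.exp (q₂ s)))
       + 2 * ((p₁ s - p₂ s) + β * (q₁ s - q₂ s)) * (-(Real.exp (q₁ s) - Real.exp (q₂ s))
        - κ * β * (Real.exp (q₁ s) / v₁ s - Real.exp (q₂ s) / v₂ s))) s := by
    intro s hs
    have hsT := hs.trans_lt ht
    have d1 := (h₁.deriv_p s hsT).sub (h₂.deriv_p s hsT)
    have d2 := (h₁.deriv_q s hsT).sub (h₂.deriv_q s hsT)
    rw [hS]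
    refine ((d1.pow 2).add ((d1.add (d2.const_mul β)).pow 2)).congr_deriv ?_
    simp
    field_simp
    ring
  have hbd : ∀ s ≤ t, (2 * (p₁ s - p₂ s) * (-(Real.exp (p₁ s) - Real.exp (p₂ s))
        - (Real.exp (q₁ s) - Real.exp (q₂ s)))
       + 2 * ((p₁ s - p₂ s) + β * (q₁ s - q₂ s)) * (-(Real.exp (q₁ s) - Real.exp (q₂ s))
        - κ * β * (Real.exp (q₁ s) / v₁ s - Real.exp (q₂ s) / v₂ s)))
       ≤ K * (Real.exp (q₁ s) + Real.exp (q₂ s)) * S s := by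
    intro s hs
    have hsT := hs.trans_lt ht
    have hq1 := Real.exp_pos (q₁ s)
    have hq2 := Real.exp_pos (q₂ s)
    have a1 : 0 ≤ (p₁ s - p₂ s) * (Real.exp (p₁ s) - Real.exp (p₂ s)) := by
      rcases le_total (p₁ s) (p₂ s) with h | h
      · exact mul_nonneg_of_nonpos_of_nonpos (by linarith) (by linarith [Real.exp_le_exp.2 h])
      · exact mul_nonneg (by linarith) (by linarith [Real.exp_le_exp.2 h])
    have a2 := abs_exp_sub_exp_le (show Real.exp (q₁ s) ≤ Real.exp (q₁ s) + Real.exp (q₂ s) by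
      linarith) (show Real.exp (q₂ s) ≤ Real.exp (q₁ s) + Real.exp (q₂ s) by linarith)
    have a3 := abs_div_sub_div_le (a := Real.exp (q₁ s)) hr0 hq2.le
      (hr1.trans (h₁.v_anti hs ht)) (hr2.trans (h₂.v_anti hs ht))
    have a4 := abs_v_sub_le hβ hκ h₁ h₂ hsT
    have a5 : Real.exp (q₂ s) ≤ Real.exp (q₁ s) + Real.exp (q₂ s) := by linarith
    rw [hS]
    have hZ : 0 < Real.exp (q₁ s) + Real.exp (q₂ s) := by linarith
    generalize Real.exp (q₁ s) / v₁ s - Real.exp (q₂ s) / v₂ s = H at *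
    generalize Real.exp (q₁ s) - Real.exp (q₂ s) = F at *
    generalize Real.exp (q₁ s) + Real.exp (q₂ s) = Z at *
    obtain ⟨D, hD⟩ : ∃ D, D = (p₁ s - p₂ s) + β * (q₁ s - q₂ s) := ⟨_, rfl⟩
    have hy : q₁ s - q₂ s = (D - (p₁ s - p₂ s)) / β := by rw [hD]; field_simp; ring
    beta_reduce
    rw [← hD] at a4 ⊢
    rw [hy] at a2
    generalize p₁ s - p₂ s = x at *
    generalize Real.exp (p₁ s) - Real.exp (p₂ s) = E at *
    obtain ⟨n, hn⟩ : ∃ n, n = |x| + |D| := ⟨_, rfl⟩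
    have hx := abs_nonneg x
    have hD0 := abs_nonneg D
    have hn0 : 0 ≤ n := by rw [hn]; positivity
    have b1 : |F| ≤ Z / β * n := by
      refine a2.trans ?_
      rw [abs_div, abs_of_pos hβ, ← mul_div_assoc, div_mul_eq_mul_div]
      refine div_le_div_of_nonneg_right (mul_le_mul_of_nonneg_left ?_ hZ.le) hβ.le
      rw [hn]
      linarith [abs_sub D x]
    have b2 : |H| ≤ (Z / β / r + Z / r ^ 2) * n := by
      have c1 : |F| / r ≤ Z / β / r * n := by
        rw [div_mul_eq_mul_div]
        exact div_le_div_of_nonneg_right b1 hr0.le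
      have c2 : Real.exp (q₂ s) * |v₁ s - v₂ s| / r ^ 2 ≤ Z / r ^ 2 * n := by
        rw [div_mul_eq_mul_div]
        refine div_le_div_of_nonneg_right ?_ (by positivity)
        exact mul_le_mul a5 (a4.trans (by linarith)) (abs_nonneg _) hZ.le
      linarith
    have b3 : -(x * F) ≤ n * (Z / β * n) := by
      have := mul_le_mul (show |x| ≤ n by linarith) b1 (abs_nonneg _) hn0
      rw [← abs_mul] at this
      linarith [neg_abs_le (x * F)]
    have b4 : D * (-F - κ * β * H) ≤
        n * (Z / β * n + κ * β * ((Z / β / r + Z / r ^ 2) * n)) := by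
      have c1 : |(-F - κ * β * H)| ≤ Z / β * n + κ * β * ((Z / β / r + Z / r ^ 2) * n) := by
        refine (abs_sub _ _).trans ?_
        rw [abs_neg, abs_mul, abs_of_pos (mul_pos hκ hβ)]
        exact add_le_add b1 (mul_le_mul_of_nonneg_left b2 (mul_pos hκ hβ).le)
      have := mul_le_mul (show |D| ≤ n by linarith) c1 (abs_nonneg _) hn0
      rw [← abs_mul] at this
      exact (le_abs_self _).trans this
    have b6 : n ^ 2 ≤ 2 * (x ^ 2 + D ^ 2) := by
      rw [hn, ← sq_abs x, ← sq_abs D]; nlinarith [sq_nonneg (|x| - |D|)]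
    have b7 := mul_le_mul_of_nonneg_left b6 (show 0 ≤ K / 2 * Z by positivity)
    have e1 : 2 * (n * (Z / β * n)) + 2 * (n * (Z / β * n
        + κ * β * ((Z / β / r + Z / r ^ 2) * n))) = K / 2 * Z * n ^ 2 := by
      rw [hK]; field_simp; ring
    linarith
  have hmono : ∀ s ≤ t, S t * Real.exp (K * (v₁ t + v₂ t))
      ≤ S s * Real.exp (K * (v₁ s + v₂ s)) := by
    intro s hs
    have hd : ∀ x ≤ t, HasDerivAt (fun x => Real.exp (K * (v₁ x + v₂ x)))
        (Real.exp (K * (v₁ x + v₂ x)) * (K * (-Real.exp (q₁ x) + -Real.exp (q₂ x)))) x :=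
      fun x hx => (((h₁.deriv_v x (hx.trans_lt ht)).add
        (h₂.deriv_v x (hx.trans_lt ht))).const_mul K).exp
    have := le_of_hasDerivAt_nonneg hs
      (fun x hx => ((hder x hx.2).mul (hd x hx.2)).neg.continuousAt.continuousWithinAt)
      (fun x hx => ((hder x hx.2.le).mul (hd x hx.2.le)).neg) (fun x hx => ?_)
    · simp only [Pi.neg_apply, Pi.mul_apply] at this
      linarith
    · have h1 := mul_le_mul_of_nonneg_right (hbd x hx.2.le)
        (Real.exp_pos (K * (v₁ x + v₂ x))).le
      linarith
  have hD : Tendsto (fun s => (p₁ s - p₂ s) + β * (q₁ s - q₂ s)) atBot (𝓝 0) := by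
    have h1 : Tendsto (fun s => (v₁ s - v₂ s) + κ * β * (Real.log (v₁ s) - Real.log (v₂ s)))
        atBot (𝓝 ((A - A) + κ * β * (Real.log A - Real.log A))) :=
      (hv₁.sub hv₂).add (((hv₁.log hA.ne').sub (hv₂.log hA.ne')).const_mul _)
    simp only [sub_self, mul_zero, add_zero] at h1
    refine h1.congr' ?_
    filter_upwards [eventually_lt_atBot T] with s hs
    linear_combination h₂.level s hs - h₁.level s hs
  have hx : Tendsto (fun s => p₁ s - p₂ s) atBot (𝓝 0) := by
    simpa using hp₁.sub hp₂
  have hlim : Tendsto (fun s => S s * Real.exp (K * (v₁ s + v₂ s))) atBot (𝓝 0) := by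
    have h1 := (((hx.pow 2).add (hD.pow 2))).mul
      ((Real.continuous_exp.tendsto _).comp ((hv₁.add hv₂).const_mul K))
    rw [hS]
    simpa using h1
  have h1 : S t * Real.exp (K * (v₁ t + v₂ t)) ≤ 0 := by
    refine ge_of_tendsto hlim ?_
    filter_upwards [eventually_le_atBot t] with s hs using hmono s hs
  have h2 := nonpos_of_mul_nonpos_left h1 (Real.exp_pos _)
  rw [hS] at h2
  rw [v_eq_iff hβ hκ h₁ h₂ ht]
  have h3 := sq_nonneg (p₁ t - p₂ t)
  exact (pow_eq_zero_iff two_ne_zero).1 (le_antisymm (by linarith) (sq_nonneg _))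

end IsOrbit

/-! ### Radial solutions, flux pairs and orbits -/

/-- A first-order form of the radial equation on `(0, r₀)`: `u' = (r^{-α} F)^{1/β}` and
`F' = r^{γ-1} / f(u)`, where `F = r^α (u')^β` is the flux. -/
structure IsFluxPair (α β γ m r₀ : ℝ) (u F : ℝ → ℝ) : Prop where
  u_pos : ∀ r ∈ Ioo 0 r₀, 0 < u r
  F_pos : ∀ r ∈ Ioo 0 r₀, 0 < F r
  deriv_u : ∀ r ∈ Ioo 0 r₀, HasDerivAt u ((r ^ (-α) * F r) ^ (1 / β)) r
  deriv_F : ∀ r ∈ Ioo 0 r₀, HasDerivAt F (r ^ (γ - 1) * Real.exp (1 / u r ^ m)) r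

theorem one_div_expNonlin {m u : ℝ} (hu : 0 < u) :
    1 / expNonlin m u = Real.exp (1 / u ^ m) := by
  rw [expNonlin, if_pos hu, Real.exp_neg, one_div, inv_inv]

theorem IsFluxPair.isRadialSolution {α β γ m r₀ a : ℝ} {u F : ℝ → ℝ} (hβ : 0 < β)
    (h : IsFluxPair α β γ m r₀ u F) (hc : ContinuousOn u (Ico 0 r₀)) (h0 : u 0 = a) :
    IsRadialSolution α β γ (expNonlin m) r₀ a u := by
  have hFc : ContDiffOn ℝ 1 F (Ioo 0 r₀) := by
    rw [show (1 : WithTop ℕ∞) = 0 + 1 by norm_num, contDiffOn_succ_iff_deriv_of_isOpen isOpen_Ioo]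
    refine ⟨fun r hr => (h.deriv_F r hr).differentiableAt.differentiableWithinAt, by simp, ?_⟩
    rw [contDiffOn_zero]
    refine ContinuousOn.congr (f := fun r => r ^ (γ - 1) * Real.exp (1 / u r ^ m)) ?_
      fun r hr => (h.deriv_F r hr).deriv
    intro r hr
    have h1 := (h.deriv_u r hr).continuousAt
    have h2 : ContinuousAt (fun r => u r ^ m) r :=
      h1.rpow_const (Or.inl (h.u_pos r hr).ne')
    have h3 : ContinuousAt (fun r : ℝ => r ^ (γ - 1)) r :=
      Real.continuousAt_rpow_const _ _ (Or.inl hr.1.ne')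
    have h4 : u r ^ m ≠ 0 := (Real.rpow_pos_of_pos (h.u_pos r hr) m).ne'
    exact (h3.mul (Real.continuous_exp.continuousAt.comp
      (continuousAt_const.div h2 h4))).continuousWithinAt
  refine ⟨?_, hc, ?_, h.u_pos, h0⟩
  · rw [show (2 : WithTop ℕ∞) = 1 + 1 by norm_num, contDiffOn_succ_iff_deriv_of_isOpen isOpen_Ioo]
    refine ⟨fun r hr => (h.deriv_u r hr).differentiableAt.differentiableWithinAt, by simp, ?_⟩
    refine ContDiffOn.congr (f := fun r => (r ^ (-α) * F r) ^ (1 / β)) ?_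
      fun r hr => (h.deriv_u r hr).deriv
    refine ContDiffOn.rpow_const_of_ne (ContDiffOn.mul ?_ hFc) fun r hr =>
      (mul_pos (Real.rpow_pos_of_pos hr.1 _) (h.F_pos r hr)).ne'
    exact contDiffOn_id.rpow_const_of_ne fun r hr => hr.1.ne'
  · intro r hr
    have hev : (fun s => s ^ α * (|deriv u s| ^ (β - 1) * deriv u s)) =ᶠ[𝓝 r] F := by
      filter_upwards [Ioo_mem_nhds hr.1 hr.2] with s hs
      have hs' := Real.rpow_pos_of_pos hs.1 (-α)
      have hF := h.F_pos s hs
      have hb := mul_pos hs' hF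
      have hw := Real.rpow_pos_of_pos hb (1 / β)
      rw [(h.deriv_u s hs).deriv, abs_of_pos hw, ← Real.rpow_add_one hw.ne', sub_add_cancel,
        ← Real.rpow_mul hb.le, one_div, inv_mul_cancel₀ hβ.ne', Real.rpow_one, ← mul_assoc,
        ← Real.rpow_add hs.1]
      simp
    rw [hev.deriv_eq, (h.deriv_F r hr).deriv, one_div_expNonlin (h.u_pos r hr), ← mul_assoc,
      ← Real.rpow_add hr.1]
    simp

theorem IsRadialSolution.tendsto {α β γ r₀ a : ℝ} {f u : ℝ → ℝ} (hr₀ : 0 < r₀)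
    (h : IsRadialSolution α β γ f r₀ a u) : Tendsto u (𝓝[>] 0) (𝓝 a) := by
  rw [← h.initial]
  refine (h.continuousOn 0 ⟨le_rfl, hr₀⟩).mono_left ?_
  rw [← nhdsWithin_Ioo_eq_nhdsGT hr₀]
  exact nhdsWithin_mono _ Ioo_subset_Ico_self

/-- The flux of a radial solution is increasing, and it cannot be negative near `0`: otherwise
`u' ≤ - k / r` there, because `β ≤ α`, and `u` would be unbounded. -/
theorem IsRadialSolution.exists_isFluxPair {α β γ m r₀ a : ℝ} {u : ℝ → ℝ} (hαβ : β < α)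
    (hβ : 1 ≤ β) (h : IsRadialSolution α β γ (expNonlin m) r₀ a u) :
    ∃ F, IsFluxPair α β γ m r₀ u F := by
  have hβ0 : 0 < β := by linarith
  obtain ⟨G, hG⟩ : ∃ G : ℝ → ℝ, G = fun s => s ^ α * (|deriv u s| ^ (β - 1) * deriv u s) :=
    ⟨_, rfl⟩
  have hdG : ∀ r ∈ Ioo 0 r₀, HasDerivAt G (r ^ (γ - 1) * Real.exp (1 / u r ^ m)) r := by
    intro r hr
    have h1 := h.equation r hr
    rw [one_div_expNonlin (h.pos r hr), ← hG] at h1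
    have h2 : deriv G r = r ^ (γ - 1) * Real.exp (1 / u r ^ m) := by
      rw [← h1, ← mul_assoc, ← Real.rpow_add hr.1]
      simp
    have h3 : deriv G r ≠ 0 := by
      rw [h2]
      exact (mul_pos (Real.rpow_pos_of_pos hr.1 _) (Real.exp_pos _)).ne'
    rw [← h2]
    exact (differentiableAt_of_deriv_ne_zero h3).hasDerivAt
  have hmono : StrictMonoOn G (Ioo 0 r₀) := by
    refine strictMonoOn_of_deriv_pos (convex_Ioo _ _)
      (fun r hr => (hdG r hr).continuousAt.continuousWithinAt) ?_
    rw [interior_Ioo]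
    intro r hr
    rw [(hdG r hr).deriv]
    exact mul_pos (Real.rpow_pos_of_pos hr.1 _) (Real.exp_pos _)
  have hdu : ∀ r ∈ Ioo 0 r₀, HasDerivAt u (deriv u r) r := fun r hr =>
    ((h.contDiffOn.differentiableOn (by norm_num) r hr).differentiableAt
      (Ioo_mem_nhds hr.1 hr.2)).hasDerivAt
  have hpos : ∀ r ∈ Ioo 0 r₀, 0 < G r := by
    intro r₁ hr₁
    by_contra hle
    push Not at hle
    have hr₂ : r₁ / 2 ∈ Ioo 0 r₀ := ⟨by linarith [hr₁.1], by linarith [hr₁.1, hr₁.2]⟩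
    have hneg : G (r₁ / 2) < 0 := (hmono hr₂ hr₁ (by linarith [hr₁.1])).trans_le hle
    obtain ⟨k, hk⟩ : ∃ k, k = (-G (r₁ / 2)) ^ (1 / β) := ⟨_, rfl⟩
    have hk0 : 0 < k := by rw [hk]; exact Real.rpow_pos_of_pos (by linarith) _
    obtain ⟨r₃, hr30, hr31, hr32⟩ : ∃ r₃, 0 < r₃ ∧ r₃ ≤ r₁ / 2 ∧ r₃ ≤ 1 :=
      ⟨min (r₁ / 2) 1, lt_min hr₂.1 one_pos, min_le_left _ _, min_le_right _ _⟩
    have hu' : ∀ r ∈ Ioc 0 r₃, deriv u r ≤ -(k / r) := by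
      intro r hr
      have hr0 : r ∈ Ioo 0 r₀ := ⟨hr.1, (hr.2.trans hr31).trans_lt hr₂.2⟩
      have h1 : G r ≤ G (r₁ / 2) := hmono.monotoneOn hr0 hr₂ (hr.2.trans hr31)
      have hrα := Real.rpow_pos_of_pos hr.1 α
      have hdneg : deriv u r < 0 := by
        by_contra hge
        push Not at hge
        have : 0 ≤ G r := by
          rw [hG]
          positivity
        linarith
      have h2 : -G r = r ^ α * (-deriv u r) ^ β := by
        rw [hG]
        simp only [abs_of_neg hdneg]
        have : (-deriv u r) ^ β = (-deriv u r) ^ (β - 1) * (-deriv u r) := by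
          rw [← Real.rpow_add_one (by linarith), sub_add_cancel]
        rw [this]
        ring
      have h3 : -G (r₁ / 2) ≤ (r * -deriv u r) ^ β := by
        rw [Real.mul_rpow hr.1.le (by linarith)]
        refine (neg_le_neg h1).trans (h2.le.trans ?_)
        exact mul_le_mul_of_nonneg_right (Real.rpow_le_rpow_of_exponent_ge hr.1
          (hr.2.trans hr32) hαβ.le) (Real.rpow_nonneg (by linarith) _)
      have h4 : k ≤ r * -deriv u r := by
        rw [hk]
        have h5 : 0 ≤ r * -deriv u r := mul_nonneg hr.1.le (by linarith)
        calc (-G (r₁ / 2)) ^ (1 / β) ≤ ((r * -deriv u r) ^ β) ^ (1 / β) :=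
              Real.rpow_le_rpow (by linarith) h3 (by positivity)
          _ = r * -deriv u r := by
              rw [← Real.rpow_mul h5, mul_one_div_cancel hβ0.ne', Real.rpow_one]
      rw [le_neg, div_le_iff₀ hr.1]
      linarith
    have hlog : ∀ r ∈ Ioc 0 r₃, u r₃ + k * Real.log r₃ - k * Real.log r ≤ u r := by
      intro r hr
      have hd : ∀ x ∈ Icc r r₃, HasDerivAt (fun x => -(u x + k * Real.log x))
          (-(deriv u x + k * x⁻¹)) x := fun x hx => by
        have hx0 : 0 < x := hr.1.trans_le hx.1
        exact ((hdu x ⟨hx0, (hx.2.trans hr31).trans_lt hr₂.2⟩).add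
          ((Real.hasDerivAt_log hx0.ne').const_mul k)).neg
      have := le_of_hasDerivAt_nonneg hr.2
        (fun x hx => (hd x hx).continuousAt.continuousWithinAt)
        (fun x hx => hd x ⟨hx.1.le, hx.2.le⟩) (fun x hx => by
          have := hu' x ⟨hr.1.trans hx.1, hx.2.le⟩
          rw [div_eq_mul_inv] at this
          linarith)
      linarith
    have hlim1 := h.tendsto (hr₁.1.trans hr₁.2)
    have hlim2 : Tendsto (fun r => u r₃ + k * Real.log r₃ - k * Real.log r) (𝓝[>] 0) atTop := by
      have h1 := Real.tendsto_log_nhdsGT_zero.const_mul_atBot hk0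
      exact tendsto_atTop_add_const_left _ _ (tendsto_neg_atBot_atTop.comp h1)
    refine not_tendsto_nhds_of_tendsto_atTop (tendsto_atTop_mono' _ ?_ hlim2) _ hlim1
    filter_upwards [Ioc_mem_nhdsGT hr30] with r hr using hlog r hr
  refine ⟨G, h.pos, hpos, fun r hr => ?_, hdG⟩
  have hGr := hpos r hr
  have hrα := Real.rpow_pos_of_pos hr.1 α
  have hd : 0 < deriv u r := by
    by_contra hle
    push Not at hle
    have : G r ≤ 0 := by
      rw [hG]
      exact mul_nonpos_of_nonneg_of_nonpos hrα.le
        (mul_nonpos_of_nonneg_of_nonpos (Real.rpow_nonneg (abs_nonneg _) _) hle)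
    linarith
  have h2 : r ^ (-α) * G r = deriv u r ^ β := by
    rw [hG]
    simp only [abs_of_pos hd]
    rw [← Real.rpow_add_one hd.ne', sub_add_cancel, ← mul_assoc, ← Real.rpow_add hr.1]
    simp
  rw [h2, ← Real.rpow_mul hd.le, mul_one_div_cancel hβ0.ne', Real.rpow_one]
  exact hdu r hr

theorem rpow_eq_exp_mul_log {x : ℝ} (hx : 0 < x) (y : ℝ) : x ^ y = Real.exp (y * Real.log x) := by
  rw [Real.rpow_def_of_pos hx, mul_comm]

/-- The variable `v = u^{-m}` in the time `t = log r`. -/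
def orbitV (m : ℝ) (u : ℝ → ℝ) (t : ℝ) : ℝ := Real.exp (-m * Real.log (u (Real.exp t)))

/-- The logarithm of `r F' / F = r^γ exp v / F` in the time `t = log r`. -/
def orbitP (γ m : ℝ) (u F : ℝ → ℝ) (t : ℝ) : ℝ :=
  γ * t + orbitV m u t - Real.log (F (Real.exp t))

/-- The logarithm of `m u^{-m-1} r u'` in the time `t = log r`. -/
def orbitQ (α β m : ℝ) (u F : ℝ → ℝ) (t : ℝ) : ℝ :=
  Real.log m - (m + 1) * Real.log (u (Real.exp t)) + (1 / β) * (Real.log (F (Real.exp t))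
    - (α - β) * t)

theorem exp_mem_Ioo {r₀ t : ℝ} (hr₀ : 0 < r₀) (ht : t < Real.log r₀) :
    Real.exp t ∈ Ioo 0 r₀ :=
  ⟨Real.exp_pos t, (Real.lt_log_iff_exp_lt hr₀).1 ht⟩

theorem orbitV_log {m r : ℝ} {u : ℝ → ℝ} (hr : 0 < r) (hu : 0 < u r) :
    orbitV m u (Real.log r) = 1 / u r ^ m := by
  rw [orbitV, Real.exp_log hr, one_div, ← Real.rpow_neg hu.le, rpow_eq_exp_mul_log hu]

theorem tendsto_orbitV {m a : ℝ} {u : ℝ → ℝ} (ha : 0 < a) (hu : Tendsto u (𝓝[>] 0) (𝓝 a)) :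
    Tendsto (orbitV m u) atBot (𝓝 (Real.exp (-m * Real.log a))) :=
  (Real.continuous_exp.tendsto _).comp
    (((hu.comp Real.tendsto_exp_atBot_nhdsGT).log ha.ne').const_mul (-m))

theorem tendsto_exp_neg_mul_log {m : ℝ} (hm : 0 < m) :
    Tendsto (fun x => Real.exp (-m * Real.log x)) (𝓝[>] 0) atTop :=
  Real.tendsto_exp_atTop.comp
    (Real.tendsto_log_nhdsGT_zero.const_mul_atBot_of_neg (by linarith))

/-- A flux pair yields an orbit of the Emden–Fowler system through `orbitV`, `orbitP`, `orbitQ`. -/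
theorem IsFluxPair.isOrbit {α β γ m r₀ : ℝ} {u F : ℝ → ℝ} (hβ : 0 < β) (hm : 0 < m)
    (hr₀ : 0 < r₀) (h : IsFluxPair α β γ m r₀ u F) :
    IsOrbit β (α - β) (γ - α + β) ((m + 1) / m) (β * Real.log m) (Real.log r₀)
      (orbitV m u) (orbitP γ m u F) (orbitQ α β m u F) := by
  have hu : ∀ t < Real.log r₀, HasDerivAt (fun t => Real.log (u (Real.exp t)))
      (Real.exp (orbitQ α β m u F t) / (m * orbitV m u t)) t := by
    intro t ht
    have hr := exp_mem_Ioo hr₀ ht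
    have hF := h.F_pos _ hr
    have hux := h.u_pos _ hr
    refine (((h.deriv_u _ hr).comp t (Real.hasDerivAt_exp t)).log hux.ne').congr_deriv ?_
    have e1 : (Real.exp t ^ (-α) * F (Real.exp t)) ^ (1 / β)
        = Real.exp ((1 / β) * (-α * t + Real.log (F (Real.exp t)))) := by
      rw [rpow_eq_exp_mul_log (mul_pos (Real.rpow_pos_of_pos hr.1 _) hF),
        Real.log_mul (Real.rpow_pos_of_pos hr.1 _).ne' hF.ne', Real.log_rpow hr.1, Real.log_exp]
    simp only [Function.comp_apply]
    rw [e1, orbitQ, orbitV]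
    have e2 : m = Real.exp (Real.log m) := (Real.exp_log hm).symm
    have e3 : u (Real.exp t) = Real.exp (Real.log (u (Real.exp t))) := (Real.exp_log hux).symm
    conv_lhs => rw [e3]
    rw [show m * Real.exp (-m * Real.log (u (Real.exp t)))
      = Real.exp (Real.log m + -m * Real.log (u (Real.exp t))) by
        rw [Real.exp_add, Real.exp_log hm], ← Real.exp_add, ← Real.exp_sub, ← Real.exp_sub]
    congr 1
    field_simp
    ring
  have hv : ∀ t < Real.log r₀, HasDerivAt (orbitV m u) (-Real.exp (orbitQ α β m u F t)) t := by
    intro t ht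
    refine ((hu t ht).const_mul (-m)).exp.congr_deriv ?_
    change orbitV m u t * _ = _
    have : orbitV m u t ≠ 0 := (Real.exp_pos _).ne'
    field_simp
  have hF : ∀ t < Real.log r₀, HasDerivAt (fun t => Real.log (F (Real.exp t)))
      (Real.exp (orbitP γ m u F t)) t := by
    intro t ht
    have hr := exp_mem_Ioo hr₀ ht
    have hFx := h.F_pos _ hr
    refine (((h.deriv_F _ hr).comp t (Real.hasDerivAt_exp t)).log hFx.ne').congr_deriv ?_
    simp only [Function.comp_apply]
    have e1 : orbitV m u t = 1 / u (Real.exp t) ^ m := by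
      have := orbitV_log (m := m) (u := u) hr.1 (h.u_pos _ hr)
      rwa [Real.log_exp] at this
    rw [orbitP, e1, Real.exp_sub, Real.exp_log hFx, Real.exp_add,
      rpow_eq_exp_mul_log (Real.exp_pos t), Real.log_exp]
    have : γ * t = (γ - 1) * t + t := by ring
    rw [this, Real.exp_add]
    ring
  refine ⟨fun t _ => Real.exp_pos _, hv, fun t ht => ?_, fun t ht => ?_, fun t _ => ?_⟩
  · refine ((((hasDerivAt_id t).const_mul γ).add (hv t ht)).sub (hF t ht)).congr_deriv ?_
    ring
  · refine ((((hu t ht).const_mul (m + 1)).const_sub (Real.log m)).add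
      (((hF t ht).sub ((hasDerivAt_id t).const_mul (α - β))).const_mul (1 / β))).congr_deriv ?_
    have : orbitV m u t ≠ 0 := (Real.exp_pos _).ne'
    field_simp
    ring
  · rw [orbitP, orbitQ, show Real.log (orbitV m u t) = -m * Real.log (u (Real.exp t)) by
      rw [orbitV, Real.log_exp]]
    field_simp
    ring

/-- The function `u = v^{-1/m}` of `r = exp t`, which inverts `orbitV`. -/
def orbitU (m : ℝ) (v : ℝ → ℝ) (r : ℝ) : ℝ := Real.exp (-(1 / m) * Real.log (v (Real.log r)))

theorem orbitU_orbitV {m r : ℝ} {u : ℝ → ℝ} (hm : 0 < m) (hr : 0 < r) (hu : 0 < u r) :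
    orbitU m (orbitV m u) r = u r := by
  rw [orbitU, orbitV, Real.exp_log hr, Real.log_exp, show -(1 / m) * (-m * Real.log (u r))
    = Real.log (u r) by field_simp, Real.exp_log hu]

/-- The first derivative of `orbitU` along an orbit. -/
def orbitU₁ (m : ℝ) (v q : ℝ → ℝ) (r : ℝ) : ℝ :=
  Real.exp (-(1 / m + 1) * Real.log (v (Real.log r)) + q (Real.log r) - Real.log m) / r

/-- The second derivative of `orbitU` along an orbit. -/
def orbitU₂ (β δ m : ℝ) (v p q : ℝ → ℝ) (r : ℝ) : ℝ :=
  orbitU₁ m v q r * ((Real.exp (p (Real.log r)) - δ) / β - 1) / r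

theorem IsOrbit.hasDerivAt_orbitU {β δ θ κ c T m r : ℝ} {v p q : ℝ → ℝ} (hm : 0 < m)
    (h : IsOrbit β δ θ κ c T v p q) (hr : 0 < r) (hrT : Real.log r < T) :
    HasDerivAt (orbitU m v) (orbitU₁ m v q r) r := by
  have hvp := h.v_pos _ hrT
  have hd : HasDerivAt (orbitU m v) _ r :=
    ((((h.deriv_v _ hrT).comp r (Real.hasDerivAt_log hr.ne')).log hvp.ne').const_mul
      (-(1 / m))).exp
  refine hd.congr_deriv ?_
  simp only [Function.comp_apply]
  rw [orbitU₁, show -(1 / m + 1) * Real.log (v (Real.log r)) + q (Real.log r) - Real.log m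
    = -(1 / m) * Real.log (v (Real.log r)) + q (Real.log r) - Real.log m
      - Real.log (v (Real.log r)) by ring, Real.exp_sub, Real.exp_sub, Real.exp_add,
    Real.exp_log hm, Real.exp_log hvp]
  have := hr.ne'
  field_simp

theorem IsOrbit.hasDerivAt_orbitU₁ {β δ θ c T m r : ℝ} {v p q : ℝ → ℝ} (hm : 0 < m)
    (h : IsOrbit β δ θ ((m + 1) / m) c T v p q) (hr : 0 < r) (hrT : Real.log r < T) :
    HasDerivAt (orbitU₁ m v q) (orbitU₂ β δ m v p q r) r := by
  have hvp := h.v_pos _ hrT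
  have hlr := Real.hasDerivAt_log hr.ne'
  have hd : HasDerivAt (orbitU₁ m v q) _ r :=
    ((((((h.deriv_v _ hrT).comp r hlr).log hvp.ne').const_mul (-(1 / m + 1))).add
      ((h.deriv_q _ hrT).comp r hlr)).sub_const (Real.log m)).exp.div (hasDerivAt_id r) hr.ne'
  refine hd.congr_deriv ?_
  simp only [Function.comp_apply, Pi.add_apply]
  rw [orbitU₂, orbitU₁]
  have := hr.ne'
  field_simp
  ring

/-- An orbit yields a flux pair through `u = v^{-1/m}` and `F = r^γ exp (v - p)`. -/
theorem IsOrbit.isFluxPair {α β γ m r₀ : ℝ} {v p q : ℝ → ℝ} (hβ : 0 < β) (hm : 0 < m)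
    (h : IsOrbit β (α - β) (γ - α + β) ((m + 1) / m) (β * Real.log m) (Real.log r₀) v p q) :
    IsFluxPair α β γ m r₀ (orbitU m v)
      (fun r => Real.exp (γ * Real.log r + v (Real.log r) - p (Real.log r))) := by
  have hlog : ∀ r ∈ Ioo 0 r₀, Real.log r < Real.log r₀ := fun r hr => Real.log_lt_log hr.1 hr.2
  refine ⟨fun r _ => Real.exp_pos _, fun r _ => Real.exp_pos _, fun r hr => ?_, fun r hr => ?_⟩
  · have hlev := h.level _ (hlog r hr)
    refine (h.hasDerivAt_orbitU hm hr.1 (hlog r hr)).congr_deriv ?_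
    have e1 : (r ^ (-α) * Real.exp (γ * Real.log r + v (Real.log r) - p (Real.log r))) ^ (1 / β)
      = Real.exp ((1 / β) * (-α * Real.log r
        + (γ * Real.log r + v (Real.log r) - p (Real.log r)))) := by
      rw [rpow_eq_exp_mul_log (mul_pos (Real.rpow_pos_of_pos hr.1 _) (Real.exp_pos _)),
        Real.log_mul (Real.rpow_pos_of_pos hr.1 _).ne' (Real.exp_pos _).ne', Real.log_rpow hr.1,
        Real.log_exp]
    have e2 : orbitU₁ m v q r = Real.exp (-(1 / m + 1) * Real.log (v (Real.log r))
        + q (Real.log r) - Real.log m - Real.log r) := by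
      rw [Real.exp_sub _ (Real.log r), Real.exp_log hr.1, orbitU₁]
    rw [e1, e2]
    congr 1
    have e3 : v (Real.log r) - p (Real.log r) = β * q (Real.log r)
        - ((m + 1) / m * β * Real.log (v (Real.log r)) + (γ - α + β) * Real.log r
          + β * Real.log m) := by linarith
    rw [show γ * Real.log r + v (Real.log r) - p (Real.log r)
      = γ * Real.log r + (v (Real.log r) - p (Real.log r)) by ring, e3]
    field_simp
    ring
  · have hv := h.deriv_v _ (hlog r hr)
    have hp := h.deriv_p _ (hlog r hr)
    have hvp := h.v_pos _ (hlog r hr)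
    have hlr := Real.hasDerivAt_log hr.1.ne'
    have hd : HasDerivAt (fun r => Real.exp (γ * Real.log r + v (Real.log r)
        - p (Real.log r))) _ r :=
      (((hlr.const_mul γ).add (hv.comp r hlr)).sub (hp.comp r hlr)).exp
    refine hd.congr_deriv ?_
    have e1 : (Real.exp (-(1 / m) * Real.log (v (Real.log r)))) ^ m = (v (Real.log r))⁻¹ := by
      rw [← Real.exp_mul, show -(1 / m) * Real.log (v (Real.log r)) * m
        = -Real.log (v (Real.log r)) by field_simp, Real.exp_neg, Real.exp_log hvp]
    rw [orbitU, e1, one_div, inv_inv, rpow_eq_exp_mul_log hr.1]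
    have e2 : Real.exp (γ * Real.log r + v (Real.log r) - p (Real.log r))
        = Real.exp ((γ - 1) * Real.log r) * r * Real.exp (v (Real.log r))
          * Real.exp (-p (Real.log r)) := by
      rw [show γ * Real.log r + v (Real.log r) - p (Real.log r)
        = (γ - 1) * Real.log r + Real.log r + v (Real.log r) + -p (Real.log r) by ring,
        Real.exp_add, Real.exp_add, Real.exp_add, Real.exp_log hr.1]
    have e3 : Real.exp (-p (Real.log r)) * Real.exp (p (Real.log r)) = 1 := by
      rw [← Real.exp_add]; simp
    simp only [Pi.add_apply, Pi.sub_apply, Function.comp_apply]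
    rw [e2]
    have := hr.1.ne'
    field_simp
    linear_combination e3

/-! ### Existence of regular solutions -/

/-- A Volterra equation `u(r) = a + ∫₀ʳ N u` with a Lipschitz operator `N` that only looks back has
a solution on `[0, R]`: the integral operator is a contraction for a suitable exponential weight. -/
theorem exists_volterra {N : (ℝ → ℝ) → ℝ → ℝ} {R C : ℝ} (hR : 0 < R) (hC : 0 < C) (a : ℝ)
    (hcont : ∀ u, Continuous u → Continuous (N u))
    (hlip : ∀ u w, Continuous u → Continuous w → ∀ s ∈ Icc 0 R, ∀ M,
      (∀ x ∈ Icc 0 s, |u x - w x| ≤ M) → |N u s - N w s| ≤ C * M) :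
    ∃ u, Continuous u ∧ ∀ r ∈ Icc 0 R, u r = a + ∫ s in (0)..r, N u s := by
  obtain ⟨K, hK⟩ : ∃ K, K = 2 * C := ⟨_, rfl⟩
  have hK0 : 0 < K := by rw [hK]; positivity
  let E : C(Icc 0 R, ℝ) → ℝ → ℝ := fun b s => Real.exp (K * s) * IccExtend hR.le b s
  have hE : ∀ b, Continuous (E b) := fun b =>
    (by fun_prop : Continuous fun s => Real.exp (K * s)).mul b.continuous.Icc_extend'
  have hI : ∀ b, Continuous fun r => a + ∫ s in (0)..r, N (E b) s := fun b =>
    continuous_const.add (intervalIntegral.continuous_primitive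
      (fun x y => (hcont _ (hE b)).intervalIntegrable x y) 0)
  let Φ : C(Icc 0 R, ℝ) → C(Icc 0 R, ℝ) := fun b =>
    ⟨fun r => Real.exp (-(K * r)) * (a + ∫ s in (0)..(r : ℝ), N (E b) s), by
      have h1 : Continuous fun r : Icc 0 R => a + ∫ s in (0)..(r : ℝ), N (E b) s :=
        (hI b).comp continuous_subtype_val
      exact (by fun_prop : Continuous fun r : Icc 0 R => Real.exp (-(K * (r : ℝ)))).mul h1⟩
  have hΦ : ContractingWith (1 / 2) Φ := by
    refine ⟨by norm_num, LipschitzWith.of_dist_le_mul fun b₁ b₂ => ?_⟩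
    have hM : 0 ≤ dist b₁ b₂ := dist_nonneg
    rw [ContinuousMap.dist_le (by positivity)]
    intro r
    have hEd : ∀ s ∈ Icc 0 R, ∀ x ∈ Icc 0 s,
        |E b₁ x - E b₂ x| ≤ Real.exp (K * s) * dist b₁ b₂ := by
      intro s _ x hx
      have h1 : |IccExtend hR.le b₁ x - IccExtend hR.le b₂ x| ≤ dist b₁ b₂ :=
        ContinuousMap.dist_apply_le_dist (f := b₁) (g := b₂) (projIcc 0 R hR.le x)
      calc |E b₁ x - E b₂ x|
          = Real.exp (K * x) * |IccExtend hR.le b₁ x - IccExtend hR.le b₂ x| := by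
            simp only [E]
            rw [← mul_sub, abs_mul, abs_of_pos (Real.exp_pos _)]
        _ ≤ Real.exp (K * s) * dist b₁ b₂ :=
            mul_le_mul (Real.exp_le_exp.2 (mul_le_mul_of_nonneg_left hx.2 hK0.le)) h1
              (abs_nonneg _) (Real.exp_pos _).le
    have hN : ∀ s ∈ Icc 0 (r : ℝ), |N (E b₁) s - N (E b₂) s|
        ≤ C * (Real.exp (K * s) * dist b₁ b₂) := fun s hs =>
      have hs' : s ∈ Icc 0 R := ⟨hs.1, hs.2.trans r.2.2⟩
      hlip _ _ (hE b₁) (hE b₂) s hs' _ (hEd s hs')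
    have hint : |∫ s in (0)..(r : ℝ), (N (E b₁) s - N (E b₂) s)|
        ≤ ∫ s in (0)..(r : ℝ), C * dist b₁ b₂ * Real.exp (K * s) := by
      rw [← Real.norm_eq_abs]
      refine intervalIntegral.norm_integral_le_of_norm_le r.2.1 ?_
        ((by fun_prop : Continuous fun s : ℝ => C * dist b₁ b₂ *
          Real.exp (K * s)).intervalIntegrable _ _)
      refine MeasureTheory.ae_of_all _ fun s hs => ?_
      rw [Real.norm_eq_abs]
      refine (hN s ⟨hs.1.le, hs.2⟩).trans (le_of_eq (by ring))
    have hval : ∫ s in (0)..(r : ℝ), C * dist b₁ b₂ * Real.exp (K * s)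
        = C * dist b₁ b₂ * ((Real.exp (K * r) - 1) / K) := by
      rw [intervalIntegral.integral_const_mul, intervalIntegral.integral_comp_mul_left _ hK0.ne',
        integral_exp]
      simp [div_eq_inv_mul]
    have h1 : dist (Φ b₁ r) (Φ b₂ r) = Real.exp (-(K * r)) *
        |∫ s in (0)..(r : ℝ), (N (E b₁) s - N (E b₂) s)| := by
      rw [Real.dist_eq, intervalIntegral.integral_sub
        ((hcont _ (hE b₁)).intervalIntegrable _ _) ((hcont _ (hE b₂)).intervalIntegrable _ _)]
      simp only [Φ, ContinuousMap.coe_mk]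
      rw [← mul_sub, abs_mul, abs_of_pos (Real.exp_pos _)]
      congr 2
      ring
    rw [h1]
    have e : Real.exp (-(K * r)) * Real.exp (K * r) = 1 := by rw [← Real.exp_add]; simp
    calc Real.exp (-(K * r)) * |∫ s in (0)..(r : ℝ), (N (E b₁) s - N (E b₂) s)|
        ≤ Real.exp (-(K * r)) * (C * dist b₁ b₂ * ((Real.exp (K * r) - 1) / K)) :=
          mul_le_mul_of_nonneg_left (hint.trans hval.le) (Real.exp_pos _).le
      _ = C / K * (1 - Real.exp (-(K * r))) * dist b₁ b₂ := by
          linear_combination (C * dist b₁ b₂ / K) * e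
      _ ≤ C / K * 1 * dist b₁ b₂ := by
          gcongr
          linarith [Real.exp_pos (-(K * (r : ℝ)))]
      _ = ((1 / 2 : NNReal) : ℝ) * dist b₁ b₂ := by
          rw [hK]
          push_cast
          field_simp
  obtain ⟨b, hb⟩ : ∃ b, Φ b = b := ⟨hΦ.fixedPoint, hΦ.fixedPoint_isFixedPt⟩
  refine ⟨E b, hE b, fun r hr => ?_⟩
  have h1 : b ⟨r, hr⟩ = Real.exp (-(K * r)) * (a + ∫ s in (0)..r, N (E b) s) := by
    conv_lhs => rw [← hb]
    rfl
  have e : Real.exp (K * r) * Real.exp (-(K * r)) = 1 := by rw [← Real.exp_add]; simp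
  change Real.exp (K * r) * IccExtend hR.le b r = _
  rw [IccExtend_of_mem _ _ hr, h1, ← mul_assoc, e, one_mul]

theorem abs_rpow_sub_rpow_le {x y z e : ℝ} (hz : 0 < z) (he : e ≤ 1) (hx : z ≤ x)
    (hy : z ≤ y) : |x ^ e - y ^ e| ≤ |e| * z ^ (e - 1) * |x - y| := by
  have := (convex_Ici z).norm_image_sub_le_of_norm_hasDerivWithin_le
    (f := fun x : ℝ => x ^ e) (f' := fun x => e * x ^ (e - 1)) (C := |e| * z ^ (e - 1))
    (fun w hw => (Real.hasDerivAt_rpow_const (Or.inl (hz.trans_le hw).ne')).hasDerivWithinAt)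
    (fun w hw => by
      rw [norm_mul, Real.norm_eq_abs, Real.norm_eq_abs,
        abs_of_pos (Real.rpow_pos_of_pos (hz.trans_le hw) _)]
      exact mul_le_mul_of_nonneg_left (Real.rpow_le_rpow_of_nonpos hz hw (by linarith))
        (abs_nonneg _)) hy hx
  simpa [Real.norm_eq_abs] using this

/-- Regular solutions exist on intervals of any length. After rescaling the integral that defines the
flux, the equation reads `u(r) = a + ∫₀ʳ s^{(γ-α)/β} J(s)^{1/β} ds` with
`J(s) = ∫₀¹ τ^{γ-1} / f(u(s τ)) dτ`. As `u ≥ a`, the nonlinearity may be replaced by its value at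
`max u a`; then `J` is bounded below and Lipschitz in `u`, and the Volterra contraction applies. -/
theorem exists_regular {α β γ m : ℝ} (hγα : α < γ) (hαβ : β < α) (hβ : 1 ≤ β) (hm : 0 < m)
    {R a : ℝ} (hR : 0 < R) (ha : 0 < a) :
    ∃ u F, IsFluxPair α β γ m R u F ∧ Continuous u ∧ u 0 = a := by
  have hβ0 : 0 < β := by linarith
  have hγ1 : 0 < γ - 1 := by linarith
  have hγ0 : 0 < γ := by linarith
  obtain ⟨h, hh⟩ : ∃ h : ℝ → ℝ, h = fun x => Real.exp (max x a ^ (-m)) := ⟨_, rfl⟩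
  obtain ⟨H, hH⟩ : ∃ H, H = Real.exp (a ^ (-m)) := ⟨_, rfl⟩
  have hamax : ∀ x, 0 < max x a := fun x => ha.trans_le (le_max_right _ _)
  have hcont : Continuous h := by
    rw [hh]
    exact Real.continuous_exp.comp ((continuous_id.max continuous_const).rpow_const
      fun x => Or.inl (hamax x).ne')
  have h1le : ∀ x, 1 ≤ h x := fun x => by
    rw [hh]
    exact Real.one_le_exp (Real.rpow_nonneg (hamax x).le _)
  have hpow : ∀ x, max x a ^ (-m) ≤ a ^ (-m) := fun x =>
    Real.rpow_le_rpow_of_nonpos ha (le_max_right _ _) (by linarith)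
  have hleH : ∀ x, h x ≤ H := fun x => by
    rw [hh, hH]
    exact Real.exp_le_exp.2 (hpow x)
  obtain ⟨L, hL0, hL⟩ : ∃ L > 0, ∀ x y, |h x - h y| ≤ L * |x - y| := by
    have hm' : 0 < |-m| := abs_pos.2 (by linarith)
    refine ⟨H * (|-m| * a ^ (-m - 1)), by rw [hH]; positivity, fun x y => ?_⟩
    have g1 : |h x - h y| ≤ H * |max x a ^ (-m) - max y a ^ (-m)| := by
      rw [hh, hH]
      exact abs_exp_sub_exp_le (Real.exp_le_exp.2 (hpow x)) (Real.exp_le_exp.2 (hpow y))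
    have g2 := abs_rpow_sub_rpow_le ha (show -m ≤ 1 by linarith) (le_max_right x a)
      (le_max_right y a)
    have g3 : |max x a - max y a| ≤ |x - y| := abs_max_sub_max_le_abs x y a
    have g4 : 0 ≤ |-m| * a ^ (-m - 1) := by positivity
    have hH0 : 0 ≤ H := by rw [hH]; positivity
    calc |h x - h y| ≤ H * |max x a ^ (-m) - max y a ^ (-m)| := g1
      _ ≤ H * (|-m| * a ^ (-m - 1) * |x - y|) :=
          mul_le_mul_of_nonneg_left (g2.trans (mul_le_mul_of_nonneg_left g3 g4)) hH0
      _ = _ := by ring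
  obtain ⟨J, hJ⟩ : ∃ J : (ℝ → ℝ) → ℝ → ℝ, J = fun u s =>
    ∫ τ in (0)..1, τ ^ (γ - 1) * h (u (s * τ)) := ⟨_, rfl⟩
  have hpc : Continuous fun τ : ℝ => τ ^ (γ - 1) := Real.continuous_rpow_const hγ1.le
  have hJi : ∀ u, Continuous u → ∀ s, Continuous fun τ : ℝ => τ ^ (γ - 1) * h (u (s * τ)) :=
    fun u hu s => hpc.mul (hcont.comp (hu.comp (by fun_prop)))
  have hJc : ∀ u, Continuous u → Continuous (J u) := fun u hu => by
    rw [hJ]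
    refine intervalIntegral.continuous_parametric_intervalIntegral_of_continuous'
      (f := fun s τ : ℝ => τ ^ (γ - 1) * h (u (s * τ))) ?_ 0 1
    exact (hpc.comp continuous_snd).mul (hcont.comp (hu.comp (by fun_prop)))
  have hint1 : ∫ τ in (0 : ℝ)..1, τ ^ (γ - 1) = 1 / γ := by
    rw [integral_rpow (Or.inl (by linarith))]
    simp [Real.zero_rpow hγ0.ne']
  have hJlow : ∀ u, Continuous u → ∀ s, 1 / γ ≤ J u s := fun u hu s => by
    rw [hJ, ← hint1]
    refine intervalIntegral.integral_mono_on zero_le_one (hpc.intervalIntegrable _ _)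
      ((hJi u hu s).intervalIntegrable _ _) fun τ hτ => ?_
    exact le_mul_of_one_le_right (Real.rpow_nonneg hτ.1 _) (h1le _)
  have hJlip : ∀ u w, Continuous u → Continuous w → ∀ s ∈ Icc 0 R, ∀ M,
      (∀ x ∈ Icc 0 s, |u x - w x| ≤ M) → |J u s - J w s| ≤ L * M := by
    intro u w hu hw s hs M hM
    rw [hJ]
    simp only
    rw [← intervalIntegral.integral_sub ((hJi u hu s).intervalIntegrable _ _)
      ((hJi w hw s).intervalIntegrable _ _), ← Real.norm_eq_abs]
    have := intervalIntegral.norm_integral_le_of_norm_le_const (a := 0) (b := 1) (C := L * M)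
      (f := fun τ : ℝ => τ ^ (γ - 1) * h (u (s * τ)) - τ ^ (γ - 1) * h (w (s * τ))) ?_
    · simpa using this
    · intro τ hτ
      rw [uIoc_of_le zero_le_one] at hτ
      rw [← mul_sub, Real.norm_eq_abs, abs_mul, abs_of_nonneg (Real.rpow_nonneg hτ.1.le _)]
      have e1 : τ ^ (γ - 1) ≤ 1 := Real.rpow_le_one hτ.1.le hτ.2 hγ1.le
      have e2 := hM (s * τ) ⟨mul_nonneg hs.1 hτ.1.le, mul_le_of_le_one_right hs.1 hτ.2⟩
      have e3 := (hL (u (s * τ)) (w (s * τ))).trans (mul_le_mul_of_nonneg_left e2 hL0.le)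
      calc τ ^ (γ - 1) * |h (u (s * τ)) - h (w (s * τ))|
          ≤ 1 * |h (u (s * τ)) - h (w (s * τ))| := mul_le_mul_of_nonneg_right e1 (abs_nonneg _)
        _ ≤ L * M := by rw [one_mul]; exact e3
  -- `N u` is the right-hand side `(r^{-α} F)^{1/β}` of the equation for `u`, where `F = r^γ J`.
  obtain ⟨N, hN⟩ : ∃ N : (ℝ → ℝ) → ℝ → ℝ, N = fun u s =>
    s ^ ((γ - α) / β) * J u s ^ (1 / β) := ⟨_, rfl⟩
  have hσ : 0 < (γ - α) / β := div_pos (by linarith) hβ0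
  have hJ0 : ∀ u, Continuous u → ∀ s, 0 < J u s := fun u hu s =>
    (by positivity : (0 : ℝ) < 1 / γ).trans_le (hJlow u hu s)
  have hNc : ∀ u, Continuous u → Continuous (N u) := fun u hu => by
    rw [hN]
    exact (Real.continuous_rpow_const hσ.le).mul
      ((hJc u hu).rpow_const fun s => Or.inl (hJ0 u hu s).ne')
  obtain ⟨u, hu, hueq⟩ := exists_volterra (N := N)
    (C := R ^ ((γ - α) / β) * (|1 / β| * (1 / γ) ^ (1 / β - 1) * L)) hR (by positivity) a hNc
    (by
      intro u w hu hw s hs M hM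
      rw [hN]
      simp only
      rw [← mul_sub, abs_mul, abs_of_nonneg (Real.rpow_nonneg hs.1 _), mul_assoc]
      refine mul_le_mul (Real.rpow_le_rpow hs.1 hs.2 hσ.le) ?_ (abs_nonneg _) (by positivity)
      refine (abs_rpow_sub_rpow_le (by positivity) ((div_le_one hβ0).2 hβ) (hJlow u hu s)
        (hJlow w hw s)).trans ?_
      rw [mul_assoc (|1 / β| * (1 / γ) ^ (1 / β - 1))]
      exact mul_le_mul_of_nonneg_left (hJlip u w hu hw s hs M hM) (by positivity))
  have hua : ∀ r ∈ Icc 0 R, a ≤ u r := by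
    intro r hr
    rw [hueq r hr]
    have : 0 ≤ ∫ s in (0)..r, N u s := by
      refine intervalIntegral.integral_nonneg hr.1 fun s hs => ?_
      rw [hN]
      exact mul_nonneg (Real.rpow_nonneg hs.1 _) (Real.rpow_nonneg (hJ0 u hu s).le _)
    linarith
  have hgc : Continuous fun x : ℝ => x ^ (γ - 1) * h (u x) := hpc.mul (hcont.comp hu)
  have hF : ∀ r, 0 < r → ∫ x in (0)..r, x ^ (γ - 1) * h (u x) = r ^ γ * J u r := by
    intro r hr
    have h1 := intervalIntegral.mul_integral_comp_mul_left (a := 0) (b := 1) (c := r)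
      (f := fun x : ℝ => x ^ (γ - 1) * h (u x))
    rw [mul_zero, mul_one] at h1
    rw [← h1, hJ]
    have h2 : ∫ x in (0 : ℝ)..1, (r * x) ^ (γ - 1) * h (u (r * x))
        = ∫ x in (0 : ℝ)..1, r ^ (γ - 1) * (x ^ (γ - 1) * h (u (r * x))) := by
      refine intervalIntegral.integral_congr fun x hx => ?_
      rw [uIcc_of_le zero_le_one] at hx
      rw [Real.mul_rpow hr.le hx.1, mul_assoc]
    rw [h2, intervalIntegral.integral_const_mul, ← mul_assoc]
    congr 1
    rw [mul_comm, ← Real.rpow_add_one hr.ne', sub_add_cancel]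
  refine ⟨u, fun r => ∫ x in (0)..r, x ^ (γ - 1) * h (u x), ⟨?_, ?_, ?_, ?_⟩, hu, ?_⟩
  · exact fun r hr => ha.trans_le (hua r ⟨hr.1.le, hr.2.le⟩)
  · intro r hr
    rw [hF r hr.1]
    exact mul_pos (Real.rpow_pos_of_pos hr.1 _) (hJ0 u hu r)
  · intro r hr
    have h1 : HasDerivAt (fun r => a + ∫ s in (0)..r, N u s) (N u r) r :=
      ((hNc u hu).integral_hasStrictDerivAt 0 r).hasDerivAt.const_add a
    have h2 : u =ᶠ[𝓝 r] fun r => a + ∫ s in (0)..r, N u s := by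
      filter_upwards [Ioo_mem_nhds hr.1 hr.2] with s hs using hueq s ⟨hs.1.le, hs.2.le⟩
    refine (h1.congr_of_eventuallyEq h2).congr_deriv ?_
    rw [hF r hr.1, hN, ← mul_assoc, ← Real.rpow_add hr.1,
      Real.mul_rpow (Real.rpow_nonneg hr.1.le _) (hJ0 u hu r).le, ← Real.rpow_mul hr.1.le]
    rw [show (-α + γ) * (1 / β) = (γ - α) / β by ring]
  · intro r hr
    refine (hgc.integral_hasStrictDerivAt 0 r).hasDerivAt.congr_deriv ?_
    rw [hh]
    simp only
    rw [max_eq_left (hua r ⟨hr.1.le, hr.2.le⟩), one_div,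
      Real.rpow_neg (ha.trans_le (hua r ⟨hr.1.le, hr.2.le⟩)).le]
  · rw [hueq 0 ⟨le_rfl, hR.le⟩]
    simp

/-! ### Comparison of orbits and the limit orbit -/

/-- The constants of the comparison of orbits on `(-∞, T)`. An orbit with `v > B N` somewhere before
the time `N` is near the equilibrium from the time `N + τ` on. Any two such orbits approach each
other exponentially after that time, and if the linearization at the equilibrium rotates, their
`v`-components agree somewhere in every interval of length `ℓ`. -/
structure IsOrbitComparison (β δ θ κ c T τ W M k ℓ : ℝ) (B : ℝ → ℝ) : Prop where
  k_pos : 0 < k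
  ℓ_pos : 0 < ℓ
  capture : ∀ v p q : ℝ → ℝ, IsOrbit β δ θ κ c T v p q → ∀ N < T, (∃ t ≤ N, B N < v t) →
    ∀ t, N + τ ≤ t → t < T → 1 ≤ v t ∧ W ≤ p t + β * q t
  contract : ∀ v₁ p₁ q₁ v₂ p₂ q₂ : ℝ → ℝ, IsOrbit β δ θ κ c T v₁ p₁ q₁ →
    IsOrbit β δ θ κ c T v₂ p₂ q₂ → ∀ N < T, (∃ t ≤ N, B N < v₁ t) → (∃ t ≤ N, B N < v₂ t) →
    ∀ t, N + τ ≤ t → t < T →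
      (p₁ t - p₂ t) ^ 2 + (q₁ t - q₂ t) ^ 2 ≤ M * Real.exp (-(k * (t - (N + τ))))
  rotate : δ * β < 4 * θ → ∀ v₁ p₁ q₁ v₂ p₂ q₂ : ℝ → ℝ, IsOrbit β δ θ κ c T v₁ p₁ q₁ →
    IsOrbit β δ θ κ c T v₂ p₂ q₂ → ∀ N < T, (∃ t ≤ N, B N < v₁ t) → (∃ t ≤ N, B N < v₂ t) →
    ∀ s, N + τ ≤ s → s + ℓ < T → ∃ r ∈ Icc s (s + ℓ), v₁ r = v₂ r

theorem log_mem_Icc_of_abs_exp_sub_le {a x : ℝ} (ha : 0 < a) (h : |Real.exp x - a| ≤ a / 2) :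
    x ∈ Icc (Real.log (a / 2)) (Real.log (2 * a)) := by
  rw [abs_le] at h
  exact ⟨(Real.log_le_iff_le_exp (by positivity)).2 (by linarith),
    (Real.le_log_iff_exp_le (by positivity)).2 (by linarith)⟩

/-- The capture near the equilibrium makes the difference of two orbits a small perturbation of the
linearized system, to which the contraction and the rotation lemma apply. -/
theorem exists_isOrbitComparison {β δ θ κ : ℝ} (hβ : 1 ≤ β) (hδ : 0 < δ) (hθ : 0 < θ)
    (hκ : 0 < κ) (c : ℝ) :
    ∃ T τ W M k ℓ : ℝ, ∃ B : ℝ → ℝ, IsOrbitComparison β δ θ κ c T τ W M k ℓ B := by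
  have hβ0 : 0 < β := by linarith
  obtain ⟨ε₁, hε₁, C, hC, k, hk, hcontr⟩ := exists_contraction hβ0 hδ hθ
  obtain ⟨ε₂, hε₂, ℓ, hℓ, hrot⟩ : ∃ ε > 0, ∃ ℓ > 0, δ * β < 4 * θ →
      ∀ (X Y e₁ e₂ : ℝ → ℝ) (s : ℝ),
      (∀ r ∈ Icc s (s + ℓ), HasDerivAt X (-δ * X r - θ * Y r + e₁ r) r) →
      (∀ r ∈ Icc s (s + ℓ), HasDerivAt Y (δ / β * X r + e₂ r) r) →
      (∀ r ∈ Icc s (s + ℓ), |e₁ r| ≤ ε * (|X r| + |Y r|)) →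
      (∀ r ∈ Icc s (s + ℓ), |e₂ r| ≤ ε * (|X r| + |Y r|)) →
      ∃ r ∈ Icc s (s + ℓ), X r + β * Y r = 0 := by
    by_cases hd : δ * β < 4 * θ
    · obtain ⟨ε, hε, ℓ, hℓ, h⟩ := exists_zero_of_rotation hβ0 hδ hθ hd
      exact ⟨ε, hε, ℓ, hℓ, fun _ => h⟩
    · exact ⟨1, one_pos, 1, one_pos, fun h => absurd h hd⟩
  obtain ⟨ε, hε, hεε₁, hεε₂, hεδ, hεθ⟩ : ∃ ε : ℝ, 0 < ε ∧ 2 * ε ≤ ε₁ ∧ 2 * ε ≤ ε₂ ∧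
      ε ≤ δ / 2 ∧ ε ≤ θ / 2 := by
    refine ⟨min (min (ε₁ / 2) (ε₂ / 2)) (min (δ / 2) (θ / 2)), by positivity, ?_, ?_, ?_, ?_⟩
    · linarith [(min_le_left (min (ε₁ / 2) (ε₂ / 2)) (min (δ / 2) (θ / 2))).trans
        (min_le_left _ _)]
    · linarith [(min_le_left (min (ε₁ / 2) (ε₂ / 2)) (min (δ / 2) (θ / 2))).trans
        (min_le_right _ _)]
    · exact (min_le_right _ _).trans (min_le_left _ _)
    · exact (min_le_right _ _).trans (min_le_right _ _)
  obtain ⟨R, hR1, hR⟩ : ∃ R : ℝ, 1 ≤ R ∧ κ * (θ + ε) * (1 + β) ≤ ε * R := by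
    refine ⟨max 1 (κ * (θ + ε) * (1 + β) / ε), le_max_left _ _, ?_⟩
    rw [← div_le_iff₀' hε]
    exact le_max_right _ _
  obtain ⟨T, τ, hτ, B, hcap⟩ := IsOrbit.exists_capture hβ0 hδ hθ hκ c hε R
  refine ⟨T, τ, Real.log (δ / 2) + β * Real.log (θ / 2),
    C * ((Real.log (2 * δ) - Real.log (δ / 2)) ^ 2 + (Real.log (2 * θ) - Real.log (θ / 2)) ^ 2),
    k, ℓ, B, hk, hℓ, ?_, ?_, ?_⟩
  · intro v p q h N hN hB t ht htT
    obtain ⟨h1, h2, h3⟩ := hcap T le_rfl v p q h N hN hB t ht htT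
    have h4 := (log_mem_Icc_of_abs_exp_sub_le hδ (h1.trans hεδ)).1
    have h5 := (log_mem_Icc_of_abs_exp_sub_le hθ (h2.trans hεθ)).1
    exact ⟨hR1.trans h3, add_le_add h4 (mul_le_mul_of_nonneg_left h5 hβ0.le)⟩
  · intro v₁ p₁ q₁ v₂ p₂ q₂ h₁ h₂ N hN hB₁ hB₂ t ht htT
    obtain ⟨e₁, e₂, he⟩ := IsOrbit.exists_sub_error hβ hθ hκ hε hR1 hR h₁ h₂
    have hlt : ∀ r ∈ Icc (N + τ) t, r < T := fun r hr => hr.2.trans_lt htT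
    have hc₁ := fun r (hr : r ∈ Icc (N + τ) t) => hcap T le_rfl v₁ p₁ q₁ h₁ N hN hB₁ r hr.1 (hlt r hr)
    have hc₂ := fun r (hr : r ∈ Icc (N + τ) t) => hcap T le_rfl v₂ p₂ q₂ h₂ N hN hB₂ r hr.1 (hlt r hr)
    have hle : ∀ r, 2 * ε * (|p₁ r - p₂ r| + |q₁ r - q₂ r|)
        ≤ ε₁ * (|p₁ r - p₂ r| + |q₁ r - q₂ r|) := fun r =>
      mul_le_mul_of_nonneg_right hεε₁ (by positivity)
    have key := hcontr (fun t => p₁ t - p₂ t) (fun t => q₁ t - q₂ t) e₁ e₂ (N + τ) t ht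
      (fun r hr => (he r (hlt r hr)).1) (fun r hr => (he r (hlt r hr)).2.1)
      (fun r hr => ((he r (hlt r hr)).2.2 (hc₁ r hr) (hc₂ r hr)).1.trans (hle r))
      (fun r hr => ((he r (hlt r hr)).2.2 (hc₁ r hr) (hc₂ r hr)).2.trans (hle r))
    have hs : N + τ ∈ Icc (N + τ) t := ⟨le_rfl, ht⟩
    obtain ⟨a1, a2, -⟩ := hc₁ _ hs
    obtain ⟨b1, b2, -⟩ := hc₂ _ hs
    have m1 := log_mem_Icc_of_abs_exp_sub_le hδ (a1.trans hεδ)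
    have m2 := log_mem_Icc_of_abs_exp_sub_le hθ (a2.trans hεθ)
    have m3 := log_mem_Icc_of_abs_exp_sub_le hδ (b1.trans hεδ)
    have m4 := log_mem_Icc_of_abs_exp_sub_le hθ (b2.trans hεθ)
    have g1 : (p₁ (N + τ) - p₂ (N + τ)) ^ 2 ≤ (Real.log (2 * δ) - Real.log (δ / 2)) ^ 2 :=
      sq_le_sq' (by linarith [m1.1, m3.2]) (by linarith [m1.2, m3.1])
    have g2 : (q₁ (N + τ) - q₂ (N + τ)) ^ 2 ≤ (Real.log (2 * θ) - Real.log (θ / 2)) ^ 2 :=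
      sq_le_sq' (by linarith [m2.1, m4.2]) (by linarith [m2.2, m4.1])
    refine key.trans ((mul_le_mul_of_nonneg_left (add_le_add g1 g2) (by positivity)).trans ?_)
    exact le_of_eq (by ring)
  · intro hd v₁ p₁ q₁ v₂ p₂ q₂ h₁ h₂ N hN hB₁ hB₂ s hs hsT
    obtain ⟨e₁, e₂, he⟩ := IsOrbit.exists_sub_error hβ hθ hκ hε hR1 hR h₁ h₂
    have hlt : ∀ r ∈ Icc s (s + ℓ), r < T := fun r hr => hr.2.trans_lt hsT
    have hc₁ := fun r (hr : r ∈ Icc s (s + ℓ)) =>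
      hcap T le_rfl v₁ p₁ q₁ h₁ N hN hB₁ r (hs.trans hr.1) (hlt r hr)
    have hc₂ := fun r (hr : r ∈ Icc s (s + ℓ)) =>
      hcap T le_rfl v₂ p₂ q₂ h₂ N hN hB₂ r (hs.trans hr.1) (hlt r hr)
    have hle : ∀ r, 2 * ε * (|p₁ r - p₂ r| + |q₁ r - q₂ r|)
        ≤ ε₂ * (|p₁ r - p₂ r| + |q₁ r - q₂ r|) := fun r =>
      mul_le_mul_of_nonneg_right hεε₂ (by positivity)
    obtain ⟨r, hr, hr0⟩ := hrot hd (fun t => p₁ t - p₂ t) (fun t => q₁ t - q₂ t) e₁ e₂ s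
      (fun r hr => (he r (hlt r hr)).1) (fun r hr => (he r (hlt r hr)).2.1)
      (fun r hr => ((he r (hlt r hr)).2.2 (hc₁ r hr) (hc₂ r hr)).1.trans (hle r))
      (fun r hr => ((he r (hlt r hr)).2.2 (hc₁ r hr) (hc₂ r hr)).2.trans (hle r))
    exact ⟨r, hr, (IsOrbit.v_eq_iff hβ0 hκ h₁ h₂ (hlt r hr)).2 hr0⟩

/-- Locally uniform convergence to a continuous function is convergence in both variables
jointly. In this form it is stable under composition with continuous functions. -/
theorem tendstoLocallyUniformlyOn_iff_joint {ι : Type*} {l : Filter ι} {F : ι → ℝ → ℝ} {f : ℝ → ℝ}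
    {s : Set ℝ} (hf : ContinuousOn f s) :
    TendstoLocallyUniformlyOn F f l s ↔
      ∀ x ∈ s, Tendsto (fun y : ι × ℝ => F y.1 y.2) (l ×ˢ 𝓝[s] x) (𝓝 (f x)) := by
  rw [tendstoLocallyUniformlyOn_iff_forall_tendsto]
  refine forall₂_congr fun x hx => ?_
  have h1 : Tendsto (fun y : ι × ℝ => f y.2) (l ×ˢ 𝓝[s] x) (𝓝 (f x)) :=
    Tendsto.comp (hf x hx) tendsto_snd
  rw [tendsto_uniformity_iff_dist_tendsto_zero]
  constructor
  · intro h2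
    rw [tendsto_iff_dist_tendsto_zero] at h1 ⊢
    refine squeeze_zero (fun _ => dist_nonneg) (fun y => ?_) (by simpa using h2.add h1)
    exact dist_triangle_left _ _ _
  · intro h2
    simpa using h1.dist h2

/-- As `v → ∞` along the family, its members are Cauchy, locally uniformly in time, by the
exponential contraction; the limit is again an orbit. -/
theorem IsOrbitComparison.exists_limit {β δ θ κ c T τ W M k ℓ : ℝ} {B : ℝ → ℝ} (hβ : 0 < β)
    (hκ : 0 < κ) (H : IsOrbitComparison β δ θ κ c T τ W M k ℓ B) {ι : Type*} {l : Filter ι}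
    [l.NeBot] {v p q : ι → ℝ → ℝ} (h : ∀ᶠ i in l, IsOrbit β δ θ κ c T (v i) (p i) (q i))
    (hlarge : ∀ N < T, ∀ᶠ i in l, ∃ t ≤ N, B N < v i t) :
    ∃ v' p' q' : ℝ → ℝ, IsOrbit β δ θ κ c T v' p' q' ∧
      TendstoLocallyUniformlyOn v v' l (Iio T) ∧ TendstoLocallyUniformlyOn p p' l (Iio T) ∧
      TendstoLocallyUniformlyOn q q' l (Iio T) ∧ ∀ t < T, W ≤ p' t + β * q' t := by
  -- All members of the family are close to each other on `[t₁, T)`.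
  have hclose : ∀ t₁ < T, ∀ ε > 0, ∀ᶠ i in l ×ˢ l, ∀ t ∈ Ico t₁ T,
      |v i.1 t - v i.2 t| < ε ∧ |p i.1 t - p i.2 t| < ε ∧ |q i.1 t - q i.2 t| < ε := by
    intro t₁ ht₁ ε hε
    obtain ⟨η, hη⟩ : ∃ η, η = ε / (2 * (1 + β)) := ⟨_, rfl⟩
    have hη0 : 0 < η := by rw [hη]; positivity
    have hηε : (1 + β) * η < ε := by
      have : (1 + β) * η = ε / 2 := by rw [hη]; field_simp
      linarith
    have hlim : Tendsto (fun N => M * Real.exp (-(k * (t₁ - (N + τ))))) atBot (𝓝 (M * 0)) := by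
      refine ((Real.tendsto_exp_atBot).comp ?_).const_mul M
      have h1 : Tendsto (fun N => k * N + -(k * (t₁ - τ))) atBot atBot :=
        tendsto_atBot_add_const_right _ _ (tendsto_id.const_mul_atBot H.k_pos)
      exact h1.congr fun N => by ring
    rw [mul_zero] at hlim
    obtain ⟨N, ⟨hN1, hN2⟩, hN3⟩ := (((hlim.eventually (Iio_mem_nhds (show 0 < η ^ 2 by
      positivity))).and (eventually_lt_atBot T)).and (eventually_le_atBot (t₁ - τ))).exists
    have hev := (h.and (hlarge N hN2))
    filter_upwards [hev.prod_mk hev] with i hi t ht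
    have hle : N + τ ≤ t := by linarith [ht.1]
    have key := H.contract _ _ _ _ _ _ hi.1.1 hi.2.1 N hN2 hi.1.2 hi.2.2 t hle ht.2
    have hexp : M * Real.exp (-(k * (t - (N + τ)))) ≤ M * Real.exp (-(k * (t₁ - (N + τ)))) := by
      have hM : 0 ≤ M := by
        have := (add_nonneg (sq_nonneg (p i.1 t - p i.2 t)) (sq_nonneg (q i.1 t - q i.2 t))).trans
          key
        exact nonneg_of_mul_nonneg_left this (Real.exp_pos _)
      refine mul_le_mul_of_nonneg_left (Real.exp_le_exp.2 ?_) hM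
      have := mul_le_mul_of_nonneg_left ht.1 H.k_pos.le
      linarith
    have hN1' : M * Real.exp (-(k * (t₁ - (N + τ)))) < η ^ 2 := hN1
    have hx : |p i.1 t - p i.2 t| < η :=
      abs_lt_of_sq_lt_sq (by linarith [sq_nonneg (q i.1 t - q i.2 t)]) hη0.le
    have hy : |q i.1 t - q i.2 t| < η :=
      abs_lt_of_sq_lt_sq (by linarith [sq_nonneg (p i.1 t - p i.2 t)]) hη0.le
    have hηle : η ≤ (1 + β) * η := by nlinarith
    refine ⟨?_, by linarith, by linarith⟩
    refine ((IsOrbit.abs_v_sub_le hβ hκ hi.1.1 hi.2.1 ht.2).trans (abs_add_le _ _)).trans_lt ?_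
    rw [abs_mul, abs_of_pos hβ]
    have := mul_le_mul_of_nonneg_left hy.le hβ.le
    linarith
  have hlimit : ∀ f : ι → ℝ → ℝ, (∀ t₁ < T, ∀ ε > 0, ∀ᶠ i in l ×ˢ l, ∀ t ∈ Ico t₁ T,
      |f i.1 t - f i.2 t| < ε) → ∃ g, TendstoLocallyUniformlyOn f g l (Iio T) := by
    intro f hf
    have hC : ∀ t₁ < T, UniformCauchySeqOn f l (Ico t₁ T) := by
      intro t₁ ht₁ u hu
      obtain ⟨ε, hε, hεu⟩ := Metric.mem_uniformity_dist.1 hu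
      filter_upwards [hf t₁ ht₁ ε hε] with i hi t ht using hεu (hi t ht)
    have hex : ∀ t, ∃ x, t < T → Tendsto (fun i => f i t) l (𝓝 x) := by
      intro t
      by_cases ht : t < T
      · obtain ⟨x, hx⟩ := CompleteSpace.complete ((hC t ht).cauchy_map ⟨le_rfl, ht⟩)
        exact ⟨x, fun _ => hx⟩
      · exact ⟨0, fun h => absurd h ht⟩
    choose g hg using hex
    refine ⟨g, fun u hu x hx => ⟨Ico (x - 1) T, ?_, ?_⟩⟩
    · exact mem_nhdsWithin_of_mem_nhds (Ico_mem_nhds (by linarith) hx)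
    · have hx' : x - 1 < T := by linarith [mem_Iio.1 hx]
      exact (hC (x - 1) hx').tendstoUniformlyOn_of_tendsto (fun t ht => hg t ht.2) u hu
  obtain ⟨v', hv'⟩ := hlimit v fun t₁ ht₁ ε hε =>
    (hclose t₁ ht₁ ε hε).mono fun i hi t ht => (hi t ht).1
  obtain ⟨p', hp'⟩ := hlimit p fun t₁ ht₁ ε hε =>
    (hclose t₁ ht₁ ε hε).mono fun i hi t ht => (hi t ht).2.1
  obtain ⟨q', hq'⟩ := hlimit q fun t₁ ht₁ ε hε =>
    (hclose t₁ ht₁ ε hε).mono fun i hi t ht => (hi t ht).2.2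
  have hvt : ∀ t < T, Tendsto (fun i => v i t) l (𝓝 (v' t)) := fun t ht =>
    hv'.tendsto_at ht
  have hpt : ∀ t < T, Tendsto (fun i => p i t) l (𝓝 (p' t)) := fun t ht =>
    hp'.tendsto_at ht
  have hqt : ∀ t < T, Tendsto (fun i => q i t) l (𝓝 (q' t)) := fun t ht =>
    hq'.tendsto_at ht
  have hcap : ∀ t < T, ∀ᶠ i in l, 1 ≤ v i t ∧ W ≤ p i t + β * q i t := by
    intro t ht
    obtain ⟨N, hN1, hN2⟩ : ∃ N < T, N + τ ≤ t := by
      refine ⟨min (T - 1) (t - τ), (min_le_left _ _).trans_lt (by linarith), ?_⟩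
      linarith [min_le_right (T - 1) (t - τ)]
    filter_upwards [h, hlarge N hN1] with i hi hi'
    exact H.capture _ _ _ hi N hN1 hi' t hN2 ht
  have hvpos : ∀ t < T, 0 < v' t := fun t ht =>
    one_pos.trans_le (ge_of_tendsto (hvt t ht) ((hcap t ht).mono fun i hi => hi.1))
  have hvc : ContinuousOn v' (Iio T) := hv'.continuousOn (h.mono fun i hi t ht =>
    (hi.deriv_v t ht).continuousAt.continuousWithinAt).frequently
  have hpc : ContinuousOn p' (Iio T) := hp'.continuousOn (h.mono fun i hi t ht =>
    (hi.deriv_p t ht).continuousAt.continuousWithinAt).frequently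
  have hqc : ContinuousOn q' (Iio T) := hq'.continuousOn (h.mono fun i hi t ht =>
    (hi.deriv_q t ht).continuousAt.continuousWithinAt).frequently
  have hvj := (tendstoLocallyUniformlyOn_iff_joint hvc).1 hv'
  have hpj := (tendstoLocallyUniformlyOn_iff_joint hpc).1 hp'
  have hqj := (tendstoLocallyUniformlyOn_iff_joint hqc).1 hq'
  refine ⟨v', p', q', ⟨hvpos, ?_, ?_, ?_, ?_⟩, hv', hp', hq', fun t ht => ?_⟩
  · intro t ht
    refine hasDerivAt_of_tendstoLocallyUniformlyOn (f := v) (f' := fun i t => -Real.exp (q i t))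
      (g' := fun t => -Real.exp (q' t)) isOpen_Iio ?_ (h.mono fun i hi => hi.deriv_v) hvt ht
    rw [tendstoLocallyUniformlyOn_iff_joint (by fun_prop)]
    exact fun x hx => ((Real.continuous_exp.tendsto _).comp (hqj x hx)).neg
  · intro t ht
    refine hasDerivAt_of_tendstoLocallyUniformlyOn (f := p)
      (f' := fun i t => -(Real.exp (p i t) - δ) - (Real.exp (q i t) - θ))
      (g' := fun t => -(Real.exp (p' t) - δ) - (Real.exp (q' t) - θ)) isOpen_Iio ?_
      (h.mono fun i hi => hi.deriv_p) hpt ht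
    rw [tendstoLocallyUniformlyOn_iff_joint (by fun_prop)]
    exact fun x hx => ((((Real.continuous_exp.tendsto _).comp (hpj x hx)).sub_const δ).neg).sub
      (((Real.continuous_exp.tendsto _).comp (hqj x hx)).sub_const θ)
  · intro t ht
    refine hasDerivAt_of_tendstoLocallyUniformlyOn (f := q)
      (f' := fun i t => (Real.exp (p i t) - δ) / β - κ * (Real.exp (q i t) / v i t))
      (g' := fun t => (Real.exp (p' t) - δ) / β - κ * (Real.exp (q' t) / v' t)) isOpen_Iio ?_
      (h.mono fun i hi => hi.deriv_q) hqt ht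
    rw [tendstoLocallyUniformlyOn_iff_joint]
    · exact fun x hx => ((((Real.continuous_exp.tendsto _).comp (hpj x hx)).sub_const δ).div_const
        β).sub ((((Real.continuous_exp.tendsto _).comp (hqj x hx)).div (hvj x hx)
          (hvpos x hx).ne').const_mul κ)
    · have h1 : ContinuousOn (fun t => Real.exp (q' t) / v' t) (Iio T) :=
        (by fun_prop : ContinuousOn (fun t => Real.exp (q' t)) (Iio T)).div hvc
          fun x hx => (hvpos x hx).ne'
      fun_prop
  · intro t ht
    have h1 : Tendsto (fun i => p i t + β * q i t) l (𝓝 (p' t + β * q' t)) :=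
      (hpt t ht).add ((hqt t ht).const_mul β)
    have h2 : Tendsto (fun i => v i t + κ * β * Real.log (v i t) + θ * t + c) l
        (𝓝 (v' t + κ * β * Real.log (v' t) + θ * t + c)) :=
      (((hvt t ht).add (((hvt t ht).log (hvpos t ht).ne').const_mul _)).add_const _).add_const _
    exact tendsto_nhds_unique h1 (h2.congr' (h.mono fun i hi => (hi.level t ht).symm))
  · exact ge_of_tendsto ((hpt t ht).add ((hqt t ht).const_mul β))
      ((hcap t ht).mono fun i hi => hi.2)

/-- Two orbits along both of which `v → ∞` at `-∞` coincide. -/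
theorem IsOrbitComparison.eq_of_tendsto_atTop {β δ θ κ c T τ W M k ℓ : ℝ} {B : ℝ → ℝ} (hβ : 0 < β)
    (hκ : 0 < κ) (H : IsOrbitComparison β δ θ κ c T τ W M k ℓ B) {v₁ p₁ q₁ v₂ p₂ q₂ : ℝ → ℝ}
    (h₁ : IsOrbit β δ θ κ c T v₁ p₁ q₁) (h₂ : IsOrbit β δ θ κ c T v₂ p₂ q₂)
    (hv₁ : Tendsto v₁ atBot atTop) (hv₂ : Tendsto v₂ atBot atTop) :
    ∀ t < T, v₁ t = v₂ t := by
  intro t ht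
  have hlarge : ∀ v : ℝ → ℝ, Tendsto v atBot atTop → ∀ N, ∃ s ≤ N, B N < v s := fun v hv N =>
    ((eventually_le_atBot N).and (hv.eventually_gt_atTop (B N))).exists
  have hlim : Tendsto (fun N => M * Real.exp (-(k * (t - (N + τ))))) atBot (𝓝 (M * 0)) := by
    refine ((Real.tendsto_exp_atBot).comp ?_).const_mul M
    have h1 : Tendsto (fun N => k * N + -(k * (t - τ))) atBot atBot :=
      tendsto_atBot_add_const_right _ _ (tendsto_id.const_mul_atBot H.k_pos)
    exact h1.congr fun N => by ring
  rw [mul_zero] at hlim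
  have h0 : (p₁ t - p₂ t) ^ 2 + (q₁ t - q₂ t) ^ 2 ≤ 0 := by
    refine ge_of_tendsto hlim ?_
    filter_upwards [eventually_lt_atBot T, eventually_le_atBot (t - τ)] with N hN hN'
    exact H.contract _ _ _ _ _ _ h₁ h₂ N hN (hlarge v₁ hv₁ N) (hlarge v₂ hv₂ N) t
      (by linarith) ht
  have hx : p₁ t - p₂ t = 0 := by
    have := sq_nonneg (q₁ t - q₂ t)
    exact (pow_eq_zero_iff two_ne_zero).1 (le_antisymm (by linarith) (sq_nonneg _))
  have hy : q₁ t - q₂ t = 0 := by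
    have := sq_nonneg (p₁ t - p₂ t)
    exact (pow_eq_zero_iff two_ne_zero).1 (le_antisymm (by linarith) (sq_nonneg _))
  rw [IsOrbit.v_eq_iff hβ hκ h₁ h₂ ht, hx, hy]
  simp

/-! ### Asymptotics of the singular solution and convergence of the regular ones -/

theorem IsOrbit.tendsto_v_atTop {β δ θ κ c T W : ℝ} {v p q : ℝ → ℝ} (hβ : 0 < β) (hθ : 0 < θ)
    (hκ : 0 < κ) (h : IsOrbit β δ θ κ c T v p q) (hW : ∀ t < T, W ≤ p t + β * q t) :
    Tendsto v atBot atTop := by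
  have hκβ := mul_pos hκ hβ
  have h1 : Tendsto (fun t => (1 / (1 + κ * β)) * ((W - c) + -(θ * t))) atBot atTop := by
    refine Tendsto.const_mul_atTop (by positivity) (tendsto_atTop_add_const_left _ _ ?_)
    exact tendsto_neg_atBot_atTop.comp (tendsto_id.const_mul_atBot hθ)
  refine tendsto_atTop_mono' _ ?_ h1
  filter_upwards [eventually_lt_atBot T] with t ht
  have h2 := Real.log_le_self (h.v_pos t ht).le
  have h3 := mul_le_mul_of_nonneg_left h2 hκβ.le
  have h4 := h.level t ht
  have h5 := hW t ht
  rw [one_div, inv_mul_le_iff₀ (by positivity)]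
  linarith

/-- As the level `w = v + κ β log v + θ t + c` is bounded along an orbit, `v ∼ -θ t`. -/
theorem IsOrbit.tendsto_v_div {β δ θ κ c T W : ℝ} {v p q : ℝ → ℝ} (hβ : 0 < β) (hδ : 0 < δ)
    (hθ : 0 < θ) (hκ : 0 < κ) (h : IsOrbit β δ θ κ c T v p q)
    (hW : ∀ t < T, W ≤ p t + β * q t) :
    Tendsto (fun t => v t / (-(θ * t))) atBot (𝓝 1) := by
  have hv := h.tendsto_v_atTop hβ hθ hκ hW
  have hden : Tendsto (fun t => -(θ * t)) atBot atTop :=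
    tendsto_neg_atBot_atTop.comp (tendsto_id.const_mul_atBot hθ)
  have h1 : Tendsto (fun t => 1 + κ * β * (Real.log (v t) / v t)) atBot (𝓝 (1 + κ * β * 0)) :=
    ((Real.isLittleO_log_id_atTop.tendsto_div_nhds_zero.comp hv).const_mul _).const_add _
  have h2 : Tendsto (fun t => 1 + (p t + β * q t - c) / (-(θ * t))) atBot (𝓝 (1 + 0)) := by
    refine Tendsto.const_add _ ?_
    refine tendsto_of_tendsto_of_tendsto_of_le_of_le' (hden.const_div_atTop (W - c))
      (hden.const_div_atTop (Real.log (δ + θ) + β * Real.log θ - c)) ?_ ?_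
    · filter_upwards [eventually_lt_atBot T, hden.eventually_gt_atTop 0] with t ht ht0
      exact div_le_div_of_nonneg_right (by linarith [hW t ht]) ht0.le
    · filter_upwards [eventually_lt_atBot T, hden.eventually_gt_atTop 0] with t ht ht0
      exact div_le_div_of_nonneg_right (by linarith [h.level_le hβ hδ hθ hκ ht]) ht0.le
  have h3 := h2.div h1 (by simp)
  simp only [mul_zero, add_zero, div_one] at h3
  refine h3.congr' ?_
  filter_upwards [eventually_lt_atBot T, hden.eventually_gt_atTop 0,
    hv.eventually_gt_atTop 1] with t ht ht0 hv1
  have hv0 : v t ≠ 0 := by linarith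
  have hlog : 0 ≤ Real.log (v t) := Real.log_nonneg hv1.le
  have hκβ := mul_pos hκ hβ
  have hne : v t + κ * β * Real.log (v t) ≠ 0 := by
    have := mul_nonneg hκβ.le hlog
    linarith
  have e1 : 1 + (p t + β * q t - c) / (-(θ * t))
      = (v t + κ * β * Real.log (v t)) / (-(θ * t)) := by
    rw [h.level t ht, eq_div_iff ht0.ne', add_mul, div_mul_cancel₀ _ ht0.ne']
    ring
  have e2 : 1 + κ * β * (Real.log (v t) / v t) = (v t + κ * β * Real.log (v t)) / v t := by
    field_simp
  simp only [Pi.div_apply]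
  rw [e1, e2, div_div_div_comm, div_self hne, one_div_div]

theorem tendsto_orbitU {m : ℝ} {v : ℝ → ℝ} (hm : 0 < m) (hv : Tendsto v atBot atTop) :
    Tendsto (orbitU m v) (𝓝[>] 0) (𝓝 0) := by
  refine Real.tendsto_exp_atBot.comp ?_
  have h1 : -(1 / m) < 0 := by
    have : 0 < 1 / m := by positivity
    linarith
  exact (Real.tendsto_log_atTop.comp (hv.comp Real.tendsto_log_nhdsGT_zero)).const_mul_atTop_of_neg
    h1

theorem isEquivalent_orbitU {m θ : ℝ} {v : ℝ → ℝ} (hθ : 0 < θ)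
    (hv : Tendsto v atBot atTop) (h : Tendsto (fun t => v t / (-(θ * t))) atBot (𝓝 1)) :
    Asymptotics.IsEquivalent (𝓝[>] (0 : ℝ)) (orbitU m v)
      (fun r => |θ * Real.log r| ^ (-(1 / m))) := by
  refine Asymptotics.isEquivalent_of_tendsto_one ?_
  have h1 := (h.comp Real.tendsto_log_nhdsGT_zero).rpow_const (p := -(1 / m)) (Or.inl one_ne_zero)
  rw [Real.one_rpow] at h1
  refine h1.congr' ?_
  filter_upwards [(hv.comp Real.tendsto_log_nhdsGT_zero).eventually_gt_atTop 0,
    Real.tendsto_log_nhdsGT_zero.eventually_lt_atBot 0] with r hr hr0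
  simp only [Function.comp_apply, Pi.div_apply] at hr ⊢
  have h2 : θ * Real.log r < 0 := mul_neg_of_pos_of_neg hθ hr0
  rw [abs_of_neg h2, Real.div_rpow hr.le (by linarith), orbitU, ← rpow_eq_exp_mul_log hr]

section

variable {ι : Type*} {l : Filter ι} {T m : ℝ}

theorem tendsto_comp_log {f : ι → ℝ → ℝ} {g : ℝ → ℝ} (hg : ContinuousOn g (Iio T))
    (h : TendstoLocallyUniformlyOn f g l (Iio T)) {x : ℝ} (hx : x ∈ Ioo 0 (Real.exp T)) :
    Tendsto (fun y : ι × ℝ => f y.1 (Real.log y.2)) (l ×ˢ 𝓝[Ioo 0 (Real.exp T)] x)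
      (𝓝 (g (Real.log x))) := by
  have hlog : ∀ r ∈ Ioo 0 (Real.exp T), Real.log r ∈ Iio T := fun r hr =>
    (Real.log_lt_iff_lt_exp hr.1).2 hr.2
  have h1 := (tendstoLocallyUniformlyOn_iff_joint hg).1 h _ (hlog x hx)
  refine h1.comp (tendsto_fst.prodMk (Tendsto.comp (g := Real.log) ?_ tendsto_snd))
  refine tendsto_nhdsWithin_of_tendsto_nhds_of_eventually_within _
    ((Real.continuousAt_log hx.1.ne').mono_left nhdsWithin_le_nhds) ?_
  filter_upwards [self_mem_nhdsWithin] with r hr using hlog r hr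

theorem tendstoUniformlyOn_of_joint {f : ι → ℝ → ℝ} {g : ℝ → ℝ} {s K : Set ℝ}
    (hg : ContinuousOn g s)
    (h : ∀ x ∈ s, Tendsto (fun y : ι × ℝ => f y.1 y.2) (l ×ˢ 𝓝[s] x) (𝓝 (g x))) (hK : K ⊆ s)
    (hc : IsCompact K) : TendstoUniformlyOn f g l K :=
  (tendstoLocallyUniformlyOn_iff_tendstoUniformlyOn_of_compact hc).1
    (((tendstoLocallyUniformlyOn_iff_joint hg).2 h).mono hK)

/-- Locally uniform convergence of orbits gives `C²` convergence of the functions `orbitU`. -/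
theorem tendstoUniformlyOn_orbitU {β δ θ c : ℝ} (hm : 0 < m) {v p q : ι → ℝ → ℝ}
    {v' p' q' : ℝ → ℝ} (h' : IsOrbit β δ θ ((m + 1) / m) c T v' p' q')
    (hv : TendstoLocallyUniformlyOn v v' l (Iio T)) (hp : TendstoLocallyUniformlyOn p p' l (Iio T))
    (hq : TendstoLocallyUniformlyOn q q' l (Iio T)) {K : Set ℝ} (hK : K ⊆ Ioo 0 (Real.exp T))
    (hc : IsCompact K) :
    TendstoUniformlyOn (fun i => orbitU m (v i)) (orbitU m v') l K ∧
    TendstoUniformlyOn (fun i => orbitU₁ m (v i) (q i)) (orbitU₁ m v' q') l K ∧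
    TendstoUniformlyOn (fun i => orbitU₂ β δ m (v i) (p i) (q i)) (orbitU₂ β δ m v' p' q') l K := by
  have hlog : ∀ r ∈ Ioo 0 (Real.exp T), Real.log r < T := fun r hr =>
    (Real.log_lt_iff_lt_exp hr.1).2 hr.2
  have hvc : ContinuousOn v' (Iio T) := fun t ht =>
    (h'.deriv_v t ht).continuousAt.continuousWithinAt
  have hpc : ContinuousOn p' (Iio T) := fun t ht =>
    (h'.deriv_p t ht).continuousAt.continuousWithinAt
  have hqc : ContinuousOn q' (Iio T) := fun t ht =>
    (h'.deriv_q t ht).continuousAt.continuousWithinAt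
  have hlv : ∀ x ∈ Ioo 0 (Real.exp T), Tendsto (fun y : ι × ℝ => Real.log (v y.1 (Real.log y.2)))
      (l ×ˢ 𝓝[Ioo 0 (Real.exp T)] x) (𝓝 (Real.log (v' (Real.log x)))) := fun x hx =>
    (tendsto_comp_log hvc hv hx).log (h'.v_pos _ (hlog x hx)).ne'
  have hy : ∀ x : ℝ, Tendsto (fun y : ι × ℝ => y.2) (l ×ˢ 𝓝[Ioo 0 (Real.exp T)] x) (𝓝 x) :=
    fun x => tendsto_snd.mono_right nhdsWithin_le_nhds
  have h1 : ∀ x ∈ Ioo 0 (Real.exp T), Tendsto (fun y : ι × ℝ => orbitU₁ m (v y.1) (q y.1) y.2)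
      (l ×ˢ 𝓝[Ioo 0 (Real.exp T)] x) (𝓝 (orbitU₁ m v' q' x)) := fun x hx =>
    ((Real.continuous_exp.tendsto _).comp ((((hlv x hx).const_mul _).add
      (tendsto_comp_log hqc hq hx)).sub_const _)).div (hy x) hx.1.ne'
  have hc1 : ContinuousOn (orbitU₁ m v' q') (Ioo 0 (Real.exp T)) := fun x hx =>
    (h'.hasDerivAt_orbitU₁ hm hx.1 (hlog x hx)).continuousAt.continuousWithinAt
  have hlogc : ContinuousOn Real.log (Ioo 0 (Real.exp T)) := fun x hx =>
    (Real.continuousAt_log hx.1.ne').continuousWithinAt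
  refine ⟨tendstoUniformlyOn_of_joint (fun x hx => ?_) (fun x hx => ?_) hK hc,
    tendstoUniformlyOn_of_joint hc1 h1 hK hc,
    tendstoUniformlyOn_of_joint ?_ (fun x hx => ?_) hK hc⟩
  · exact (h'.hasDerivAt_orbitU hm hx.1 (hlog x hx)).continuousAt.continuousWithinAt
  · exact (Real.continuous_exp.tendsto _).comp ((hlv x hx).const_mul _)
  · have hpl : ContinuousOn (fun r => p' (Real.log r)) (Ioo 0 (Real.exp T)) :=
      hpc.comp hlogc hlog
    have h2 : ContinuousOn (fun r => (Real.exp (p' (Real.log r)) - δ) / β - 1)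
        (Ioo 0 (Real.exp T)) :=
      ((hpl.rexp.sub continuousOn_const).div_const β).sub continuousOn_const
    exact (hc1.mul h2).div continuousOn_id fun x hx => hx.1.ne'
  · exact ((h1 x hx).mul (((((Real.continuous_exp.tendsto _).comp
      (tendsto_comp_log hpc hp hx)).sub_const δ).div_const β).sub_const 1)).div (hy x) hx.1.ne'

end

/-! ### Zero numbers and the radial problem -/

theorem natCast_lt_zeroNumber {I : Set ℝ} {h : ℝ → ℝ} (n : ℕ) (x : ℕ → ℝ) (hx : StrictMono x)
    (hI : ∀ j ≤ n, x j ∈ I) (h0 : ∀ j ≤ n, h (x j) = 0) : (n : ℕ∞) < zeroNumber I h := by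
  have h1 : (x '' (Finset.range (n + 1) : Set ℕ)).encard = n + 1 := by
    rw [hx.injective.injOn.encard_image, Set.encard_coe_eq_coe_finsetCard, Finset.card_range]
    push_cast
    rfl
  have h2 : x '' (Finset.range (n + 1) : Set ℕ) ⊆ {r ∈ I | h r = 0} := by
    rintro _ ⟨j, hj, rfl⟩
    have hj' : j ≤ n := by
      have := Finset.mem_range.1 (Finset.mem_coe.1 hj)
      omega
    exact ⟨hI j hj', h0 j hj'⟩
  have h3 := Set.encard_le_encard h2
  rw [h1] at h3
  refine lt_of_lt_of_le ?_ h3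
  exact_mod_cast Nat.lt_succ_self n

theorem IsRadialSolution.monotoneOn {α β γ m r₀ a : ℝ} {u : ℝ → ℝ} (hαβ : β < α)
    (hβ : 1 ≤ β) (h : IsRadialSolution α β γ (expNonlin m) r₀ a u) : MonotoneOn u (Ico 0 r₀) := by
  obtain ⟨F, hF⟩ := h.exists_isFluxPair hαβ hβ
  refine monotoneOn_of_deriv_nonneg (convex_Ico _ _) h.continuousOn ?_ ?_
  · rw [interior_Ico]
    exact fun r hr => (hF.deriv_u r hr).differentiableAt.differentiableWithinAt
  · rw [interior_Ico]
    intro r hr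
    rw [(hF.deriv_u r hr).deriv]
    exact Real.rpow_nonneg (mul_nonneg (Real.rpow_nonneg hr.1.le _) (hF.F_pos r hr).le) _

/-- A family of radial solutions that converges pointwise to a singular solution converges
jointly at the origin: by monotonicity, its values near `0` are below its value at a fixed
point. -/
theorem tendsto_joint_zero {α β γ m r₀ : ℝ} {U : ℝ → ℝ → ℝ} {u : ℝ → ℝ} (hαβ : β < α)
    (hβ : 1 ≤ β) (hr₀ : 0 < r₀) (hu : IsRadialSolution α β γ (expNonlin m) r₀ 0 u)
    (hU : ∀ a : ℝ, 0 < a → IsRadialSolution α β γ (expNonlin m) r₀ a (U a))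
    (hlim : ∀ r ∈ Ioo 0 r₀, Tendsto (fun a => U a r) (𝓝[>] 0) (𝓝 (u r))) :
    Tendsto (fun y : ℝ × ℝ => U y.1 y.2) (𝓝[>] 0 ×ˢ 𝓝[Ico 0 r₀] 0) (𝓝 (u 0)) := by
  rw [hu.initial, Metric.tendsto_nhds]
  intro ε hε
  obtain ⟨r₁, hr₁, hr₁ε⟩ := (((hu.tendsto hr₀).eventually (Iio_mem_nhds hε)).and
    (Ioo_mem_nhdsGT hr₀)).exists
  have h1 := (hlim r₁ hr₁ε).eventually (Iio_mem_nhds hr₁)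
  have h2 : ∀ᶠ r in 𝓝[Ico 0 r₀] (0 : ℝ), r ∈ Ico 0 r₀ ∧ r < r₁ :=
    (eventually_mem_nhdsWithin).and
      (nhdsWithin_le_nhds (Iio_mem_nhds hr₁ε.1))
  filter_upwards [(h1.and self_mem_nhdsWithin).prod_mk h2] with y hy
  have ha : 0 < y.1 := hy.1.2
  have hm := (hU y.1 ha).monotoneOn hαβ hβ
  have h3 := hm hy.2.1 ⟨hr₁ε.1.le, hr₁ε.2⟩ hy.2.2.le
  have h4 := hm ⟨le_rfl, hr₀⟩ hy.2.1 hy.2.1.1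
  rw [(hU y.1 ha).initial] at h4
  have h5 : U y.1 r₁ < ε := hy.1.1
  rw [Real.dist_eq, sub_zero, abs_of_nonneg (by linarith)]
  linarith

theorem proposition2p4 (α β γ m : ℝ) (hγα : α < γ) (hαβ : β < α) (hβ : 1 ≤ β) (hm : 0 < m) :
    ∃ r₀ : ℝ, 0 < r₀ ∧ ∃ uStar : ℝ → ℝ,
      IsUniqueRadialSolution α β γ (expNonlin m) r₀ 0 uStar ∧
      Asymptotics.IsEquivalent (𝓝[>] (0 : ℝ)) uStar
        (fun r => |(γ - α + β) * Real.log r| ^ (-(1 / m))) ∧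
      ∃ U : ℝ → ℝ → ℝ,
        (∀ a : ℝ, 0 < a → IsUniqueRadialSolution α β γ (expNonlin m) r₀ a (U a)) ∧
        (TendstoC2Loc r₀ U uStar ∧ TendstoCLoc r₀ U uStar) ∧
        (4 * γ > (α - β) * (β + 4) →
          ∀ ρ ∈ Ioo 0 r₀,
            Tendsto (fun a => zeroNumber (Ioo 0 ρ) (fun r => U a r - uStar r))
              (𝓝[>] (0 : ℝ)) (𝓝 ⊤)) := by
  have hβ0 : 0 < β := by linarith
  have hδ : 0 < α - β := by linarith
  have hθ : 0 < γ - α + β := by linarith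
  have hκ : 0 < (m + 1) / m := by positivity
  obtain ⟨T, τ, W, M, k, ℓ, B, H⟩ := exists_isOrbitComparison hβ hδ hθ hκ (β * Real.log m)
  obtain ⟨r₀, hr₀T⟩ : ∃ r₀, r₀ = Real.exp T := ⟨_, rfl⟩
  have hr₀ : 0 < r₀ := by rw [hr₀T]; exact Real.exp_pos T
  have hlogr₀ : Real.log r₀ = T := by rw [hr₀T, Real.log_exp]
  have hlog : ∀ r ∈ Ioo 0 r₀, Real.log r < T := fun r hr => by
    rw [← hlogr₀]
    exact Real.log_lt_log hr.1 hr.2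
  have hex : ∀ a : ℝ, ∃ u F, 0 < a → IsFluxPair α β γ m r₀ u F ∧ Continuous u ∧ u 0 = a := by
    intro a
    by_cases ha : 0 < a
    · obtain ⟨u, F, h⟩ := exists_regular hγα hαβ hβ hm hr₀ ha
      exact ⟨u, F, fun _ => h⟩
    · exact ⟨0, 0, fun h => absurd h ha⟩
  choose U F hUF using hex
  have hUsol : ∀ a : ℝ, 0 < a → IsRadialSolution α β γ (expNonlin m) r₀ a (U a) := fun a ha =>
    (hUF a ha).1.isRadialSolution hβ0 (hUF a ha).2.1.continuousOn (hUF a ha).2.2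
  have hflux : ∀ {u G : ℝ → ℝ}, IsFluxPair α β γ m r₀ u G →
      IsOrbit β (α - β) (γ - α + β) ((m + 1) / m) (β * Real.log m) T
        (orbitV m u) (orbitP γ m u G) (orbitQ α β m u G) := fun h => by
    have := h.isOrbit hβ0 hm hr₀
    rwa [hlogr₀] at this
  have hpos : ∀ᶠ a in 𝓝[>] (0 : ℝ), 0 < a := self_mem_nhdsWithin
  have hUorb := hpos.mono fun a ha => hflux (hUF a ha).1
  -- Along a regular solution, `v` tends to `a^{-m}` at `-∞`, which is large if `a` is small.
  have hlarge : ∀ N < T, ∀ᶠ a in 𝓝[>] (0 : ℝ), ∃ t ≤ N, B N < orbitV m (U a) t := by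
    intro N _
    filter_upwards [hpos, (tendsto_exp_neg_mul_log hm).eventually_gt_atTop (B N)] with a ha haB
    exact ((eventually_le_atBot N).and ((tendsto_orbitV ha ((hUsol a ha).tendsto hr₀)).eventually
      (Ioi_mem_nhds haB))).exists
  obtain ⟨v', p', q', h', hv', hp', hq', hW⟩ := H.exists_limit hβ0 hκ hUorb hlarge
  have hv'top := h'.tendsto_v_atTop hβ0 hθ hκ hW
  -- The value of `orbitU` at `0` is meaningless and has to be corrected.
  obtain ⟨uStar, huStar⟩ : ∃ u, u = Function.update (orbitU m v') 0 0 := ⟨_, rfl⟩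
  have heq : ∀ r, 0 < r → uStar r = orbitU m v' r := fun r hr => by
    rw [huStar, Function.update_of_ne hr.ne']
  have heq' : ∀ r, 0 < r → uStar =ᶠ[𝓝 r] orbitU m v' := fun r hr => by
    filter_upwards [Ioi_mem_nhds hr] with s hs using heq s hs
  have hstar : IsRadialSolution α β γ (expNonlin m) r₀ 0 uStar := by
    have h1 : IsFluxPair α β γ m r₀ (orbitU m v') _ :=
      IsOrbit.isFluxPair hβ0 hm (by rw [hlogr₀]; exact h')
    have h2 : IsFluxPair α β γ m r₀ uStar
        (fun r => Real.exp (γ * Real.log r + v' (Real.log r) - p' (Real.log r))) :=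
      ⟨fun r hr => by rw [heq r hr.1]; exact h1.u_pos r hr, h1.F_pos,
        fun r hr => (h1.deriv_u r hr).congr_of_eventuallyEq (heq' r hr.1),
        fun r hr => by rw [heq r hr.1]; exact h1.deriv_F r hr⟩
    refine h2.isRadialSolution hβ0 (fun r hr => ?_) (by rw [huStar, Function.update_self])
    rcases hr.1.eq_or_lt with h0 | h0
    · rw [← h0, huStar, continuousWithinAt_update_same]
      refine (tendsto_orbitU hm hv'top).mono_left (nhdsWithin_mono _ ?_)
      exact fun x hx => lt_of_le_of_ne hx.1.1 (Ne.symm hx.2)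
    · exact (h2.deriv_u r ⟨h0, hr.2⟩).continuousAt.continuousWithinAt
  have hUeq : ∀ a, 0 < a → ∀ r ∈ Ioo 0 r₀, orbitU m (orbitV m (U a)) r = U a r := fun a ha r hr =>
    orbitU_orbitV hm hr.1 ((hUsol a ha).pos r hr)
  have hC2 : TendstoC2Loc r₀ U uStar := by
    intro K hK hKc
    rw [hr₀T] at hK
    obtain ⟨c0, c1, c2⟩ := tendstoUniformlyOn_orbitU hm h' hv' hp' hq' hK hKc
    rw [← hr₀T] at hK
    have e0 : ∀ a, 0 < a → ∀ r ∈ Ioo 0 r₀, U a =ᶠ[𝓝 r] orbitU m (orbitV m (U a)) :=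
      fun a ha r hr => by
        filter_upwards [Ioo_mem_nhds hr.1 hr.2] with s hs using (hUeq a ha s hs).symm
    have e1 : ∀ a, 0 < a → ∀ r ∈ Ioo 0 r₀,
        deriv (U a) r = orbitU₁ m (orbitV m (U a)) (orbitQ α β m (U a) (F a)) r :=
      fun a ha r hr => by
        rw [(e0 a ha r hr).deriv_eq,
          ((hflux (hUF a ha).1).hasDerivAt_orbitU hm hr.1 (hlog r hr)).deriv]
    have e2 : ∀ a, 0 < a → ∀ r ∈ Ioo 0 r₀, deriv (deriv (U a)) r = orbitU₂ β (α - β) m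
        (orbitV m (U a)) (orbitP γ m (U a) (F a)) (orbitQ α β m (U a) (F a)) r :=
      fun a ha r hr => by
        have : deriv (U a) =ᶠ[𝓝 r] orbitU₁ m (orbitV m (U a)) (orbitQ α β m (U a) (F a)) := by
          filter_upwards [Ioo_mem_nhds hr.1 hr.2] with s hs using e1 a ha s hs
        rw [this.deriv_eq,
          ((hflux (hUF a ha).1).hasDerivAt_orbitU₁ hm hr.1 (hlog r hr)).deriv]
    have f1 : ∀ r ∈ Ioo 0 r₀, deriv uStar r = orbitU₁ m v' q' r := fun r hr => by
      rw [(heq' r hr.1).deriv_eq, (h'.hasDerivAt_orbitU hm hr.1 (hlog r hr)).deriv]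
    have f2 : ∀ r ∈ Ioo 0 r₀, deriv (deriv uStar) r = orbitU₂ β (α - β) m v' p' q' r :=
      fun r hr => by
        have : deriv uStar =ᶠ[𝓝 r] orbitU₁ m v' q' := by
          filter_upwards [Ioo_mem_nhds hr.1 hr.2] with s hs using f1 s hs
        rw [this.deriv_eq, (h'.hasDerivAt_orbitU₁ hm hr.1 (hlog r hr)).deriv]
    refine ⟨(c0.congr (hpos.mono fun a ha r hr => hUeq a ha r (hK hr))).congr_right fun r hr =>
        (heq r (hK hr).1).symm,
      (c1.congr (hpos.mono fun a ha r hr => (e1 a ha r (hK hr)).symm)).congr_right fun r hr =>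
        (f1 r (hK hr)).symm,
      (c2.congr (hpos.mono fun a ha r hr => (e2 a ha r (hK hr)).symm)).congr_right fun r hr =>
        (f2 r (hK hr)).symm⟩
  refine ⟨r₀, hr₀, uStar, ⟨hstar, fun w hw => ?_⟩, ?_, U, fun a ha => ⟨hUsol a ha, fun w hw => ?_⟩,
    ⟨hC2, ?_⟩, ?_⟩
  · obtain ⟨G, hG⟩ := hw.exists_isFluxPair hαβ hβ
    have hwtop : Tendsto (orbitV m w) atBot atTop := by
      have h1 : Tendsto w (𝓝[>] 0) (𝓝[>] 0) := by
        refine tendsto_nhdsWithin_of_tendsto_nhds_of_eventually_within _ (hw.tendsto hr₀) ?_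
        filter_upwards [Ioo_mem_nhdsGT hr₀] with r hr using hw.pos r hr
      exact (tendsto_exp_neg_mul_log hm).comp (h1.comp Real.tendsto_exp_atBot_nhdsGT)
    intro r hr
    rcases hr.1.eq_or_lt with h0 | h0
    · rw [← h0, hw.initial, hstar.initial]
    · have h1 := H.eq_of_tendsto_atTop hβ0 hκ (hflux hG) h' hwtop hv'top _ (hlog r ⟨h0, hr.2⟩)
      rw [heq r h0, ← orbitU_orbitV hm h0 (hw.pos r ⟨h0, hr.2⟩), orbitU, orbitU, h1]
  · refine (isEquivalent_orbitU hθ hv'top (h'.tendsto_v_div hβ0 hδ hθ hκ hW)).congr_left ?_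
    filter_upwards [self_mem_nhdsWithin] with r hr using (heq r hr).symm
  · obtain ⟨G, hG⟩ := hw.exists_isFluxPair hαβ hβ
    have hv₁ := tendsto_orbitV (m := m) ha (hw.tendsto hr₀)
    have hv₂ := tendsto_orbitV (m := m) ha ((hUsol a ha).tendsto hr₀)
    intro r hr
    rcases hr.1.eq_or_lt with h0 | h0
    · rw [← h0, hw.initial, (hUsol a ha).initial]
    · have h1 := IsOrbit.eq_of_tendsto hβ0 hκ (hflux hG) (hflux (hUF a ha).1) (Real.exp_pos _)
        hv₁ hv₂ ((hflux hG).tendsto_p hβ0 hδ hθ hκ hv₁)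
        ((hflux (hUF a ha).1).tendsto_p hβ0 hδ hθ hκ hv₂) _ (hlog r ⟨h0, hr.2⟩)
      rw [← hUeq a ha r ⟨h0, hr.2⟩, ← orbitU_orbitV hm h0 (hw.pos r ⟨h0, hr.2⟩), orbitU, orbitU, h1]
  · intro K hK hKc
    refine tendstoUniformlyOn_of_joint hstar.continuousOn (fun x hx => ?_) hK hKc
    rcases hx.1.eq_or_lt with h0 | h0
    · rw [← h0]
      refine tendsto_joint_zero hαβ hβ hr₀ hstar hUsol fun r hr => ?_
      exact (hC2 {r} (singleton_subset_iff.2 hr) isCompact_singleton).1.tendsto_at rfl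
    · have hsub : Icc (x / 2) ((x + r₀) / 2) ⊆ Ioo 0 r₀ := fun y hy =>
        ⟨by linarith [hy.1], by linarith [hy.2, hx.2]⟩
      have h1 := (hC2 _ hsub isCompact_Icc).1.tendstoLocallyUniformlyOn
      rw [tendstoLocallyUniformlyOn_iff_joint
        (hstar.continuousOn.mono (hsub.trans Ioo_subset_Ico_self))] at h1
      have h2 := h1 x ⟨by linarith, by linarith [hx.2]⟩
      rw [nhdsWithin_eq_nhds.2 (Icc_mem_nhds (by linarith) (by linarith [hx.2]))] at h2
      exact h2.mono_left (Filter.prod_mono le_rfl nhdsWithin_le_nhds)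
  · intro hcond ρ hρ
    have hdisc : (α - β) * β < 4 * (γ - α + β) := by linarith
    -- There is room for `n + 1` disjoint intervals of length `ℓ` between `N + τ` and `log ρ`.
    rw [ENat.tendsto_nhds_top_iff_natCast_lt]
    intro n
    obtain ⟨N, hN⟩ : ∃ N, N = min (T - 1) (Real.log ρ - τ - 2 * (n + 1) * ℓ) := ⟨_, rfl⟩
    have hNT : N < T := by rw [hN]; exact (min_le_left _ _).trans_lt (by linarith)
    have hNρ : N + τ + 2 * (n + 1) * ℓ ≤ Real.log ρ := by
      have := min_le_right (T - 1) (Real.log ρ - τ - 2 * (n + 1) * ℓ)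
      rw [← hN] at this
      linarith
    have hρT := hlog ρ hρ
    filter_upwards [hpos, hlarge N hNT] with a ha hBa
    have hB' : ∃ t ≤ N, B N < v' t :=
      ((eventually_le_atBot N).and (hv'top.eventually_gt_atTop (B N))).exists
    have hz : ∀ j : ℕ, ∃ t, (N + τ + 2 * j * ℓ ≤ t ∧ t ≤ N + τ + 2 * j * ℓ + ℓ) ∧
        (j ≤ n → orbitV m (U a) t = v' t) := by
      intro j
      by_cases hj : j ≤ n
      · have hj' : (j : ℝ) ≤ n := by exact_mod_cast hj
        have h1 : 2 * (j : ℝ) * ℓ ≤ 2 * n * ℓ :=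
          mul_le_mul_of_nonneg_right (by linarith) H.ℓ_pos.le
        have h2 : 0 ≤ 2 * (j : ℝ) * ℓ := by
          have := H.ℓ_pos
          positivity
        obtain ⟨t, ht, hte⟩ := H.rotate hdisc _ _ _ _ _ _ (hflux (hUF a ha).1) h' N hNT hBa hB'
          (N + τ + 2 * j * ℓ) (by linarith) (by linarith [H.ℓ_pos])
        exact ⟨t, ht, fun _ => hte⟩
      · exact ⟨_, ⟨le_rfl, by linarith [H.ℓ_pos]⟩, fun h => absurd h hj⟩
    choose t ht hte using hz
    have hmono : StrictMono t := strictMono_nat_of_lt_succ fun j => by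
      have h1 := (ht j).2
      have h2 := (ht (j + 1)).1
      push_cast at h2
      linarith [H.ℓ_pos]
    have hI : ∀ j ≤ n, Real.exp (t j) ∈ Ioo 0 ρ := by
      intro j hj
      have hj' : (j : ℝ) ≤ n := by exact_mod_cast hj
      have h1 : 2 * (j : ℝ) * ℓ ≤ 2 * n * ℓ :=
        mul_le_mul_of_nonneg_right (by linarith) H.ℓ_pos.le
      refine ⟨Real.exp_pos _, (Real.lt_log_iff_exp_lt hρ.1).1 ?_⟩
      linarith [(ht j).2, H.ℓ_pos]
    refine natCast_lt_zeroNumber n (fun j => Real.exp (t j))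
      (Real.exp_strictMono.comp hmono) hI fun j hj => ?_
    have hr : Real.exp (t j) ∈ Ioo 0 r₀ := ⟨(hI j hj).1, (hI j hj).2.trans hρ.2⟩
    rw [heq _ hr.1, ← hUeq a ha _ hr, orbitU, orbitU, Real.log_exp, hte j hj, sub_self]

end
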